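/- Let $\widehat{\mathbb C}=\mathbb C\cup\{\infty\}$ be the Riemann sphere with its spherical metric $\sigma$ (the length metric of $\frac{2|dz|}{1+|z|^2}$). A *Jordan region* is a nonempty connected open subset of $\widehat{\mathbb C}$ whose boundary is a Jordan curve, and a *geometric disk* is an open ball in the metric $\sigma$ of radius $r$ with $0<r<\pi$. An orientation-preserving homeomorphism $f$ between open subsets of $\mathbb C$ is *quasiconformal* if there is $K\ge 1$ such that $f\in W^{1,2}_{\mathrm{loc}}$ and $\|Df\|^2\le K J_f$ almost everywhere; a homeomorphism $f\colon\widehat{\mathbb C}\to\widehat{\mathbb C}$ is quasiconformal if its restriction to $\widehat{\mathbb C}\setminus\{\infty,f^{-1}(\infty)\}$ is. A *quasidisk* is the image of the unit disk $\mathbb D$ under a quasiconformal homeomorphism of $\widehat{\mathbb C}$. Let $U,V\subset\widehat{\mathbb C}$ be disjoint Jordan regions such that the pair $U,V$ is quasiconformally circularizable, i.e., there exists a quasiconformal homeomorphism $\phi\colon\widehat{\mathbb C}\to\widehat{\mathbb C}$ such that $\phi(U)$ and $\phi(V)$ are geometric disks. Let $W\subset\widehat{\mathbb C}\setminus(U\cup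 V)$ be a Jordan region such that $\partial W\cap\partial U\cap\partial V\neq\emptyset$. Then $W$ is not a quasidisk. -/

import Mathlib

open Set MeasureTheory
open scoped OnePoint

noncomputable section

/-- The chordal metric on the Riemann sphere `OnePoint ℂ = ℂ ∪ {∞}`. -/
def chordalDist : OnePoint ℂ → OnePoint ℂ → ℝ
  | OnePoint.some z, OnePoint.some w =>
      2 * ‖z - w‖ / (Real.sqrt (1 + ‖z‖ ^ 2) * Real.sqrt (1 + ‖w‖ ^ 2))
  | OnePoint.some z, ∞ => 2 / Real.sqrt (1 + ‖z‖ ^ 2)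
  | ∞, OnePoint.some w => 2 / Real.sqrt (1 + ‖w‖ ^ 2)
  | ∞, ∞ => 0

/-- The spherical (great-circle) metric on the Riemann sphere, i.e. the length metric of
`2|dz| / (1 + |z|²)`: a chord of length `c` of the unit sphere spans an arc of length
`2 arcsin (c / 2)`. -/
def sphericalDist (z w : OnePoint ℂ) : ℝ :=
  2 * Real.arcsin (chordalDist z w / 2)

/-- A geometric disk: an open ball of radius `0 < r < π` in the spherical metric. -/
def IsGeometricDisk (D : Set (OnePoint ℂ)) : Prop :=
  ∃ (a : OnePoint ℂ) (r : ℝ), 0 < r ∧ r < Real.pi ∧ D = {z | sphericalDist a z < r}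

/-- A Jordan curve in the Riemann sphere: a homeomorphic image of the circle. -/
def IsJordanCurve (J : Set (OnePoint ℂ)) : Prop :=
  ∃ γ : Circle → OnePoint ℂ, Continuous γ ∧ Function.Injective γ ∧ range γ = J

/-- A Jordan region: a (nonempty, connected, open) region of the Riemann sphere bounded by a
Jordan curve. -/
def IsJordanRegion (U : Set (OnePoint ℂ)) : Prop :=
  IsOpen U ∧ IsConnected U ∧ IsJordanCurve (frontier U)

/-- `g` is the weak (distributional) differential of `f` in the open set `U`: for each test
function `φ` on `U` and each direction `v`, one has `∫ (∂ᵥ φ) f = - ∫ φ (g · v)`. -/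
def IsWeakDeriv (U : Set ℂ) (f : ℂ → ℂ) (g : ℂ → ℂ →L[ℝ] ℂ) : Prop :=
  ∀ φ : ℂ → ℝ, ContDiff ℝ (⊤ : ℕ∞) φ → HasCompactSupport φ → tsupport φ ⊆ U → ∀ v : ℂ,
    ∫ z, (fderiv ℝ φ z v) • f z = - ∫ z, φ z • g z v

/-- `f` is in the Sobolev space `W^{1,2}_loc(U)`, with weak differential `g`. -/
def IsSobolevLoc (U : Set ℂ) (f : ℂ → ℂ) (g : ℂ → ℂ →L[ℝ] ℂ) : Prop :=
  (∀ C : Set ℂ, IsCompact C → C ⊆ U →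
    MemLp f 2 (volume.restrict C) ∧ MemLp g 2 (volume.restrict C)) ∧
  IsWeakDeriv U f g

/-- `f` preserves orientation on `U` (for `f` injective and continuous on the open set `U`): if
`closedBall z r ⊆ U`, then the image of the positively oriented circle of radius `r` about `z`
has winding number `1` about `f z`; the winding number is read off a continuous argument `θ`. -/
def IsOrientationPreservingOn (U : Set ℂ) (f : ℂ → ℂ) : Prop :=
  ∀ (z : ℂ) (r : ℝ), 0 < r → Metric.closedBall z r ⊆ U →
    ∃ θ : ℝ → ℝ, Continuous θ ∧ θ (2 * Real.pi) = θ 0 + 2 * Real.pi ∧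
      ∀ t : ℝ, f (circleMap z r t) - f z =
        (‖f (circleMap z r t) - f z‖ : ℂ) * Complex.exp (θ t * Complex.I)

/-- A homeomorphism `f` between two open subsets `f.source` and `f.target` of the plane is
`K`-quasiconformal, `K ≥ 1`: it preserves orientation, lies in `W^{1,2}_loc`, and satisfies
`‖Df‖² ≤ K J_f` almost everywhere. -/
def IsPlanarQuasiconformal (K : ℝ) (f : OpenPartialHomeomorph ℂ ℂ) : Prop :=
  1 ≤ K ∧ IsOrientationPreservingOn f.source f ∧
    ∃ Df : ℂ → ℂ →L[ℝ] ℂ, IsSobolevLoc f.source f Df ∧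
      ∀ᵐ z ∂(volume.restrict f.source), ‖Df z‖ ^ 2 ≤ K * (Df z).det

/-- The inclusion of `ℂ` into the Riemann sphere, as a homeomorphism onto its open image. -/
def planeChart : OpenPartialHomeomorph ℂ (OnePoint ℂ) :=
  (OnePoint.isOpenEmbedding_coe (X := ℂ)).toOpenPartialHomeomorph (↑)

/-- The restriction of a homeomorphism `f` of the sphere to `Ĉ \ {∞, f⁻¹(∞)}`, as a
homeomorphism between open subsets of the plane. -/
def planarRestriction (f : OnePoint ℂ ≃ₜ OnePoint ℂ) : OpenPartialHomeomorph ℂ ℂ :=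
  (planeChart.trans f.toOpenPartialHomeomorph).trans planeChart.symm

/-- The restriction is defined exactly at the finite points that are not sent to `∞`. -/
theorem mem_planarRestriction_source (f : OnePoint ℂ ≃ₜ OnePoint ℂ) (z : ℂ) :
    z ∈ (planarRestriction f).source ↔ f z ≠ ∞ := by
  simp [planarRestriction, planeChart, OnePoint.ne_infty_iff_exists]

/-- On its source the restriction has the values of `f`. -/
theorem coe_planarRestriction (f : OnePoint ℂ ≃ₜ OnePoint ℂ) (z : ℂ) (hz : f z ≠ ∞) :
    ((planarRestriction f z : ℂ) : OnePoint ℂ) = f z := by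
  have h : f z ∈ planeChart.target := by
    simpa [planeChart, OnePoint.ne_infty_iff_exists] using hz
  exact planeChart.right_inv h

/-- A homeomorphism of the Riemann sphere is quasiconformal if its restriction to the complement
of `{∞, f⁻¹(∞)}` is `K`-quasiconformal for some `K`. -/
def IsQuasiconformal (f : OnePoint ℂ ≃ₜ OnePoint ℂ) : Prop :=
  ∃ K : ℝ, IsPlanarQuasiconformal K (planarRestriction f)

/-- A quasidisk: the image of the unit disk under a quasiconformal homeomorphism of the sphere. -/
def IsQuasidisk (W : Set (OnePoint ℂ)) : Prop :=
  ∃ f : OnePoint ℂ ≃ₜ OnePoint ℂ, IsQuasiconformal f ∧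
    W = f '' ((fun z : ℂ => (z : OnePoint ℂ)) '' Metric.ball (0 : ℂ) 1)

/-- The pair `U`, `V` is quasiconformally circularizable: some quasiconformal homeomorphism of the
sphere maps both sets onto geometric disks. -/
def IsQCCircularizable (U V : Set (OnePoint ℂ)) : Prop :=
  ∃ φ : OnePoint ℂ ≃ₜ OnePoint ℂ, IsQuasiconformal φ ∧
    IsGeometricDisk (φ '' U) ∧ IsGeometricDisk (φ '' V)

end

noncomputable section

open Filter Topology Convolution ENNReal

/-! Suppose W = f(𝔻) with f quasiconformal, and let f(q), ‖q‖ = 1, be a common boundary point. The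
disks φ(U) and φ(V) are disjoint and share the boundary point φ(f(q)), so they are tangent there. A
Möbius map m taking this point to ∞ opens them up to disjoint half-planes, necessarily parallel.
Hence g = m ∘ φ ∘ f maps the closed disk minus q into a strip, with g(q) = ∞: W is squeezed into a
cusp.

A punctured neighbourhood of q in the closed disk is connected, so its image runs into one end of
the strip only. Therefore on the two sides of q there are points x, y of the unit circle, as close
to q as desired, with |g(x) - g(y)| ≤ 2h and both images far from g(-q). The ring 2h < |w - g(x)| <
R separates g(x), g(y) from g(q) = ∞ and g(-q), and R may be prescribed arbitrarily large, so a
logarithmic cutoff u on it has energy O(1 / log(R / 2h)). In the domain nothing degenerates: for one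
of the two points, called e, the other one e' satisfies |e - e'| ≥ 3/2 |e - q|, so the circles about
e in an annulus of fixed modulus separate {e, q} from {e', -q}. Each of them meets the connected
preimages of {u = 0} and {u = 1}, and the length-area inequality bounds the energy of u ∘ g below by
a constant. Since g distorts energy by a bounded factor, this is a contradiction
(`false_of_strip_of_hasEnergyLE`).

The analytic core is that distortion bound (`IsPlanarQuasiconformal.hasEnergyLE_comp`). The
inequality ‖Df‖² ≤ K J_f reduces it to the area inequality ∫ ρ(f) J_f ≤ ∫ ρ
(`lintegral_comp_mul_det_le`), which comes from degree theory: by Green's formula a smooth map of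
boundary winding number one pulls a bump back to total mass one; L² approximation carries this over
to Sobolev maps, and averaging over the centres of the bumps gives the inequality. Energy is phrased
through C¹ approximants (`HasEnergyLE`), so that neither pointwise differentiability of f nor a
Sobolev chain rule is needed. -/

/-! ### Mollification of Sobolev functions -/

theorem ContDiffBump.lintegral_enorm_normed (φ : ContDiffBump (0 : ℂ)) :
    ∫⁻ t, ‖φ.normed volume t‖ₑ = 1 := by
  rw [← ofReal_integral_norm_eq_lintegral_enorm φ.integrable_normed]
  simp [abs_of_nonneg (φ.nonneg_normed _), φ.integral_normed]

/-- Young's inequality for a kernel of mass one: Cauchy–Schwarz after splitting the kernel into two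
square roots, then Tonelli and translation invariance. -/
theorem ContDiffBump.eLpNorm_normed_convolution_le {E : Type*} [NormedAddCommGroup E]
    [NormedSpace ℝ E] (φ : ContDiffBump (0 : ℂ)) {g : ℂ → E}
    (hg : AEStronglyMeasurable g volume) :
    eLpNorm (φ.normed volume ⋆[ContinuousLinearMap.lsmul ℝ ℝ, volume] g) 2 volume
      ≤ eLpNorm g 2 volume := by
  have hmeas : AEMeasurable (fun p : ℂ × ℂ => ‖g (p.1 - p.2)‖ₑ) (volume.prod volume) :=
    (hg.comp_quasiMeasurePreserving
      (quasiMeasurePreserving_sub_of_right_invariant volume volume)).enorm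
  have hφm : Measurable fun t => ‖φ.normed volume t‖ₑ := φ.continuous_normed.enorm.measurable
  have hpt : ∀ x, ‖(φ.normed volume ⋆[ContinuousLinearMap.lsmul ℝ ℝ, volume] g) x‖ₑ ^ (2 : ℝ)
      ≤ ∫⁻ t, ‖φ.normed volume t‖ₑ * ‖g (x - t)‖ₑ ^ (2 : ℝ) := by
    intro x
    have hgx : AEMeasurable (fun t => ‖g (x - t)‖ₑ) volume :=
      (hg.comp_quasiMeasurePreserving
        (quasiMeasurePreserving_sub_left volume x)).enorm
    have h1 : ‖(φ.normed volume ⋆[ContinuousLinearMap.lsmul ℝ ℝ, volume] g) x‖ₑ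
        ≤ ∫⁻ t, ‖φ.normed volume t‖ₑ * ‖g (x - t)‖ₑ := by
      rw [convolution_def]
      refine (enorm_integral_le_lintegral_enorm _).trans (le_of_eq ?_)
      refine lintegral_congr fun t => ?_
      simp [enorm_smul]
    have h2 : ∫⁻ t, ‖φ.normed volume t‖ₑ * ‖g (x - t)‖ₑ ≤
        (∫⁻ t, (‖φ.normed volume t‖ₑ ^ (1 / 2 : ℝ)) ^ (2 : ℝ)) ^ (1 / 2 : ℝ) *
        (∫⁻ t, (‖φ.normed volume t‖ₑ ^ (1 / 2 : ℝ) * ‖g (x - t)‖ₑ) ^ (2 : ℝ)) ^ (1 / 2 : ℝ) := by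
      refine le_trans (le_of_eq ?_) (ENNReal.lintegral_mul_le_Lp_mul_Lq volume
        (Real.HolderConjugate.two_two) (hφm.pow_const _).aemeasurable
        ((hφm.pow_const _).aemeasurable.mul hgx))
      refine lintegral_congr fun t => ?_
      simp only [Pi.mul_apply]
      rw [← mul_assoc, ← ENNReal.rpow_add_of_nonneg _ _ (by norm_num) (by norm_num)]
      norm_num
    have h3 : ∀ a : ℝ≥0∞, (a ^ (1 / 2 : ℝ)) ^ (2 : ℝ) = a := fun a => by
      rw [← ENNReal.rpow_mul]; norm_num
    simp only [ENNReal.mul_rpow_of_nonneg _ _ (zero_le_two), h3] at h2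
    rw [φ.lintegral_enorm_normed, ENNReal.one_rpow, one_mul] at h2
    calc _ ≤ _ := ENNReal.rpow_le_rpow (h1.trans h2) zero_le_two
      _ = _ := h3 _
  rw [eLpNorm_eq_lintegral_rpow_enorm_toReal two_ne_zero ENNReal.ofNat_ne_top,
    eLpNorm_eq_lintegral_rpow_enorm_toReal two_ne_zero ENNReal.ofNat_ne_top]
  refine ENNReal.rpow_le_rpow ?_ (by simp)
  simp only [ENNReal.toReal_ofNat]
  calc _ ≤ ∫⁻ x, ∫⁻ t, ‖φ.normed volume t‖ₑ * ‖g (x - t)‖ₑ ^ (2 : ℝ) := lintegral_mono hpt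
    _ = ∫⁻ t, ∫⁻ x, ‖φ.normed volume t‖ₑ * ‖g (x - t)‖ₑ ^ (2 : ℝ) := by
      refine lintegral_lintegral_swap ?_
      exact (hφm.comp measurable_snd).aemeasurable.mul (hmeas.pow_const _)
    _ = ∫⁻ t, ‖φ.normed volume t‖ₑ * ∫⁻ x, ‖g x‖ₑ ^ (2 : ℝ) := by
      refine lintegral_congr fun t => ?_
      rw [lintegral_const_mul' _ _ enorm_ne_top,
        lintegral_sub_right_eq_self (fun x => ‖g x‖ₑ ^ (2 : ℝ)) t]
    _ = _ := by
      rw [lintegral_mul_const _ hφm, φ.lintegral_enorm_normed, one_mul]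

/-- Approximate g by a continuous compactly supported g₀. Mollification contracts L², so the error g
- g₀ stays small uniformly in n, and g₀ is uniformly continuous, so its mollifications converge
uniformly. -/
theorem tendsto_eLpNorm_normed_convolution_sub {E : Type*} [NormedAddCommGroup E]
    [NormedSpace ℝ E] [CompleteSpace E]
    {φ : ℕ → ContDiffBump (0 : ℂ)}
    (hφ : Tendsto (fun n => (φ n).rOut) atTop (𝓝 0)) {g : ℂ → E} (hg : MemLp g 2 volume)
    {C : Set ℂ} (hC : IsCompact C) :
    Tendsto (fun n => eLpNorm (((φ n).normed volume ⋆[ContinuousLinearMap.lsmul ℝ ℝ, volume] g) - g)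
      2 (volume.restrict C)) atTop (𝓝 0) := by
  rw [ENNReal.tendsto_atTop_zero]
  intro ε hε
  have hε4 : ε / 4 ≠ 0 := by simp [hε.ne']
  obtain ⟨g₀, hg₀c, hg₀, hg₀cont, hg₀L⟩ := hg.exists_hasCompactSupport_eLpNorm_sub_le
    ENNReal.ofNat_ne_top hε4
  have hvC : volume C ≠ ⊤ := hC.measure_lt_top.ne
  obtain ⟨η, hη, hηε⟩ : ∃ η : ℝ, 0 < η ∧
      (volume.restrict C) univ ^ (2 : ℝ≥0∞).toReal⁻¹ * ENNReal.ofReal η ≤ ε / 4 := by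
    rcases eq_or_ne ε ⊤ with rfl | hεt
    · exact ⟨1, one_pos, by rw [ENNReal.top_div_of_ne_top (by norm_num)]; exact le_top⟩
    have hfin : (volume.restrict C) univ ^ (2 : ℝ≥0∞).toReal⁻¹ ≠ ⊤ := by
      simp [hvC]
    have ht : Tendsto (fun η : ℝ => (volume.restrict C) univ ^ (2 : ℝ≥0∞).toReal⁻¹ *
        ENNReal.ofReal η) (𝓝[>] 0) (𝓝 0) := by
      have : Tendsto (fun η : ℝ => ENNReal.ofReal η) (𝓝[>] 0) (𝓝 0) := by
        have := (ENNReal.continuous_ofReal.tendsto 0).mono_left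
          (nhdsWithin_le_nhds (s := Ioi (0 : ℝ)))
        simpa using this
      simpa using ENNReal.Tendsto.const_mul this (Or.inr hfin)
    have hev := (ht.eventually (ge_mem_nhds (pos_iff_ne_zero.2 hε4))).and self_mem_nhdsWithin
    obtain ⟨η, h1, h2⟩ := hev.exists
    exact ⟨η, h2, h1⟩
  have hu := hg₀cont.uniformContinuous_of_tendsto_cocompact
    (hg₀c.is_zero_at_infty)
  obtain ⟨δ, hδ, hδη⟩ := Metric.uniformContinuous_iff.1 hu η hη
  obtain ⟨N, hN⟩ := eventually_atTop.1 (hφ.eventually (gt_mem_nhds hδ))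
  refine ⟨N, fun n hn => ?_⟩
  set L := ContinuousLinearMap.lsmul (E := E) ℝ ℝ
  set ψ := (φ n).normed volume
  have hψ : Continuous ψ := (φ n).continuous_normed
  have hψc : HasCompactSupport ψ := (φ n).hasCompactSupport_normed
  have hgl : LocallyIntegrable g volume := hg.locallyIntegrable (by norm_num)
  have hgl₀ : LocallyIntegrable g₀ volume := hg₀cont.locallyIntegrable
  have hex : ConvolutionExists ψ (g - g₀) L volume :=
    hψc.convolutionExists_left L hψ (hgl.sub hgl₀)
  have hex₀ : ConvolutionExists ψ g₀ L volume := hψc.convolutionExists_left L hψ hgl₀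
  have hsplit : (ψ ⋆[L, volume] g) - g =
      (ψ ⋆[L, volume] (g - g₀)) + ((ψ ⋆[L, volume] g₀) - g₀) + (g₀ - g) := by
    have : ψ ⋆[L, volume] g = (ψ ⋆[L, volume] (g - g₀)) + (ψ ⋆[L, volume] g₀) := by
      rw [← hex.distrib_add hex₀]; simp
    rw [this]; abel
  have hm1 : AEStronglyMeasurable (ψ ⋆[L, volume] (g - g₀)) (volume.restrict C) :=
    (hψc.continuous_convolution_left L hψ (hgl.sub hgl₀)).aestronglyMeasurable
  have hm2 : AEStronglyMeasurable ((ψ ⋆[L, volume] g₀) - g₀) (volume.restrict C) :=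
    ((hψc.continuous_convolution_left L hψ hgl₀).sub hg₀cont).aestronglyMeasurable
  have hm3 : AEStronglyMeasurable (g₀ - g) (volume.restrict C) :=
    (hg₀cont.aestronglyMeasurable.sub hg.1).restrict
  have hb1 : eLpNorm (ψ ⋆[L, volume] (g - g₀)) 2 (volume.restrict C) ≤ ε / 4 :=
    (eLpNorm_restrict_le _ _ _ _).trans
      (((φ n).eLpNorm_normed_convolution_le (hg.1.sub hg₀L.1)).trans hg₀)
  have hb2 : eLpNorm ((ψ ⋆[L, volume] g₀) - g₀) 2 (volume.restrict C) ≤ ε / 4 := by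
    refine (eLpNorm_le_of_ae_bound (C := η) (Eventually.of_forall fun x => ?_)).trans hηε
    rw [Pi.sub_apply, ← dist_eq_norm]
    refine (φ n).dist_normed_convolution_le hg₀cont.aestronglyMeasurable fun y hy => ?_
    exact (hδη ((Metric.mem_ball.1 hy).trans (hN n hn))).le
  have hb3 : eLpNorm (g₀ - g) 2 (volume.restrict C) ≤ ε / 4 := by
    rw [eLpNorm_sub_comm]
    exact (eLpNorm_restrict_le _ _ _ _).trans hg₀
  rw [hsplit]
  calc _ ≤ ε / 4 + ε / 4 + ε / 4 :=
        (eLpNorm_add_le (hm1.add hm2) hm3 one_le_two).trans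
          (add_le_add ((eLpNorm_add_le hm1 hm2 one_le_two).trans (add_le_add hb1 hb2)) hb3)
    _ ≤ ε / 4 + ε / 4 + ε / 4 + ε / 4 := le_self_add
    _ = ε := by
      have h4 : ε / 4 = ε / 2 / 2 := by
        rw [div_eq_mul_inv, div_eq_mul_inv, div_eq_mul_inv, mul_assoc,
          ← ENNReal.mul_inv (by norm_num) (by norm_num)]
        norm_num
      rw [h4, add_assoc, ENNReal.add_halves, ENNReal.add_halves]

theorem exists_memLp_eqOn_of_restrict {E : Type*} [NormedAddCommGroup E] {g : ℂ → E}
    {S : Set ℂ} (hS : IsCompact S)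
    (hg : MemLp g 2 (volume.restrict S)) :
    ∃ g₁ : ℂ → E, MemLp g₁ 2 volume ∧ Integrable g₁ volume ∧ ∀ y ∈ S, g₁ y = g y := by
  have : IsFiniteMeasure (volume.restrict S) := ⟨by simpa using hS.measure_lt_top⟩
  exact ⟨S.indicator g, (memLp_indicator_iff_restrict hS.measurableSet).2 hg,
    IntegrableOn.integrable_indicator (hg.integrable one_le_two) hS.measurableSet,
    fun y hy => indicator_of_mem hy g⟩

/-- Differentiation falls on the kernel, and y ↦ ψ(x - y) is an admissible test function because its
support lies in a closed ball about x contained in S ⊆ U. The function `g₁` is a globally integrable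
replacement for g. -/
theorem IsWeakDeriv.fderiv_normed_convolution {U : Set ℂ} {f : ℂ → ℂ} {g : ℂ → ℂ →L[ℝ] ℂ}
    (hfg : IsWeakDeriv U f g) (φ : ContDiffBump (0 : ℂ)) {S : Set ℂ} (hSU : S ⊆ U)
    (hf : Integrable (S.indicator f) volume) {g₁ : ℂ → ℂ →L[ℝ] ℂ}
    (hg : Integrable g₁ volume) (hg₁ : ∀ y ∈ S, g₁ y = g y)
    {x : ℂ} (hx : Metric.closedBall x φ.rOut ⊆ S) :
    fderiv ℝ (φ.normed volume ⋆[ContinuousLinearMap.lsmul ℝ ℝ, volume] (S.indicator f)) x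
      = (φ.normed volume ⋆[ContinuousLinearMap.lsmul ℝ ℝ, volume] g₁) x := by
  set L := ContinuousLinearMap.lsmul (E := ℂ) ℝ ℝ
  set ψ := φ.normed volume
  have hψ : ContDiff ℝ (⊤ : ℕ∞) ψ := φ.contDiff_normed
  have hψc : HasCompactSupport ψ := φ.hasCompactSupport_normed
  have hd := hψc.hasFDerivAt_convolution_left L (hψ.of_le (by exact_mod_cast le_top))
    hf.locallyIntegrable x
  rw [hd.fderiv]
  ext1 v
  have hex1 : ConvolutionExists (fderiv ℝ ψ) (S.indicator f) (L.precompL ℂ) volume :=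
    (hψc.fderiv ℝ).convolutionExists_left _ (hψ.continuous_fderiv (by simp))
      hf.locallyIntegrable
  have hex2 : ConvolutionExists ψ g₁ (ContinuousLinearMap.lsmul ℝ ℝ) volume :=
    hψc.convolutionExists_left _ hψ.continuous hg.locallyIntegrable
  have hsupp : ∀ y ∉ S, ψ (x - y) = 0 ∧ fderiv ℝ ψ (x - y) = 0 := by
    intro y hy
    have hy' : x - y ∉ tsupport ψ := by
      rw [φ.tsupport_normed_eq]
      intro h
      refine hy (hx ?_)
      rwa [Metric.mem_closedBall, dist_comm, dist_eq_norm, ← dist_zero_right]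
    exact ⟨image_eq_zero_of_notMem_tsupport hy',
      image_eq_zero_of_notMem_tsupport fun h => hy' (tsupport_fderiv_subset ℝ h)⟩
  -- The sign from differentiating in y instead of x - y cancels the sign in the definition of the
  -- weak derivative.
  have hderiv : ∀ y, fderiv ℝ (fun y => ψ (x - y)) y = - fderiv ℝ ψ (x - y) := by
    intro y
    have h1 : HasFDerivAt (fun y : ℂ => x - y) (-ContinuousLinearMap.id ℝ ℂ) y :=
      (hasFDerivAt_id y).const_sub x
    have h2 := ((hψ.differentiable (by simp)).differentiableAt (x := x - y)).hasFDerivAt.comp y h1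
    refine h2.fderiv.trans ?_
    ext; simp
  have htest := hfg (fun y => ψ (x - y)) (hψ.comp (contDiff_const.sub contDiff_id))
    (hψc.comp_homeomorph (Homeomorph.subLeft x))
    (by
      refine Subset.trans ?_ (hx.trans hSU)
      refine closure_minimal (fun y hy => ?_) Metric.isClosed_closedBall
      have : x - y ∈ tsupport ψ := subset_tsupport _ hy
      rw [φ.tsupport_normed_eq] at this
      rwa [Metric.mem_closedBall, dist_comm, dist_eq_norm, ← dist_zero_right]) v
  simp only [hderiv] at htest
  have e1 : (fderiv ℝ ψ ⋆[L.precompL ℂ, volume] S.indicator f) x v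
      = ∫ y, (fderiv ℝ ψ (x - y) v) • f y := by
    rw [convolution_def, ContinuousLinearMap.integral_apply (hex1 x),
      ← integral_sub_left_eq_self _ volume x]
    refine integral_congr_ae (Eventually.of_forall fun y => ?_)
    by_cases hy : y ∈ S
    · simp [L, hy]
    · simp [L, (hsupp y hy).2]
  have e2 : (ψ ⋆[ContinuousLinearMap.lsmul ℝ ℝ, volume] g₁) x v
      = ∫ y, ψ (x - y) • g y v := by
    rw [convolution_def, ContinuousLinearMap.integral_apply (hex2 x),
      ← integral_sub_left_eq_self _ volume x]
    refine integral_congr_ae (Eventually.of_forall fun y => ?_)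
    by_cases hy : y ∈ S
    · simp [hg₁ y hy]
    · simp [(hsupp y hy).1]
  rw [e1, e2, ← neg_inj, ← htest, ← integral_neg]
  simp

theorem exists_contDiffBump_seq {δ : ℝ} (hδ : 0 < δ) : ∃ φ : ℕ → ContDiffBump (0 : ℂ),
    Tendsto (fun n => (φ n).rOut) atTop (𝓝 0) ∧ ∀ n, (φ n).rOut < δ := by
  refine ⟨fun n => ⟨δ / 2 / (n + 2), δ / (n + 2), by positivity,
      div_lt_div_of_pos_right (half_lt_self hδ) (by positivity)⟩, ?_, fun n => ?_⟩
  · have := (tendsto_const_div_atTop_nhds_zero_nat δ).comp (tendsto_add_atTop_nat 2)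
    refine this.congr fun n => ?_
    simp
  · exact div_lt_self hδ (by linarith [(Nat.cast_nonneg n : (0 : ℝ) ≤ n)])

/-- Cut f and g off outside a compact thickening of C inside U and mollify at scales below its
width; near C the cutoff is then invisible. -/
theorem IsSobolevLoc.exists_smooth_approx {U : Set ℂ} (hU : IsOpen U) {f : ℂ → ℂ}
    (hf : ContinuousOn f U) {g : ℂ → ℂ →L[ℝ] ℂ} (hS : IsSobolevLoc U f g) {C : Set ℂ}
    (hC : IsCompact C) (hCU : C ⊆ U) :
    ∃ F : ℕ → ℂ → ℂ, (∀ n, ContDiff ℝ (⊤ : ℕ∞) (F n)) ∧ TendstoUniformlyOn F f atTop C ∧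
      Tendsto (fun n => eLpNorm (fderiv ℝ (F n) - g) 2 (volume.restrict C)) atTop (𝓝 0) := by
  obtain ⟨δ, hδ, hδU⟩ := hC.exists_cthickening_subset_open hU hCU
  set S := Metric.cthickening δ C
  have hSc : IsCompact S := hC.cthickening
  have hfS : ContinuousOn f S := hf.mono hδU
  have hfi : Integrable (S.indicator f) volume :=
    (hfS.integrableOn_compact hSc).integrable_indicator hSc.measurableSet
  have hgS : MemLp g 2 (volume.restrict S) := (hS.1 S hSc hδU).2
  obtain ⟨g₁, hgL, hgi, hg₁⟩ := exists_memLp_eqOn_of_restrict hSc hgS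
  obtain ⟨φ, hφ, hφδ⟩ := exists_contDiffBump_seq hδ
  have hball : ∀ n, ∀ x ∈ C, Metric.closedBall x (φ n).rOut ⊆ S := fun n x hx =>
    (Metric.closedBall_subset_closedBall (hφδ n).le).trans
      (Metric.closedBall_subset_cthickening hx δ)
  have hsm : ∀ n, ContDiff ℝ (⊤ : ℕ∞) ((φ n).normed volume ⋆[ContinuousLinearMap.lsmul ℝ ℝ,
      volume] (S.indicator f)) := fun n =>
    (φ n).hasCompactSupport_normed.contDiff_convolution_left _ (φ n).contDiff_normed
      hfi.locallyIntegrable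
  refine ⟨fun n => (φ n).normed volume ⋆[ContinuousLinearMap.lsmul ℝ ℝ, volume] (S.indicator f),
    hsm, ?_, ?_⟩
  · rw [Metric.tendstoUniformlyOn_iff]
    intro ε hε
    obtain ⟨η, hη, hu⟩ := Metric.uniformContinuousOn_iff.1
      (hSc.uniformContinuousOn_of_continuous hfS) (ε / 2) (half_pos hε)
    filter_upwards [hφ.eventually (gt_mem_nhds hη)] with n hn x hx
    have hxS : x ∈ S := Metric.self_subset_cthickening C hx
    have h := (φ n).dist_normed_convolution_le (μ := volume) (x₀ := x) (ε := ε / 2)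
      hfi.aestronglyMeasurable (fun y hy => by
        have hyS : y ∈ S := hball n x hx (Metric.ball_subset_closedBall hy)
        rw [indicator_of_mem hyS, indicator_of_mem hxS]
        exact (hu y hyS x hxS ((Metric.mem_ball.1 hy).trans hn)).le)
    rw [indicator_of_mem hxS, dist_comm] at h
    linarith
  · refine (tendsto_eLpNorm_normed_convolution_sub hφ hgL hC).congr fun n => ?_
    refine eLpNorm_congr_ae ?_
    filter_upwards [ae_restrict_mem hC.measurableSet] with x hx
    have hxS : x ∈ S := Metric.self_subset_cthickening C hx
    rw [Pi.sub_apply, Pi.sub_apply, hg₁ x hxS,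
      hS.2.fderiv_normed_convolution (φ n) hδU hfi hgi hg₁ (hball n x hx)]

/-! ### Degree formula for smooth maps via Green's theorem -/

/-- A smooth monotone step, equal to `0` up to `σ² / 2` and to `1` from `σ²` on. -/
def smoothStep (σ t : ℝ) : ℝ := Real.smoothTransition (2 * t / σ ^ 2 - 1)

theorem contDiff_smoothStep (σ : ℝ) : ContDiff ℝ (⊤ : ℕ∞) (smoothStep σ) := by
  unfold smoothStep
  exact Real.smoothTransition.contDiff.comp (by fun_prop)

theorem smoothStep_monotone (σ : ℝ) : Monotone (smoothStep σ) := fun a b h =>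
  Real.smoothTransition.monotone (by gcongr)

theorem smoothStep_eq_zero {σ t : ℝ} (hσ : 0 < σ) (h : t ≤ σ ^ 2 / 2) : smoothStep σ t = 0 := by
  refine Real.smoothTransition.zero_of_nonpos ?_
  rw [sub_nonpos, div_le_one (by positivity)]
  linarith

theorem smoothStep_eq_one {σ t : ℝ} (hσ : 0 < σ) (h : σ ^ 2 ≤ t) : smoothStep σ t = 1 := by
  refine Real.smoothTransition.one_of_one_le ?_
  have : 2 ≤ 2 * t / σ ^ 2 := by rw [le_div_iff₀ (by positivity)]; linarith
  linarith

/-- A radial bump function of mass one, supported in the disk of radius `σ` about `0`. -/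
def radialBump (σ : ℝ) (ζ : ℂ) : ℝ := deriv (smoothStep σ) (Complex.normSq ζ) / Real.pi

theorem continuous_deriv_smoothStep (σ : ℝ) : Continuous (deriv (smoothStep σ)) :=
  (contDiff_smoothStep σ).continuous_deriv (by simp)

theorem continuous_radialBump (σ : ℝ) : Continuous (radialBump σ) :=
  ((continuous_deriv_smoothStep σ).comp Complex.continuous_normSq).div_const _

theorem radialBump_nonneg (σ : ℝ) (ζ : ℂ) : 0 ≤ radialBump σ ζ :=
  div_nonneg (smoothStep_monotone σ).deriv_nonneg Real.pi_pos.le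

theorem radialBump_eq_zero {σ : ℝ} (hσ : 0 < σ) {ζ : ℂ} (h : σ < ‖ζ‖) : radialBump σ ζ = 0 := by
  have h1 : σ ^ 2 < Complex.normSq ζ := by
    rw [Complex.normSq_eq_norm_sq]; gcongr
  have : smoothStep σ =ᶠ[𝓝 (Complex.normSq ζ)] fun _ => 1 := by
    filter_upwards [lt_mem_nhds h1] with t ht using smoothStep_eq_one hσ ht.le
  simp [radialBump, this.deriv_eq]

theorem hasCompactSupport_radialBump {σ : ℝ} (hσ : 0 < σ) : HasCompactSupport (radialBump σ) := by
  refine HasCompactSupport.of_support_subset_isCompact (isCompact_closedBall (0 : ℂ) σ) ?_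
  intro ζ hζ
  by_contra h
  exact hζ (radialBump_eq_zero hσ (by simpa using h))

/-- Im(ūv) is the area form of ℂ, which a real-linear map multiplies by its determinant. This makes
Jacobians accessible without matrices. -/
theorem ContinuousLinearMap.im_conj_mul_eq_det_mul (A : ℂ →L[ℝ] ℂ) (u v : ℂ) :
    ((starRingEnd ℂ) (A u) * A v).im = A.det * ((starRingEnd ℂ) u * v).im := by
  have hdet : A.det = (A 1).re * (A Complex.I).im - (A Complex.I).re * (A 1).im := by
    change LinearMap.det (A : ℂ →ₗ[ℝ] ℂ) = _
    rw [← LinearMap.det_toMatrix Complex.basisOneI, Matrix.det_fin_two]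
    simp [LinearMap.toMatrix_apply]
  have hA : ∀ w : ℂ, A w = w.re • A 1 + w.im • A Complex.I := by
    intro w
    rw [← map_smul, ← map_smul, ← map_add]
    congr 1
    apply Complex.ext <;> simp
  rw [hA u, hA v, hdet]
  simp
  ring

/-- The complex form `step(|ζ|²) / ζ`, whose imaginary part is a multiple of `d arg` off a disk. -/
def cutoffInv (σ : ℝ) (ζ : ℂ) : ℂ := (smoothStep σ (Complex.normSq ζ) : ℂ) * ζ⁻¹

/-- For ω = κ(|ζ|²) dζ/ζ the factor 1/ζ is holomorphic and contributes nothing to dω, so dω =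
κ'(|ζ|²) d(ζζ̄) ∧ dζ/ζ = κ'(|ζ|²) dζ̄ ∧ dζ. Thus Im ω is a primitive of 2π `radialBump` times area,
and equals d arg where |ζ| ≥ σ. -/
theorem exists_hasFDerivAt_cutoffInv {σ : ℝ} (hσ : 0 < σ) (ζ : ℂ) :
    ∃ L : ℂ →L[ℝ] ℂ, HasFDerivAt (cutoffInv σ) L ζ ∧ ∀ u v : ℂ,
      (L u * v - L v * u).im =
        2 * deriv (smoothStep σ) (Complex.normSq ζ) * ((starRingEnd ℂ) u * v).im := by
  by_cases h : Complex.normSq ζ < σ ^ 2 / 2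
  · have hev : ∀ᶠ w in 𝓝 ζ, Complex.normSq w < σ ^ 2 / 2 :=
      Complex.continuous_normSq.continuousAt.eventually (gt_mem_nhds h)
    have h0 : cutoffInv σ =ᶠ[𝓝 ζ] fun _ => 0 := by
      filter_upwards [hev] with w hw
      simp [cutoffInv, smoothStep_eq_zero hσ hw.le]
    have hk : smoothStep σ =ᶠ[𝓝 (Complex.normSq ζ)] fun _ => 0 := by
      filter_upwards [gt_mem_nhds h] with t ht using smoothStep_eq_zero hσ ht.le
    refine ⟨0, (hasFDerivAt_const (0 : ℂ) ζ).congr_of_eventuallyEq h0, fun u v => ?_⟩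
    simp [hk.deriv_eq]
  · have hζ : ζ ≠ 0 := by
      rintro rfl
      exact h (by simpa using by positivity)
    set k := deriv (smoothStep σ) (Complex.normSq ζ)
    have hn : HasFDerivAt (fun w : ℂ => Complex.normSq w)
        ((2 * ζ.re) • Complex.reCLM + (2 * ζ.im) • Complex.imCLM) ζ := by
      have h1 := (Complex.reCLM.hasFDerivAt (x := ζ)).mul (Complex.reCLM.hasFDerivAt (x := ζ))
      have h2 := (Complex.imCLM.hasFDerivAt (x := ζ)).mul (Complex.imCLM.hasFDerivAt (x := ζ))
      refine ((h1.add h2).congr_fderiv ?_).congr_of_eventuallyEq ?_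
      · ext <;> (simp; ring)
      · exact Eventually.of_forall fun w => by simp [Complex.normSq_apply]
    have hk : HasDerivAt (smoothStep σ) k (Complex.normSq ζ) :=
      ((contDiff_smoothStep σ).differentiable (by simp)).differentiableAt.hasDerivAt
    have hc := Complex.ofRealCLM.hasFDerivAt.comp ζ (hk.comp_hasFDerivAt ζ hn)
    have hi : HasFDerivAt (fun w : ℂ => w⁻¹)
        ((ContinuousLinearMap.toSpanSingleton ℂ (-(ζ ^ 2)⁻¹)).restrictScalars ℝ) ζ :=
      (hasDerivAt_inv hζ).hasFDerivAt.restrictScalars ℝ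
    refine ⟨_, hc.mul hi, fun u v => ?_⟩
    simp only [add_apply, smul_apply, Function.comp_apply,
      ContinuousLinearMap.comp_apply, Complex.ofRealCLM_apply, Complex.reCLM_apply,
      Complex.imCLM_apply, ContinuousLinearMap.coe_restrictScalars',
      ContinuousLinearMap.toSpanSingleton_apply, smul_eq_mul]
    have key : (((k * (2 * ζ.re * u.re + 2 * ζ.im * u.im) : ℝ) : ℂ) * v -
        ((k * (2 * ζ.re * v.re + 2 * ζ.im * v.im) : ℝ) : ℂ) * u) =
        ζ * (((2 * k * ((starRingEnd ℂ) u * v).im : ℝ) : ℂ) * Complex.I) := by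
      apply Complex.ext <;> (simp; ring)
    have : ∀ a b c : ℂ, (a * (u * -(ζ ^ 2)⁻¹) + ζ⁻¹ * b) * v - (a * (v * -(ζ ^ 2)⁻¹) + ζ⁻¹ * c) * u
        = ζ⁻¹ * (b * v - c * u) := fun a b c => by ring
    rw [this, key, inv_mul_cancel_left₀ hζ]
    simp

/-- The two functions are the components of the pull-back of Im ω under G. The mixed second
derivatives of G cancel by symmetry, leaving the pull-back of d(Im ω). -/
theorem divergence_im_cutoffInv {σ : ℝ} (hσ : 0 < σ) {G : ℝ × ℝ → ℂ}
    (hG : ContDiff ℝ (⊤ : ℕ∞) G) (p : ℝ × ℝ) :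
    ∃ A B : ℝ × ℝ →L[ℝ] ℝ,
      HasFDerivAt (fun p => (cutoffInv σ (G p) * fderiv ℝ G p (0, 1)).im) A p ∧
      HasFDerivAt (fun p => - (cutoffInv σ (G p) * fderiv ℝ G p (1, 0)).im) B p ∧
      A (1, 0) + B (0, 1) = 2 * deriv (smoothStep σ) (Complex.normSq (G p)) *
        ((starRingEnd ℂ) (fderiv ℝ G p (1, 0)) * fderiv ℝ G p (0, 1)).im := by
  obtain ⟨L, hL, hLim⟩ := exists_hasFDerivAt_cutoffInv hσ (G p)
  have hd : HasFDerivAt G (fderiv ℝ G p) p :=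
    (hG.differentiable (by simp)).differentiableAt.hasFDerivAt
  have hG' : ContDiff ℝ 1 (fderiv ℝ G) := hG.fderiv_right (WithTop.coe_le_coe.2 le_top)
  have hd2 : HasFDerivAt (fderiv ℝ G) (fderiv ℝ (fderiv ℝ G) p) p :=
    (hG'.differentiable (by simp)).differentiableAt.hasFDerivAt
  have hsymm : fderiv ℝ (fderiv ℝ G) p (1, 0) (0, 1) = fderiv ℝ (fderiv ℝ G) p (0, 1) (1, 0) :=
    second_derivative_symmetric
      (fun y => (hG.differentiable (by simp)).differentiableAt.hasFDerivAt) hd2 _ _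
  have hκ := hL.comp p hd
  have hv : ∀ e : ℝ × ℝ, HasFDerivAt (fun p => fderiv ℝ G p e)
      ((ContinuousLinearMap.apply ℝ ℂ e).comp (fderiv ℝ (fderiv ℝ G) p)) p := fun e =>
    (ContinuousLinearMap.apply ℝ ℂ e).hasFDerivAt.comp p hd2
  have hA := Complex.imCLM.hasFDerivAt.comp p (hκ.mul (hv (0, 1)))
  have hB := (Complex.imCLM.hasFDerivAt.comp p (hκ.mul (hv (1, 0)))).neg
  refine ⟨_, _, hA, hB, ?_⟩
  simp only [add_apply, smul_apply, Function.comp_apply,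
      ContinuousLinearMap.comp_apply, neg_apply, Complex.imCLM_apply,
      ContinuousLinearMap.apply_apply, smul_eq_mul]
  rw [← hLim, hsymm]
  simp only [Complex.add_im, Complex.sub_im, Complex.mul_im]
  ring

/-- Green's formula on a rectangle of polar coordinates. The side s = 0 contributes nothing because
it is collapsed to a point, and the sides t = a, t = b cancel by periodicity. -/
theorem integral_divergence_im_cutoffInv {σ : ℝ} (hσ : 0 < σ) {G : ℝ × ℝ → ℂ}
    (hG : ContDiff ℝ (⊤ : ℕ∞) G) {r a b : ℝ} (h0 : ∀ t, fderiv ℝ G (0, t) (0, 1) = 0)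
    (hper : ∀ s, G (s, a) = G (s, b) ∧ fderiv ℝ G (s, a) (1, 0) = fderiv ℝ G (s, b) (1, 0)) :
    ∫ s in (0 : ℝ)..r, ∫ t in a..b, 2 * deriv (smoothStep σ) (Complex.normSq (G (s, t))) *
        ((starRingEnd ℂ) (fderiv ℝ G (s, t) (1, 0)) * fderiv ℝ G (s, t) (0, 1)).im =
      ∫ t in a..b, (cutoffInv σ (G (r, t)) * fderiv ℝ G (r, t) (0, 1)).im := by
  choose A B hA hB hAB using divergence_im_cutoffInv hσ hG
  have hG' : Continuous (fderiv ℝ G) := hG.continuous_fderiv (by simp)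
  have hcont : Continuous fun p => A p (1, 0) + B p (0, 1) := by
    simp only [hAB]
    have h1 := (continuous_deriv_smoothStep σ).comp (Complex.continuous_normSq.comp hG.continuous)
    have h2 : ∀ e, Continuous fun p => fderiv ℝ G p e := fun e => hG'.clm_apply continuous_const
    exact (continuous_const.mul h1).mul (Complex.continuous_im.comp
      ((Complex.continuous_conj.comp (h2 _)).mul (h2 _)))
  have := integral2_divergence_prod_of_hasFDerivAt _ _ A B 0 a r b
    (continuous_iff_continuousAt.2 fun p => (hA p).continuousAt).continuousOn
    (continuous_iff_continuousAt.2 fun p => (hB p).continuousAt).continuousOn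
    (fun p _ => hA p) (fun p _ => hB p)
    (hcont.continuousOn.integrableOn_compact (isCompact_uIcc.prod isCompact_uIcc))
  simp only [hAB] at this
  rw [this]
  simp [h0, hper]

theorem integral_ball_eq_polar {H : ℂ → ℝ} (hH : Continuous H) (c : ℂ) {r : ℝ} (hr : 0 ≤ r) :
    ∫ z in Metric.ball c r, H z =
      ∫ s in (0 : ℝ)..r, ∫ t in -Real.pi..Real.pi, s * H (circleMap c s t) := by
  have hpol : ∀ p : ℝ × ℝ, Complex.polarCoord.symm p + c = circleMap c p.1 p.2 := by
    intro p
    rw [Complex.polarCoord_symm_apply, circleMap, Complex.exp_mul_I, add_comm]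
    simp
  have hcont : Continuous fun p : ℝ × ℝ => p.1 * H (circleMap c p.1 p.2) := by
    simp only [← hpol, Complex.polarCoord_symm_apply]
    fun_prop
  have h1 : ∫ z in Metric.ball c r, H z =
      ∫ z, (Metric.ball (0 : ℂ) r).indicator (fun z => H (z + c)) z := by
    rw [← integral_indicator Metric.isOpen_ball.measurableSet, ← integral_add_right_eq_self _ c]
    congr 1; ext z
    by_cases hz : z ∈ Metric.ball (0 : ℂ) r
    · rw [indicator_of_mem hz, indicator_of_mem]
      simpa using hz
    · rw [indicator_of_notMem hz, indicator_of_notMem]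
      simpa using hz
  rw [h1, ← Complex.integral_comp_polarCoord_symm]
  have h2 : ∫ p in polarCoord.target, p.1 • (Metric.ball (0 : ℂ) r).indicator
        (fun z => H (z + c)) (Complex.polarCoord.symm p)
      = ∫ p in polarCoord.target, (Iio r ×ˢ univ : Set (ℝ × ℝ)).indicator
        (fun p : ℝ × ℝ => p.1 * H (circleMap c p.1 p.2)) p := by
    refine setIntegral_congr_fun polarCoord.open_target.measurableSet fun p hp => ?_
    have hp1 : 0 < p.1 := by simpa [polarCoord] using hp.1
    have hn : ‖Complex.polarCoord.symm p‖ = p.1 := by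
      rw [Complex.norm_polarCoord_symm, abs_of_pos hp1]
    by_cases h : p.1 < r
    · rw [indicator_of_mem (by rwa [mem_ball_zero_iff, hn]), indicator_of_mem (by simpa using h), hpol,
        smul_eq_mul]
    · rw [indicator_of_notMem (by rwa [mem_ball_zero_iff, hn]), indicator_of_notMem (by simpa using h),
        smul_zero]
  rw [h2, setIntegral_indicator (measurableSet_Iio.prod MeasurableSet.univ)]
  have h3 : polarCoord.target ∩ (Iio r ×ˢ univ : Set (ℝ × ℝ)) = Ioo 0 r ×ˢ Ioo (-Real.pi) Real.pi := by
    ext p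
    simp [polarCoord]
    tauto
  rw [h3, Measure.volume_eq_prod, setIntegral_prod, intervalIntegral.integral_of_le hr,
    ← integral_Ioc_eq_integral_Ioo]
  · refine setIntegral_congr_fun measurableSet_Ioc fun s _ => ?_
    simp only
    rw [intervalIntegral.integral_of_le (by linarith [Real.pi_pos]),
      ← integral_Ioc_eq_integral_Ioo]
  · exact (hcont.continuousOn.integrableOn_compact
      ((isCompact_Icc (a := (0 : ℝ)) (b := r)).prod
        (isCompact_Icc (a := -Real.pi) (b := Real.pi)))).mono_set
      (prod_mono Ioo_subset_Icc_self Ioo_subset_Icc_self)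

/-- With ψ the primitive of γ'/γ one has γ = γ(a) exp ψ. Hence θ - θ(a) - Im ψ is continuous with
values in the discrete group 2πℤ, so it is constant. -/
theorem integral_im_deriv_div_eq_sub {γ : ℝ → ℂ} (hγ : ContDiff ℝ 1 γ) (hγ0 : ∀ t, γ t ≠ 0)
    {θ : ℝ → ℝ} (hθ : Continuous θ)
    (hlift : ∀ t, γ t = (‖γ t‖ : ℂ) * Complex.exp (θ t * Complex.I)) (a b : ℝ) :
    ∫ t in a..b, (deriv γ t / γ t).im = θ b - θ a := by
  have hq : Continuous fun t => deriv γ t / γ t :=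
    (hγ.continuous_deriv le_rfl).div hγ.continuous hγ0
  set ψ : ℝ → ℂ := fun t => ∫ s in a..t, deriv γ s / γ s
  have hψ : ∀ t, HasDerivAt ψ (deriv γ t / γ t) t := fun t =>
    (hq.integral_hasStrictDerivAt a t).hasDerivAt
  have hψc : Continuous ψ := continuous_iff_continuousAt.2 fun t => (hψ t).continuousAt
  have hψa : ψ a = 0 := intervalIntegral.integral_same
  have hconst : ∀ t, γ t * Complex.exp (-ψ t) = γ a := by
    have hd : ∀ t, HasDerivAt (fun t => γ t * Complex.exp (-ψ t)) 0 t := by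
      intro t
      have h1 := ((hγ.differentiable (by simp)).differentiableAt (x := t)).hasDerivAt.mul
        ((hψ t).neg.cexp)
      refine h1.congr_deriv ?_
      have := hγ0 t
      field_simp
      simp
    intro t
    have := is_const_of_deriv_eq_zero (fun t => (hd t).differentiableAt) (fun t => (hd t).deriv) t a
    simpa [hψa] using this
  have hγψ : ∀ t, γ t = γ a * Complex.exp (ψ t) := fun t => by
    rw [← hconst t, mul_assoc, ← Complex.exp_add]; simp
  have hone : ∀ t, Complex.exp (((θ t - θ a - (ψ t).im : ℝ) : ℂ) * Complex.I) = 1 := by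
    intro t
    have hn : (‖γ t‖ : ℂ) = ‖γ a‖ * Complex.exp ((ψ t).re) := by
      rw [hγψ t, norm_mul, Complex.norm_exp]
      push_cast; rfl
    have h1 := hlift t
    rw [hn, hγψ t, hlift a] at h1
    have h2 : (‖γ a‖ : ℂ) ≠ 0 := by exact_mod_cast (norm_pos_iff.2 (hγ0 a)).ne'
    simp only [norm_mul, Complex.norm_real, norm_norm, Complex.norm_exp_ofReal_mul_I, mul_one] at h1
    rw [mul_assoc, mul_assoc] at h1
    have h3 := mul_left_cancel₀ h2 h1
    rw [← Complex.exp_add, ← Complex.exp_add] at h3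
    have h4 : ((θ t - θ a - (ψ t).im : ℝ) : ℂ) * Complex.I =
        ((ψ t).re + θ t * Complex.I) - (θ a * Complex.I + ψ t) := by
      have h5 := Complex.re_add_im (ψ t)
      push_cast
      linear_combination -h5
    rw [h4, Complex.exp_sub, h3, div_self (Complex.exp_ne_zero _)]
  have hmem : ∀ t, θ t - θ a - (ψ t).im ∈ AddSubgroup.zmultiples (2 * Real.pi) := by
    intro t
    obtain ⟨n, hn⟩ := Complex.exp_eq_one_iff.1 (hone t)
    refine AddSubgroup.mem_zmultiples_iff.2 ⟨n, ?_⟩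
    have := congrArg Complex.im hn
    simp at this
    simp [this]
  have hdisc : IsDiscrete (AddSubgroup.zmultiples (2 * Real.pi) : Set ℝ) :=
    ⟨inferInstanceAs (DiscreteTopology (AddSubgroup.zmultiples (2 * Real.pi)))⟩
  obtain ⟨y, -, hy⟩ := isPreconnected_univ.eqOn_const_of_mapsTo hdisc
    (f := fun t => θ t - θ a - (ψ t).im)
    ((hθ.sub continuous_const).sub (Complex.continuous_im.comp hψc)).continuousOn
    (fun t _ => hmem t) ⟨0, zero_mem _⟩
  have ha := hy (mem_univ a)
  have hb := hy (mem_univ b)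
  simp only [hψa, Function.const_apply, sub_self, Complex.zero_im] at ha hb
  have him : ∫ t in a..b, (deriv γ t / γ t).im = (ψ b).im :=
    intervalIntegral.intervalIntegral_im (hq.intervalIntegrable a b)
  rw [him]; linarith

/-- Dog-on-a-leash: γ/γ₀ stays in the unit disk about 1, where the principal argument is continuous.
Adding it to θ lifts γ, and it takes equal values at 0 and T. -/
theorem exists_lift_of_norm_sub_lt {γ₀ γ : ℝ → ℂ} (hγ₀ : Continuous γ₀) (hγ : Continuous γ)
    {T : ℝ} (hγ₀T : γ₀ T = γ₀ 0) (hγT : γ T = γ 0) (hlt : ∀ t, ‖γ t - γ₀ t‖ < ‖γ₀ t‖)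
    {θ : ℝ → ℝ} (hθ : Continuous θ)
    (hlift : ∀ t, γ₀ t = (‖γ₀ t‖ : ℂ) * Complex.exp (θ t * Complex.I)) :
    ∃ θ' : ℝ → ℝ, Continuous θ' ∧ θ' T - θ' 0 = θ T - θ 0 ∧
      ∀ t, γ t = (‖γ t‖ : ℂ) * Complex.exp (θ' t * Complex.I) := by
  have h0 : ∀ t, γ₀ t ≠ 0 := fun t => norm_pos_iff.1 ((norm_nonneg _).trans_lt (hlt t))
  have hslit : ∀ t, γ t / γ₀ t ∈ Complex.slitPlane := by
    intro t
    have h : 1 + (γ t - γ₀ t) / γ₀ t ∈ Complex.slitPlane := by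
      refine Complex.mem_slitPlane_of_norm_lt_one ?_
      rw [norm_div, div_lt_one (norm_pos_iff.2 (h0 t))]; exact hlt t
    rwa [sub_div, div_self (h0 t), add_sub_cancel] at h
  refine ⟨fun t => θ t + Complex.arg (γ t / γ₀ t), hθ.add ?_, ?_, fun t => ?_⟩
  · exact continuous_iff_continuousAt.2 fun t =>
      ContinuousAt.comp (f := fun t => γ t / γ₀ t) (Complex.continuousAt_arg (hslit t))
        ((hγ.div hγ₀ h0).continuousAt)
  · simp [hγ₀T, hγT]
  · have h1 := Complex.norm_mul_exp_arg_mul_I (γ t / γ₀ t)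
    have h2 : γ t = γ₀ t * (γ t / γ₀ t) := by field_simp [h0 t]
    have h3 : (‖γ₀ t‖ : ℂ) ≠ 0 := by exact_mod_cast (norm_pos_iff.2 (h0 t)).ne'
    have h4 : (‖γ₀ t‖ : ℂ) * (‖γ t / γ₀ t‖ : ℂ) = ‖γ t‖ := by
      rw [norm_div]; push_cast; field_simp
    calc γ t = γ₀ t * (γ t / γ₀ t) := h2
      _ = ((‖γ₀ t‖ : ℂ) * Complex.exp (θ t * Complex.I)) *
          ((‖γ t / γ₀ t‖ : ℂ) * Complex.exp (Complex.arg (γ t / γ₀ t) * Complex.I)) := by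
        rw [← hlift t, h1]
      _ = ‖γ t‖ * (Complex.exp (θ t * Complex.I) *
          Complex.exp (Complex.arg (γ t / γ₀ t) * Complex.I)) := by rw [← h4]; ring
      _ = _ := by rw [← Complex.exp_add, Complex.ofReal_add, add_mul]

theorem contDiff_uncurry_circleMap (c : ℂ) :
    ContDiff ℝ (⊤ : ℕ∞) fun p : ℝ × ℝ => circleMap c p.1 p.2 := by
  unfold circleMap
  have h1 : ContDiff ℝ (⊤ : ℕ∞) fun p : ℝ × ℝ => ((p.1 : ℝ) : ℂ) :=
    Complex.ofRealCLM.contDiff.comp contDiff_fst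
  have h2 : ContDiff ℝ (⊤ : ℕ∞) fun p : ℝ × ℝ => ((p.2 : ℝ) : ℂ) :=
    Complex.ofRealCLM.contDiff.comp contDiff_snd
  exact contDiff_const.add (h1.mul (h2.mul contDiff_const).cexp)

theorem fderiv_comp_uncurry_circleMap {E : Type*} [NormedAddCommGroup E] [NormedSpace ℝ E]
    {F : ℂ → E} {c : ℂ} {s t : ℝ}
    (hF : DifferentiableAt ℝ F (circleMap c s t)) :
    fderiv ℝ (fun p : ℝ × ℝ => F (circleMap c p.1 p.2)) (s, t) (1, 0)
        = fderiv ℝ F (circleMap c s t) (Complex.exp (t * Complex.I)) ∧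
    fderiv ℝ (fun p : ℝ × ℝ => F (circleMap c p.1 p.2)) (s, t) (0, 1)
        = fderiv ℝ F (circleMap c s t) (circleMap 0 s t * Complex.I) := by
  have hc : HasFDerivAt (fun p : ℝ × ℝ => circleMap c p.1 p.2)
      (fderiv ℝ (fun p : ℝ × ℝ => circleMap c p.1 p.2) (s, t)) (s, t) :=
    ((contDiff_uncurry_circleMap c).differentiable (by simp)).differentiableAt.hasFDerivAt
  have h1 : fderiv ℝ (fun p : ℝ × ℝ => circleMap c p.1 p.2) (s, t) (1, 0)
      = Complex.exp (t * Complex.I) := by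
    have hl : HasDerivAt (fun x : ℝ => ((x, t) : ℝ × ℝ)) (1, 0) s :=
      (hasDerivAt_id s).prodMk (hasDerivAt_const s t)
    have h := hc.comp_hasDerivAt s hl
    have h' : HasDerivAt (fun x : ℝ => circleMap c x t) (Complex.exp (t * Complex.I)) s := by
      unfold circleMap
      simpa using (((hasDerivAt_id s).ofReal_comp).mul_const
        (Complex.exp (t * Complex.I))).const_add c
    exact h.unique h'
  have h2 : fderiv ℝ (fun p : ℝ × ℝ => circleMap c p.1 p.2) (s, t) (0, 1)
      = circleMap 0 s t * Complex.I := by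
    have hl : HasDerivAt (fun x : ℝ => ((s, x) : ℝ × ℝ)) (0, 1) t :=
      (hasDerivAt_const t s).prodMk (hasDerivAt_id t)
    exact (hc.comp_hasDerivAt t hl).unique (hasDerivAt_circleMap c s t)
  have hcomp : HasFDerivAt (fun p : ℝ × ℝ => F (circleMap c p.1 p.2)) _ (s, t) :=
    HasFDerivAt.comp (s, t) (g := F) hF.hasFDerivAt hc
  rw [hcomp.fderiv]
  simp only [ContinuousLinearMap.comp_apply, h1, h2, and_self]

/-- A smooth map with winding number one on the boundary circle of a disk covers a neighbourhood
of the origin with degree one. -/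
theorem integral_ball_radialBump_mul_det {F : ℂ → ℂ} (hF : ContDiff ℝ (⊤ : ℕ∞) F) {c : ℂ}
    {r σ : ℝ} (hr : 0 ≤ r) (hσ : 0 < σ) (hbd : ∀ t, σ ≤ ‖F (circleMap c r t)‖) {θ : ℝ → ℝ}
    (hθ : Continuous θ) (hθ2 : θ (2 * Real.pi) - θ 0 = 2 * Real.pi)
    (hlift : ∀ t, F (circleMap c r t) =
      (‖F (circleMap c r t)‖ : ℂ) * Complex.exp (θ t * Complex.I)) :
    ∫ z in Metric.ball c r, radialBump σ (F z) * (fderiv ℝ F z).det = 1 := by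
  have hF' : Continuous (fderiv ℝ F) := hF.continuous_fderiv (by simp)
  have hdet : Continuous fun z => (fderiv ℝ F z).det :=
    ContinuousLinearMap.continuous_det.comp hF'
  have hFd : Differentiable ℝ F := hF.differentiable (by simp)
  set G : ℝ × ℝ → ℂ := fun p => F (circleMap c p.1 p.2)
  have hG : ContDiff ℝ (⊤ : ℕ∞) G := hF.comp (contDiff_uncurry_circleMap c)
  have hG1 := fun s t => (fderiv_comp_uncurry_circleMap (c := c) (s := s) (t := t)
    hFd.differentiableAt).1
  have hG2 := fun s t => (fderiv_comp_uncurry_circleMap (c := c) (s := s) (t := t)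
    hFd.differentiableAt).2
  have hc : ∀ s, circleMap c s (-Real.pi) = circleMap c s Real.pi := fun s => by
    simp [circleMap]
  have hgreen := integral_divergence_im_cutoffInv hσ hG (r := r) (a := -Real.pi) (b := Real.pi)
    (fun t => by rw [hG2]; simp [circleMap])
    (fun s => by
      refine ⟨by simp only [G, hc], ?_⟩
      rw [hG1, hG1, hc]
      congr 1
      simp)
  have hγ : ContDiff ℝ 1 fun t => F (circleMap c r t) :=
    (hF.of_le (WithTop.coe_le_coe.2 le_top)).comp (contDiff_circleMap c r)
  have hγ0 : ∀ t, F (circleMap c r t) ≠ 0 := fun t => norm_pos_iff.1 (hσ.trans_le (hbd t))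
  have hbdry : ∀ t, (cutoffInv σ (G (r, t)) * fderiv ℝ G (r, t) (0, 1)).im =
      (deriv (fun t => F (circleMap c r t)) t / F (circleMap c r t)).im := by
    intro t
    have h1 : deriv (fun t => F (circleMap c r t)) t = fderiv ℝ G (r, t) (0, 1) := by
      rw [hG2]
      exact ((hFd.differentiableAt.hasFDerivAt).comp_hasDerivAt t
        (hasDerivAt_circleMap c r t)).deriv
    have h2 : smoothStep σ (Complex.normSq (F (circleMap c r t))) = 1 := by
      refine smoothStep_eq_one hσ ?_
      rw [Complex.normSq_eq_norm_sq]
      have := hbd t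
      gcongr
    rw [h1, cutoffInv]
    simp only [G, h2]
    rw [div_eq_inv_mul]
    simp
  -- Polar coordinates use the angles (-π, π), whereas the winding number is read off on [0, 2π];
  -- periodicity reconciles the two.
  have hperiod : Function.Periodic
      (fun t => (deriv (fun t => F (circleMap c r t)) t / F (circleMap c r t)).im)
      (2 * Real.pi) := by
    intro t
    have hp : Function.Periodic (fun t => F (circleMap c r t)) (2 * Real.pi) := fun t => by
      simp only [periodic_circleMap c r t]
    have h1 := hp t
    have h2 : deriv (fun t => F (circleMap c r t)) (t + 2 * Real.pi) =
        deriv (fun t => F (circleMap c r t)) t := by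
      rw [← deriv_comp_add_const]
      congr 1
      ext x; exact hp x
    simp only [h2]
    simp only at h1
    rw [h1]
  have hwind : ∫ t in -Real.pi..Real.pi,
      (deriv (fun t => F (circleMap c r t)) t / F (circleMap c r t)).im = 2 * Real.pi := by
    have h1 := hperiod.intervalIntegral_add_eq (-Real.pi) 0
    rw [zero_add, show -Real.pi + 2 * Real.pi = Real.pi by ring] at h1
    rw [h1, integral_im_deriv_div_eq_sub hγ hγ0 hθ hlift, hθ2]
  rw [integral_ball_eq_polar (H := fun z => radialBump σ (F z) * (fderiv ℝ F z).det)
    (((continuous_radialBump σ).comp hF.continuous).mul hdet) c hr]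
  simp only [hbdry, hwind] at hgreen
  have : ∀ s t, s * (radialBump σ (F (circleMap c s t)) * (fderiv ℝ F (circleMap c s t)).det) =
      (2 * Real.pi)⁻¹ * (2 * deriv (smoothStep σ) (Complex.normSq (G (s, t))) *
        ((starRingEnd ℂ) (fderiv ℝ G (s, t) (1, 0)) * fderiv ℝ G (s, t) (0, 1)).im) := by
    intro s t
    rw [hG1, hG2, ContinuousLinearMap.im_conj_mul_eq_det_mul]
    have : ((starRingEnd ℂ) (Complex.exp (t * Complex.I)) * (circleMap 0 s t * Complex.I)).im = s := by
      rw [circleMap, zero_add, ← Complex.exp_conj]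
      have h : Complex.exp ((starRingEnd ℂ) (t * Complex.I)) *
          (s * Complex.exp (t * Complex.I) * Complex.I) = s * Complex.I *
          Complex.exp ((starRingEnd ℂ) (t * Complex.I) + t * Complex.I) := by
        rw [Complex.exp_add]; ring
      rw [h]
      simp
    rw [this, radialBump]
    simp only [G]
    field_simp
  simp only [this, intervalIntegral.integral_const_mul]
  rw [hgreen]
  field_simp

/-! ### Degree formula for Sobolev maps -/

/-- The determinant is a quadratic form in A, so L² convergence of differentials will give L¹
convergence of Jacobians. -/
theorem ContinuousLinearMap.abs_det_sub_det_le (A B : ℂ →L[ℝ] ℂ) :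
    |A.det - B.det| ≤ ‖A - B‖ * (‖A - B‖ + 2 * ‖B‖) := by
  have h : ∀ A : ℂ →L[ℝ] ℂ, A.det = ((starRingEnd ℂ) (A 1) * A Complex.I).im := fun A => by
    rw [A.im_conj_mul_eq_det_mul]; simp
  have h1 : ∀ A : ℂ →L[ℝ] ℂ, ‖A 1‖ ≤ ‖A‖ := fun A => by simpa using A.le_opNorm 1
  have hI : ∀ A : ℂ →L[ℝ] ℂ, ‖A Complex.I‖ ≤ ‖A‖ := fun A => by simpa using A.le_opNorm Complex.I
  have hsplit : A.det - B.det = ((starRingEnd ℂ) ((A - B) 1) * (A - B) Complex.I +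
      (starRingEnd ℂ) ((A - B) 1) * B Complex.I + (starRingEnd ℂ) (B 1) * (A - B) Complex.I).im := by
    rw [h, h, ← Complex.sub_im]
    congr 1
    simp only [sub_apply, map_sub]
    ring
  rw [hsplit]
  refine (Complex.abs_im_le_norm _).trans ?_
  refine (norm_add₃_le).trans ?_
  simp only [norm_mul, RCLike.norm_conj]
  have e1 := mul_le_mul (h1 (A - B)) (hI (A - B)) (norm_nonneg _) (norm_nonneg _)
  have e2 := mul_le_mul (h1 (A - B)) (hI B) (norm_nonneg _) (norm_nonneg _)
  have e3 := mul_le_mul (h1 B) (hI (A - B)) (norm_nonneg _) (norm_nonneg _)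
  linarith

theorem lintegral_enorm_mul_enorm_le {α E F : Type*} [MeasurableSpace α] {μ : Measure α}
    [NormedAddCommGroup E] [NormedAddCommGroup F] {u : α → E} {v : α → F}
    (hu : AEStronglyMeasurable u μ) (hv : AEStronglyMeasurable v μ) :
    ∫⁻ x, ‖u x‖ₑ * ‖v x‖ₑ ∂μ ≤ eLpNorm u 2 μ * eLpNorm v 2 μ := by
  have := ENNReal.lintegral_mul_le_Lp_mul_Lq μ Real.HolderConjugate.two_two hu.enorm hv.enorm
  rw [eLpNorm_eq_lintegral_rpow_enorm_toReal two_ne_zero ENNReal.ofNat_ne_top,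
    eLpNorm_eq_lintegral_rpow_enorm_toReal two_ne_zero ENNReal.ofNat_ne_top]
  simpa using this

theorem aestronglyMeasurable_det {μ : Measure ℂ} {g : ℂ → ℂ →L[ℝ] ℂ}
    (hg : AEStronglyMeasurable g μ) : AEStronglyMeasurable (fun z => (g z).det) μ :=
  ContinuousLinearMap.continuous_det.comp_aestronglyMeasurable hg

theorem integrable_det {μ : Measure ℂ} {g : ℂ → ℂ →L[ℝ] ℂ} (hg : MemLp g 2 μ) :
    Integrable (fun z => (g z).det) μ := by
  have h2 : Integrable (fun z => ‖g z‖ ^ 2) μ := by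
    simpa using hg.integrable_norm_pow (by norm_num)
  refine h2.mono (aestronglyMeasurable_det hg.1) (Eventually.of_forall fun z => ?_)
  have := ContinuousLinearMap.abs_det_sub_det_le (g z) 0
  have h0 : (0 : ℂ →L[ℝ] ℂ).det = 0 := by
    have := (0 : ℂ →L[ℝ] ℂ).im_conj_mul_eq_det_mul 1 Complex.I
    simpa using this.symm
  rw [h0] at this
  simp only [sub_zero, norm_zero, mul_zero, add_zero] at this
  simpa [sq] using this

theorem tendsto_lintegral_det_sub {μ : Measure ℂ} {g : ℂ → ℂ →L[ℝ] ℂ} (hg : MemLp g 2 μ)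
    {A : ℕ → ℂ → ℂ →L[ℝ] ℂ} (hA : ∀ n, AEStronglyMeasurable (A n) μ)
    (hAg : Tendsto (fun n => eLpNorm (A n - g) 2 μ) atTop (𝓝 0)) :
    Tendsto (fun n => ∫⁻ z, ‖(A n z).det - (g z).det‖ₑ ∂μ) atTop (𝓝 0) := by
  have hbound : ∀ n, ∫⁻ z, ‖(A n z).det - (g z).det‖ₑ ∂μ ≤
      eLpNorm (A n - g) 2 μ * eLpNorm (A n - g) 2 μ +
        2 * (eLpNorm (A n - g) 2 μ * eLpNorm g 2 μ) := by
    intro n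
    have hm : AEStronglyMeasurable (A n - g) μ := (hA n).sub hg.1
    calc ∫⁻ z, ‖(A n z).det - (g z).det‖ₑ ∂μ
        ≤ ∫⁻ z, (‖(A n - g) z‖ₑ * ‖(A n - g) z‖ₑ + 2 * (‖(A n - g) z‖ₑ * ‖g z‖ₑ)) ∂μ := by
          refine lintegral_mono fun z => ?_
          have h := ContinuousLinearMap.abs_det_sub_det_le (A n z) (g z)
          rw [← Real.norm_eq_abs, show ‖A n z - g z‖ * (‖A n z - g z‖ + 2 * ‖g z‖) =
            ‖A n z - g z‖ * ‖A n z - g z‖ + 2 * (‖A n z - g z‖ * ‖g z‖) by ring] at h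
          have h' := ENNReal.ofReal_le_ofReal h
          rw [ENNReal.ofReal_add (by positivity) (by positivity),
            ENNReal.ofReal_mul (by positivity), ENNReal.ofReal_mul (by positivity),
            ENNReal.ofReal_mul (by positivity)] at h'
          simpa [ofReal_norm, ← Real.enorm_eq_ofReal_abs] using h'
      _ = ∫⁻ z, ‖(A n - g) z‖ₑ * ‖(A n - g) z‖ₑ ∂μ +
          2 * ∫⁻ z, ‖(A n - g) z‖ₑ * ‖g z‖ₑ ∂μ := by
        rw [lintegral_add_left' (f := fun z => ‖(A n - g) z‖ₑ * ‖(A n - g) z‖ₑ)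
          (hm.enorm.mul hm.enorm), lintegral_const_mul' _ _ (by norm_num)]
      _ ≤ _ := by
        gcongr
        · exact lintegral_enorm_mul_enorm_le hm hm
        · exact lintegral_enorm_mul_enorm_le hm hg.1
  refine tendsto_of_tendsto_of_tendsto_of_le_of_le tendsto_const_nhds ?_ (fun _ => zero_le) hbound
  have h1 := ENNReal.Tendsto.mul hAg (Or.inr ENNReal.zero_ne_top) hAg (Or.inr ENNReal.zero_ne_top)
  have h2 := ENNReal.Tendsto.const_mul (a := 2)
    (ENNReal.Tendsto.mul_const (b := eLpNorm g 2 μ) hAg (Or.inr hg.2.ne)) (Or.inr (by norm_num))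
  simpa using h1.add h2

/-- The degree formula on a disk for an orientation preserving Sobolev map. -/
theorem integral_ball_radialBump_mul_det_of_isSobolevLoc {U : Set ℂ} (hU : IsOpen U) {f : ℂ → ℂ}
    (hf : ContinuousOn f U) (ho : IsOrientationPreservingOn U f) {g : ℂ → ℂ →L[ℝ] ℂ}
    (hS : IsSobolevLoc U f g) {c : ℂ} {r σ : ℝ} (hr : 0 < r) (hσ : 0 < σ)
    (hrU : Metric.closedBall c r ⊆ U) (hbd : ∀ t, σ < ‖f (circleMap c r t) - f c‖) :
    IntegrableOn (fun z => radialBump σ (f z - f c) * (g z).det) (Metric.ball c r) ∧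
      ∫ z in Metric.ball c r, radialBump σ (f z - f c) * (g z).det = 1 := by
  set B := Metric.closedBall c r
  have hB : IsCompact B := isCompact_closedBall c r
  obtain ⟨F, hF, hFf, hFg⟩ := hS.exists_smooth_approx hU hf hB hrU
  have hfB : ContinuousOn f B := hf.mono hrU
  have hgB : MemLp g 2 (volume.restrict B) := (hS.1 B hB hrU).2
  have hcirc : ∀ t, circleMap c r t ∈ B := fun t => circleMap_mem_closedBall c hr.le t
  have hγ₀ : Continuous fun t => f (circleMap c r t) - f c :=
    (hfB.comp_continuous (continuous_circleMap c r) hcirc).sub continuous_const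
  obtain ⟨θ, hθ, hθ2, hlift⟩ := ho c r hr hrU
  obtain ⟨M, hM⟩ := (continuous_radialBump σ).bounded_above_of_compact_support
    (hasCompactSupport_radialBump hσ)
  -- Compactness of the circle turns the strict inequality into a margin σ', which pays for
  -- replacing f by a uniform approximant.
  obtain ⟨σ', hσ', hσbd⟩ : ∃ σ' > 0, ∀ t, σ + σ' ≤ ‖f (circleMap c r t) - f c‖ := by
    obtain ⟨t₀, -, ht₀⟩ := (isCompact_Icc (a := 0) (b := 2 * Real.pi)).exists_isMinOn
      ⟨0, by simp [Real.pi_pos.le]⟩ hγ₀.norm.continuousOn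
    refine ⟨‖f (circleMap c r t₀) - f c‖ - σ, by linarith [hbd t₀], fun t => ?_⟩
    obtain ⟨s, hs, hst⟩ := (periodic_circleMap c r).exists_mem_Ico₀ Real.two_pi_pos t
    rw [hst]
    have := ht₀ (Ico_subset_Icc_self hs)
    simp only [mem_ofPred_eq] at this
    linarith
  have hone : ∀ᶠ n in atTop, ∫ z in Metric.ball c r,
      radialBump σ (F n z - f c) * (fderiv ℝ (F n) z).det = 1 := by
    filter_upwards [Metric.tendstoUniformlyOn_iff.1 hFf σ' hσ'] with n hn
    have hclose : ∀ t, ‖(F n (circleMap c r t) - f c) - (f (circleMap c r t) - f c)‖ < σ' := by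
      intro t
      have := hn _ (hcirc t)
      rw [dist_comm, dist_eq_norm] at this
      simpa using this
    obtain ⟨θ', hθ', hθ'2, hlift'⟩ := exists_lift_of_norm_sub_lt (T := 2 * Real.pi) hγ₀
      (γ := fun t => F n (circleMap c r t) - f c)
      (((hF n).continuous.comp (continuous_circleMap c r)).sub continuous_const)
      (by simp [circleMap]) (by simp [circleMap])
      (fun t => (hclose t).trans_le (by linarith [hσbd t])) hθ hlift
    have h := integral_ball_radialBump_mul_det (F := fun z => F n z - f c)
      ((hF n).sub contDiff_const) hr.le hσ (c := c) (fun t => by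
        have h1 := hclose t
        have h2 := hσbd t
        have h3 := norm_sub_norm_le (f (circleMap c r t) - f c) (F n (circleMap c r t) - f c)
        rw [norm_sub_rev (f _ - f c)] at h3
        linarith) hθ' (by rw [hθ'2, hθ2]; ring) hlift'
    simpa only [fderiv_sub_const] using h
  set μ := volume.restrict (Metric.ball c r)
  have hμ : μ ≤ volume.restrict B := Measure.restrict_mono Metric.ball_subset_closedBall le_rfl
  have hgμ : MemLp g 2 μ := hgB.mono_measure hμ
  have hFgμ : Tendsto (fun n => eLpNorm (fderiv ℝ (F n) - g) 2 μ) atTop (𝓝 0) :=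
    tendsto_of_tendsto_of_tendsto_of_le_of_le tendsto_const_nhds hFg (fun _ => zero_le)
      fun n => eLpNorm_mono_measure _ hμ
  have hFc : ∀ n, Continuous (fderiv ℝ (F n)) := fun n => (hF n).continuous_fderiv (by simp)
  have hdet := tendsto_lintegral_det_sub hgμ (fun n => (hFc n).aestronglyMeasurable) hFgμ
  have hdi := integrable_det hgμ
  have hfin : IsFiniteMeasure μ := ⟨by
    rw [Measure.restrict_apply_univ]; exact measure_ball_lt_top⟩
  have hFi : ∀ n, Integrable (fun z => (fderiv ℝ (F n) z).det) μ := fun n => by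
    have : IntegrableOn (fun z => (fderiv ℝ (F n) z).det) B volume :=
      (ContinuousLinearMap.continuous_det.comp (hFc n)).continuousOn.integrableOn_compact hB
    exact this.mono_set Metric.ball_subset_closedBall
  have hfm : AEStronglyMeasurable f μ :=
    (hfB.mono Metric.ball_subset_closedBall).aestronglyMeasurable Metric.isOpen_ball.measurableSet
  have hbm : ∀ n, AEStronglyMeasurable (fun z => radialBump σ (F n z - f c)) μ := fun n =>
    ((continuous_radialBump σ).comp
      ((hF n).continuous.sub continuous_const)).aestronglyMeasurable
  have hbfm : AEStronglyMeasurable (fun z => radialBump σ (f z - f c)) μ :=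
    (continuous_radialBump σ).comp_aestronglyMeasurable (hfm.sub aestronglyMeasurable_const)
  have hint1 : ∀ n, Integrable (fun z => radialBump σ (F n z - f c) *
      ((fderiv ℝ (F n) z).det - (g z).det)) μ := fun n =>
    ((hFi n).sub hdi).bdd_mul (hbm n) (Eventually.of_forall fun z => hM _)
  have hint2 : ∀ n, Integrable (fun z => radialBump σ (F n z - f c) * (g z).det) μ := fun n =>
    hdi.bdd_mul (hbm n) (Eventually.of_forall fun z => hM _)
  have hint3 : Integrable (fun z => radialBump σ (f z - f c) * (g z).det) μ :=
    hdi.bdd_mul hbfm (Eventually.of_forall fun z => hM _)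
  -- The passage to the limit is split: first the Jacobian of `F n` is replaced by that of f, using
  -- the L¹ convergence and a bounded weight; then the weight is replaced, by dominated convergence.
  have hlim1 : Tendsto (fun n => ∫ z, radialBump σ (F n z - f c) *
      ((fderiv ℝ (F n) z).det - (g z).det) ∂μ) atTop (𝓝 0) := by
    have h1 : Tendsto (fun n => ENNReal.ofReal M * ∫⁻ z, ‖(fderiv ℝ (F n) z).det - (g z).det‖ₑ ∂μ)
        atTop (𝓝 0) := by
      simpa using ENNReal.Tendsto.const_mul hdet (Or.inr ENNReal.ofReal_ne_top)
    rw [tendsto_zero_iff_enorm_tendsto_zero]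
    refine tendsto_of_tendsto_of_tendsto_of_le_of_le tendsto_const_nhds h1 (fun _ => zero_le)
      fun n => ?_
    refine (enorm_integral_le_lintegral_enorm _).trans ?_
    rw [← lintegral_const_mul' _ _ ENNReal.ofReal_ne_top]
    refine lintegral_mono fun z => ?_
    rw [enorm_mul]
    gcongr
    rw [← ofReal_norm]
    exact ENNReal.ofReal_le_ofReal (hM _)
  have hlim2 : Tendsto (fun n => ∫ z, radialBump σ (F n z - f c) * (g z).det ∂μ) atTop
      (𝓝 (∫ z, radialBump σ (f z - f c) * (g z).det ∂μ)) := by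
    refine tendsto_integral_of_dominated_convergence (fun z => M * ‖(g z).det‖)
      (fun n => (hint2 n).1) (hdi.norm.const_mul M) (fun n => Eventually.of_forall fun z => ?_) ?_
    · rw [norm_mul]; gcongr; exact hM _
    · filter_upwards [ae_restrict_mem Metric.isOpen_ball.measurableSet] with z hz
      refine Tendsto.mul_const _ ?_
      exact ((continuous_radialBump σ).tendsto _).comp
        ((hFf.tendsto_at (Metric.ball_subset_closedBall hz)).sub_const (f c))
  refine ⟨hint3, ?_⟩
  have hsum := hlim1.add hlim2
  rw [zero_add] at hsum
  refine tendsto_nhds_unique hsum ?_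
  refine tendsto_const_nhds.congr' ?_
  filter_upwards [hone] with n hn
  rw [← integral_add (hint1 n) (hint2 n), ← hn]
  congr 1; ext z; ring

/-! ### The area inequality -/

/-- This is the degree formula for the identity map on the disk of radius 2σ. -/
theorem lintegral_radialBump {σ : ℝ} (hσ : 0 < σ) (w : ℂ) :
    ∫⁻ y, ENNReal.ofReal (radialBump σ (y - w)) = 1 := by
  rw [lintegral_sub_right_eq_self (fun y => ENNReal.ofReal (radialBump σ y)) w]
  have hball := integral_ball_radialBump_mul_det (F := fun z => z) contDiff_id (c := 0) (r := 2 * σ)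
    (by positivity) hσ (fun t => by simp [abs_of_pos hσ]; linarith) (θ := fun t => t)
    continuous_id (by simp) (fun t => by simp [circleMap, abs_of_pos hσ])
  have hdet : ∀ z : ℂ, (fderiv ℝ (fun z : ℂ => z) z).det = 1 := fun z => by
    have := (fderiv ℝ (fun z : ℂ => z) z).im_conj_mul_eq_det_mul 1 Complex.I
    simpa using this.symm
  simp only [hdet, mul_one] at hball
  have hsupp : ∀ z ∉ Metric.ball (0 : ℂ) (2 * σ), radialBump σ z = 0 := fun z hz =>
    radialBump_eq_zero hσ (by
      rw [mem_ball_zero_iff, not_lt] at hz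
      linarith)
  rw [setIntegral_eq_integral_of_forall_compl_eq_zero hsupp] at hball
  rw [← ofReal_integral_eq_lintegral_ofReal ((continuous_radialBump σ).integrable_of_hasCompactSupport
    (hasCompactSupport_radialBump hσ)) (Eventually.of_forall (radialBump_nonneg σ)), hball,
    ENNReal.ofReal_one]

/-- Uniform continuity of the inverse map near the compact set T. -/
theorem exists_uniform_symm_bound (f : OpenPartialHomeomorph ℂ ℂ) {T : Set ℂ} (hT : IsCompact T)
    (hTf : T ⊆ f.target) : ∃ r > 0, ∃ δ > 0, ∀ w ∈ T,
      Metric.closedBall (f.symm w) r ⊆ f.source ∧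
      ∀ x ∈ f.source, ‖f x - w‖ < δ → x ∈ Metric.ball (f.symm w) r := by
  have hS : IsCompact (f.symm '' T) := hT.image_of_continuousOn (f.continuousOn_symm.mono hTf)
  obtain ⟨r, hr, hrs⟩ := hS.exists_cthickening_subset_open f.open_source (by
    rintro _ ⟨w, hw, rfl⟩
    exact f.map_target (hTf hw))
  have hunif := hT.uniformContinuousAt_of_continuousAt f.symm
    (fun w hw => f.continuousAt_symm (hTf hw)) (Metric.dist_mem_uniformity hr)
  obtain ⟨δ, hδ, h⟩ := Metric.mem_uniformity_dist.1 hunif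
  refine ⟨r, hr, δ, hδ, fun w hw => ⟨?_, fun x hx hxw => ?_⟩⟩
  · exact (Metric.closedBall_subset_cthickening (mem_image_of_mem _ hw) r).trans hrs
  · have := h (a := w) (b := f x) (by rwa [dist_comm, dist_eq_norm]) hw
    simp only [mem_ofPred_eq] at this
    rw [f.left_inv hx] at this
    rwa [Metric.mem_ball, dist_comm]

/-- For small σ the bump about w, pulled back by f, lives in a fixed ball about f⁻¹(w). The degree
formula there gives mass exactly one, and the Jacobian is nonnegative. -/
theorem lintegral_radialBump_comp_mul_det_le (f : OpenPartialHomeomorph ℂ ℂ)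
    (ho : IsOrientationPreservingOn f.source f) {g : ℂ → ℂ →L[ℝ] ℂ}
    (hS : IsSobolevLoc f.source f g)
    (hg : ∀ᵐ z ∂(volume.restrict f.source), 0 ≤ (g z).det) {T : Set ℂ} (hT : IsCompact T)
    (hTf : T ⊆ f.target) : ∃ σ₀ > 0, ∀ σ, 0 < σ → σ < σ₀ → ∀ w ∈ T, ∀ C ⊆ f.source,
      ∫⁻ z in C, ENNReal.ofReal (radialBump σ (f z - w)) * ENNReal.ofReal (g z).det ≤ 1 := by
  obtain ⟨r, hr, δ, hδ, h⟩ := exists_uniform_symm_bound f hT hTf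
  refine ⟨δ, hδ, fun σ hσ hσδ w hw C hC => ?_⟩
  obtain ⟨hball, hin⟩ := h w hw
  have hfw : f (f.symm w) = w := f.right_inv (hTf hw)
  obtain ⟨hi, h1⟩ := integral_ball_radialBump_mul_det_of_isSobolevLoc f.open_source f.continuousOn
    ho hS hr hσ hball (fun t => by
      by_contra hcon
      rw [hfw, not_lt] at hcon
      have hx : circleMap (f.symm w) r t ∈ f.source := hball (circleMap_mem_closedBall _ hr.le t)
      have := hin _ hx (hcon.trans_lt hσδ)
      have hs := circleMap_mem_sphere (f.symm w) hr.le t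
      rw [Metric.mem_sphere] at hs
      rw [Metric.mem_ball, hs] at this
      exact lt_irrefl _ this)
  rw [hfw] at hi h1
  have hpos : 0 ≤ᵐ[volume.restrict (Metric.ball (f.symm w) r)]
      fun z => radialBump σ (f z - w) * (g z).det := by
    have := ae_restrict_of_ae_restrict_of_subset
      (Metric.ball_subset_closedBall.trans hball) hg
    filter_upwards [this] with z hz using mul_nonneg (radialBump_nonneg _ _) hz
  have h2 := ofReal_integral_eq_lintegral_ofReal hi hpos
  rw [h1, ENNReal.ofReal_one] at h2
  calc ∫⁻ z in C, ENNReal.ofReal (radialBump σ (f z - w)) * ENNReal.ofReal (g z).det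
      ≤ ∫⁻ z in f.source, ENNReal.ofReal (radialBump σ (f z - w)) * ENNReal.ofReal (g z).det :=
        lintegral_mono_set hC
    _ = ∫⁻ z in f.source, (Metric.ball (f.symm w) r).indicator (fun z =>
          ENNReal.ofReal (radialBump σ (f z - w) * (g z).det)) z := by
        refine setLIntegral_congr_fun f.open_source.measurableSet fun z hz => ?_
        by_cases hzb : z ∈ Metric.ball (f.symm w) r
        · rw [indicator_of_mem hzb, ENNReal.ofReal_mul (radialBump_nonneg _ _)]
        · rw [indicator_of_notMem hzb, radialBump_eq_zero hσ]
          · simp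
          · by_contra hcon
            exact hzb (hin z hz ((not_lt.1 hcon).trans_lt hσδ))
    _ ≤ ∫⁻ z, (Metric.ball (f.symm w) r).indicator (fun z =>
          ENNReal.ofReal (radialBump σ (f z - w) * (g z).det)) z := setLIntegral_le_lintegral _ _
    _ = 1 := by rw [lintegral_indicator Metric.isOpen_ball.measurableSet, ← h2]

/-- Averages of ρ over shrinking bumps recover ρ(y); only the lower bound is needed, since it feeds
Fatou's lemma. -/
theorem ofReal_le_liminf_lintegral_radialBump {ρ : ℂ → ℝ} (hρ : Continuous ρ)
    {σ : ℕ → ℝ} (hσ0 : ∀ n, 0 < σ n) (hσ : Tendsto σ atTop (𝓝 0)) (y : ℂ) :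
    ENNReal.ofReal (ρ y) ≤ liminf (fun n => ∫⁻ w, ENNReal.ofReal (ρ w) *
      ENNReal.ofReal (radialBump (σ n) (y - w))) atTop := by
  refine le_of_forall_lt fun c hc => ?_
  obtain ⟨c', hcc', hc'⟩ := exists_between hc
  refine hcc'.trans_le (le_liminf_of_le (by isBoundedDefault) ?_)
  have hev : ∀ᶠ w in 𝓝 y, c' < ENNReal.ofReal (ρ w) :=
    ((ENNReal.continuous_ofReal.comp hρ).continuousAt (x := y)).eventually (lt_mem_nhds hc')
  obtain ⟨δ, hδ, hball⟩ := Metric.eventually_nhds_iff.1 hev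
  filter_upwards [hσ.eventually (gt_mem_nhds hδ)] with n hn
  have hsymm : ∀ w, radialBump (σ n) (y - w) = radialBump (σ n) (w - y) := fun w => by
    rw [radialBump, radialBump, ← Complex.normSq_neg, neg_sub]
  calc c' = c' * ∫⁻ w, ENNReal.ofReal (radialBump (σ n) (w - y)) := by
        rw [lintegral_radialBump (hσ0 n), mul_one]
    _ = ∫⁻ w, c' * ENNReal.ofReal (radialBump (σ n) (w - y)) := by
        rw [lintegral_const_mul' _ _ (hc'.trans ENNReal.ofReal_lt_top).ne]
    _ ≤ _ := by
        refine lintegral_mono fun w => ?_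
        rw [hsymm]
        by_cases hw : dist w y < δ
        · gcongr
          exact (hball hw).le
        · rw [radialBump_eq_zero (hσ0 n)]
          · simp
          · rw [← dist_eq_norm]; linarith

/-- The area inequality for orientation preserving Sobolev homeomorphisms. -/
theorem lintegral_comp_mul_det_le (f : OpenPartialHomeomorph ℂ ℂ)
    (ho : IsOrientationPreservingOn f.source f) {g : ℂ → ℂ →L[ℝ] ℂ}
    (hS : IsSobolevLoc f.source f g)
    (hg : ∀ᵐ z ∂(volume.restrict f.source), 0 ≤ (g z).det) {ρ : ℂ → ℝ} (hρ : Continuous ρ)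
    (hρc : HasCompactSupport ρ) (hρf : tsupport ρ ⊆ f.target) {C : Set ℂ}
    (hC : IsCompact C) (hCf : C ⊆ f.source) :
    ∫⁻ z in C, ENNReal.ofReal (ρ (f z)) * ENNReal.ofReal (g z).det ≤
      ∫⁻ w, ENNReal.ofReal (ρ w) := by
  obtain ⟨σ₀, hσ₀, h⟩ := lintegral_radialBump_comp_mul_det_le f ho hS hg hρc hρf
  set σ : ℕ → ℝ := fun n => σ₀ / (n + 2)
  have hσ0 : ∀ n, 0 < σ n := fun n => by positivity
  have hσlt : ∀ n, σ n < σ₀ := fun n =>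
    div_lt_self hσ₀ (by linarith [(Nat.cast_nonneg n : (0 : ℝ) ≤ n)])
  have hσ : Tendsto σ atTop (𝓝 0) := by
    have := (tendsto_const_div_atTop_nhds_zero_nat σ₀).comp (tendsto_add_atTop_nat 2)
    refine this.congr fun n => ?_
    simp [σ]
  set μ := volume.restrict C
  have hfm : AEMeasurable f μ := (f.continuousOn.mono hCf).aemeasurable hC.measurableSet
  have hgm : AEMeasurable (fun z => ENNReal.ofReal (g z).det) μ :=
    (aestronglyMeasurable_det (hS.1 C hC hCf).2.1).aemeasurable.ennreal_ofReal
  have hρm : Measurable fun w => ENNReal.ofReal (ρ w) := hρ.measurable.ennreal_ofReal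
  have hbm : ∀ n, AEMeasurable (fun p : ℂ × ℂ => ENNReal.ofReal (ρ p.2) *
      ENNReal.ofReal (radialBump (σ n) (f p.1 - p.2)) * ENNReal.ofReal (g p.1).det)
      (μ.prod volume) := by
    intro n
    have h1 : AEMeasurable (fun p : ℂ × ℂ => f p.1) (μ.prod volume) :=
      hfm.comp_quasiMeasurePreserving Measure.quasiMeasurePreserving_fst
    have h2 : AEMeasurable (fun p : ℂ × ℂ => ENNReal.ofReal (g p.1).det) (μ.prod volume) :=
      hgm.comp_quasiMeasurePreserving Measure.quasiMeasurePreserving_fst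
    have h3 := ((continuous_radialBump (σ n)).measurable.comp_aemeasurable
      (h1.sub measurable_snd.aemeasurable)).ennreal_ofReal
    exact ((hρm.comp measurable_snd).aemeasurable.mul h3).mul h2
  have hinner : ∀ n z, (∫⁻ w, ENNReal.ofReal (ρ w) *
        ENNReal.ofReal (radialBump (σ n) (f z - w))) * ENNReal.ofReal (g z).det =
      ∫⁻ w, ENNReal.ofReal (ρ w) *
        ENNReal.ofReal (radialBump (σ n) (f z - w)) * ENNReal.ofReal (g z).det := fun n z => by
    rw [lintegral_mul_const' _ _ ENNReal.ofReal_ne_top]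
  -- Write ρ as the limit of its bump averages, use Fatou, and exchange the integrals: for each
  -- centre w in the support of ρ the inner integral is at most one.
  calc ∫⁻ z in C, ENNReal.ofReal (ρ (f z)) * ENNReal.ofReal (g z).det
      ≤ ∫⁻ z in C, liminf (fun n => (∫⁻ w, ENNReal.ofReal (ρ w) *
        ENNReal.ofReal (radialBump (σ n) (f z - w))) * ENNReal.ofReal (g z).det) atTop := by
        refine lintegral_mono fun z => ?_
        have h1 := ofReal_le_liminf_lintegral_radialBump hρ hσ0 hσ (f z)
        have h2 : ENNReal.ofReal (g z).det ≠ ⊤ := ENNReal.ofReal_ne_top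
        refine (mul_le_mul_left h1 _).trans (le_of_eq ?_)
        simp only [mul_comm _ (ENNReal.ofReal (g z).det)]
        exact (ENNReal.liminf_const_mul_of_ne_top h2).symm
    _ ≤ liminf (fun n => ∫⁻ z in C, (∫⁻ w, ENNReal.ofReal (ρ w) *
        ENNReal.ofReal (radialBump (σ n) (f z - w))) * ENNReal.ofReal (g z).det) atTop := by
        refine lintegral_liminf_le' fun n => ?_
        simp only [hinner]
        exact (hbm n).lintegral_prod_right'
    _ ≤ _ := by
        refine liminf_le_of_frequently_le' (Eventually.of_forall fun n => ?_).frequently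
        simp only [hinner]
        rw [lintegral_lintegral_swap (hbm n)]
        refine lintegral_mono fun w => ?_
        simp only [mul_assoc]
        rw [lintegral_const_mul' _ _ ENNReal.ofReal_ne_top]
        by_cases hw : w ∈ tsupport ρ
        · calc _ ≤ ENNReal.ofReal (ρ w) * 1 := by
                gcongr
                exact h (σ n) (hσ0 n) (hσlt n) w hw C hCf
            _ = _ := mul_one _
        · simp [image_eq_zero_of_notMem_tsupport hw]

/-! ### Dirichlet energy under quasiconformal pull-back -/

/-- On each compact subset of `Ω`, the function `h` is a uniform limit of `C¹` functions whose
Dirichlet energy is at most `E` in the limit. -/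
def HasEnergyLE (Ω : Set ℂ) (E : ℝ≥0∞) (h : ℂ → ℝ) : Prop :=
  ∀ C : Set ℂ, IsCompact C → C ⊆ Ω → ∀ η : ℝ, 0 < η → ∃ N : Set ℂ, IsOpen N ∧ C ⊆ N ∧
    ∃ s : ℂ → ℝ, ContDiffOn ℝ 1 s N ∧ (∀ z ∈ C, |s z - h z| < η) ∧
      ∫⁻ z in C, ‖fderiv ℝ s z‖ₑ ^ 2 ≤ E + ENNReal.ofReal η

theorem eLpNorm_two_sq {α F : Type*} [MeasurableSpace α] {μ : Measure α}
    [NormedAddCommGroup F] (u : α → F) : eLpNorm u 2 μ ^ 2 = ∫⁻ x, ‖u x‖ₑ ^ 2 ∂μ := by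
  have := eLpNorm_nnreal_pow_eq_lintegral (f := u) (μ := μ) (p := 2) two_ne_zero
  simpa using this

theorem enorm_fderiv_comp_le {E F G : Type*} [NormedAddCommGroup E] [NormedSpace ℝ E]
    [NormedAddCommGroup F] [NormedSpace ℝ F] [NormedAddCommGroup G] [NormedSpace ℝ G]
    {s : F → G} {f : E → F} {z : E} (hs : DifferentiableAt ℝ s (f z))
    (hf : DifferentiableAt ℝ f z) :
    ‖fderiv ℝ (s ∘ f) z‖ ≤ ‖fderiv ℝ s (f z)‖ * ‖fderiv ℝ f z‖ := by
  rw [fderiv_comp z hs hf]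
  exact ContinuousLinearMap.opNorm_comp_le _ _

/-- The energy bound for a pull-back by a quasiconformal map, for one smooth function. -/
theorem eLpNorm_norm_fderiv_comp_mul_sq_le {K : ℝ} (f : OpenPartialHomeomorph ℂ ℂ) (hK : 1 ≤ K)
    (ho : IsOrientationPreservingOn f.source f) {g : ℂ → ℂ →L[ℝ] ℂ}
    (hS : IsSobolevLoc f.source f g)
    (hg : ∀ᵐ z ∂(volume.restrict f.source), ‖g z‖ ^ 2 ≤ K * (g z).det)
    {C C' N : Set ℂ} (hC : IsCompact C) (hCf : C ⊆ f.source) (hC' : IsCompact C')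
    (hN : IsOpen N) (hC'N : C' ⊆ N) (hN' : C' ⊆ f.target) (hCC' : f '' C ⊆ interior C')
    {s : ℂ → ℝ} (hs : ContDiffOn ℝ 1 s N) :
    eLpNorm (fun z => ‖fderiv ℝ s (f z)‖ * ‖g z‖) 2 (volume.restrict C) ^ 2 ≤
      ENNReal.ofReal K * ∫⁻ w in C', ‖fderiv ℝ s w‖ₑ ^ 2 := by
  have hK0 : 0 ≤ K := zero_le_one.trans hK
  have hfC : IsCompact (f '' C) := hC.image_of_continuousOn (f.continuousOn.mono hCf)
  -- The area inequality needs a continuous compactly supported density, whereas s is only C¹ on N;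
  -- χ cuts |∇s|² off without changing it on f(C).
  obtain ⟨χ, hχ1, hχc, hχs, hχ01⟩ :=
    exists_continuousMap_one_of_isCompact_subset_isOpen hfC isOpen_interior hCC'
  have hsc : ContinuousOn (fderiv ℝ s) N := hs.continuousOn_fderiv_of_isOpen hN le_rfl
  set ρ : ℂ → ℝ := fun w => χ w * ‖fderiv ℝ s w‖ ^ 2
  have hρχ : tsupport ρ ⊆ tsupport χ := closure_mono fun w hw h0 => hw (by
    simp only [ρ]
    rw [show χ w = 0 from h0, zero_mul])
  have hχN : tsupport χ ⊆ N := hχs.trans (interior_subset.trans hC'N)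
  have hρ : Continuous ρ := by
    refine continuous_of_tsupport fun w hw => ?_
    exact χ.continuous.continuousAt.mul
      ((hsc.continuousAt (hN.mem_nhds (hχN (hρχ hw)))).norm.pow 2)
  have hρc : HasCompactSupport ρ := hχc.of_isClosed_subset (isClosed_tsupport _) hρχ
  have hpos : ∀ᵐ z ∂(volume.restrict f.source), 0 ≤ (g z).det := by
    filter_upwards [hg] with z hz
    by_contra hcon
    nlinarith [sq_nonneg ‖g z‖]
  have harea := lintegral_comp_mul_det_le f ho hS hpos hρ hρc
    (hρχ.trans (hχs.trans (interior_subset.trans hN'))) hC hCf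
  have hρle : ∫⁻ w, ENNReal.ofReal (ρ w) ≤ ∫⁻ w in C', ‖fderiv ℝ s w‖ₑ ^ 2 := by
    rw [← lintegral_indicator hC'.measurableSet]
    refine lintegral_mono fun w => ?_
    by_cases hw : w ∈ C'
    · rw [indicator_of_mem hw, ← ofReal_norm, ← ENNReal.ofReal_pow (norm_nonneg _)]
      exact ENNReal.ofReal_le_ofReal (mul_le_of_le_one_left (by positivity) (hχ01 w).2)
    · have : χ w = 0 := image_eq_zero_of_notMem_tsupport fun h => hw (interior_subset (hχs h))
      simp [ρ, this]
  rw [eLpNorm_two_sq]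
  calc ∫⁻ z in C, ‖‖fderiv ℝ s (f z)‖ * ‖g z‖‖ₑ ^ 2
      ≤ ∫⁻ z in C, ENNReal.ofReal K * (ENNReal.ofReal (ρ (f z)) * ENNReal.ofReal (g z).det) := by
        refine lintegral_mono_ae ?_
        filter_upwards [ae_restrict_of_ae_restrict_of_subset hCf hg,
          ae_restrict_mem hC.measurableSet] with z hz hzC
        have h1 : χ (f z) = 1 := hχ1 (mem_image_of_mem f hzC)
        rw [← ofReal_norm, ← ENNReal.ofReal_pow (norm_nonneg _),
          ← ENNReal.ofReal_mul (by simp only [ρ, h1]; positivity), ← ENNReal.ofReal_mul hK0]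
        refine ENNReal.ofReal_le_ofReal ?_
        simp only [ρ, h1, norm_mul, norm_norm, one_mul, mul_pow]
        calc _ ≤ ‖fderiv ℝ s (f z)‖ ^ 2 * (K * (g z).det) := by gcongr
          _ = _ := by ring
    _ ≤ _ := by
      rw [lintegral_const_mul' _ _ ENNReal.ofReal_ne_top]
      exact mul_le_mul_right (harea.trans hρle) _

/-- The approximants are s ∘ F with s an approximant of v and F a mollification of f. Their
gradients are bounded by |∇s(f)| ‖Df‖ plus a term small in L², and the main term is controlled by
the quasiconformal inequality and the area inequality. -/
theorem IsPlanarQuasiconformal.hasEnergyLE_comp {K : ℝ} {f : OpenPartialHomeomorph ℂ ℂ}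
    (hf : IsPlanarQuasiconformal K f) {Ω : Set ℂ} (hΩ : IsOpen Ω) {E : ℝ≥0∞} (hE : E ≠ ⊤)
    {v : ℂ → ℝ} (hv : HasEnergyLE Ω E v) :
    HasEnergyLE (f.source ∩ f ⁻¹' (Ω ∩ f.target)) (ENNReal.ofReal K * E) (v ∘ f) := by
  obtain ⟨hK, ho, g, hS, hg⟩ := hf
  have hK0 : 0 < K := zero_lt_one.trans_le hK
  intro C hC hCΩ η hη
  have hCf : C ⊆ f.source := fun z hz => (hCΩ hz).1
  have hfC : IsCompact (f '' C) := hC.image_of_continuousOn (f.continuousOn.mono hCf)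
  obtain ⟨C', hC', hfCC', hC'Ω⟩ := exists_compact_between hfC (hΩ.inter f.open_target)
    (image_subset_iff.2 fun z hz => (hCΩ hz).2)
  -- Half of η is spent on the approximation of v; the energy excess is multiplied by K, hence the
  -- second bound.
  have hη' : 0 < min (η / 2) (η / (2 * K)) := by positivity
  obtain ⟨N, hN, hC'N, s, hs, hsv, hsE⟩ := hv C' hC' (hC'Ω.trans inter_subset_left) _ hη'
  set A := eLpNorm (fun z => ‖fderiv ℝ s (f z)‖ * ‖g z‖) 2 (volume.restrict C) with hA
  have hAE : A ^ 2 ≤ ENNReal.ofReal K * E + ENNReal.ofReal (η / 2) := by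
    refine (eLpNorm_norm_fderiv_comp_mul_sq_le f hK ho hS hg hC hCf hC' hN hC'N
      (hC'Ω.trans inter_subset_right) hfCC' hs).trans ?_
    calc _ ≤ ENNReal.ofReal K * (E + ENNReal.ofReal (min (η / 2) (η / (2 * K)))) := by gcongr
      _ ≤ ENNReal.ofReal K * E + ENNReal.ofReal K * ENNReal.ofReal (η / (2 * K)) := by
        rw [mul_add]
        gcongr
        exact min_le_right _ _
      _ = _ := by
        rw [← ENNReal.ofReal_mul hK0.le]
        congr 2
        field_simp
  obtain ⟨F, hF, hFf, hFg⟩ := hS.exists_smooth_approx f.open_source f.continuousOn hC hCf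
  have hsc : ∀ w ∈ f '' C, ContinuousAt (fderiv ℝ s) w := fun w hw =>
    (hs.continuousOn_fderiv_of_isOpen hN le_rfl).continuousAt
      (hN.mem_nhds (hC'N (interior_subset (hfCC' hw))))
  have hss : ∀ w ∈ f '' C, ContinuousAt s w := fun w hw =>
    hs.continuousOn.continuousAt (hN.mem_nhds (hC'N (interior_subset (hfCC' hw))))
  obtain ⟨M, hM0, hM⟩ : ∃ M : ℝ, 0 ≤ M ∧ ∀ w ∈ f '' C, ‖fderiv ℝ s w‖ ≤ M := by
    obtain ⟨M, hM⟩ := hfC.exists_bound_of_continuousOn (f := fderiv ℝ s)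
      fun w hw => (hsc w hw).continuousWithinAt
    exact ⟨max M 0, le_max_right _ _, fun w hw => (hM w hw).trans (le_max_left _ _)⟩
  have hgC : MemLp g 2 (volume.restrict C) := (hS.1 C hC hCf).2
  set G := eLpNorm g 2 (volume.restrict C)
  have hG : G ≠ ⊤ := hgC.2.ne
  have hsymmC : ∀ n, AEStronglyMeasurable (fderiv ℝ (F n) - g) (volume.restrict C) := fun n =>
    (((hF n).continuous_fderiv (by simp)).aestronglyMeasurable).sub hgC.1
  have hAm : AEStronglyMeasurable (fun z => ‖fderiv ℝ s (f z)‖ * ‖g z‖) (volume.restrict C) := by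
    refine AEStronglyMeasurable.mul ?_ hgC.1.norm
    refine (ContinuousOn.aestronglyMeasurable (fun z hz => ?_) hC.measurableSet).norm
    exact (hsc _ (mem_image_of_mem f hz)).comp_continuousWithinAt (f.continuousOn.mono hCf z hz)
  have hKE : ENNReal.ofReal K * E ≠ ⊤ := ENNReal.mul_ne_top ENNReal.ofReal_ne_top hE
  have hlt : A ^ 2 < ENNReal.ofReal K * E + ENNReal.ofReal η := by
    refine hAE.trans_lt (ENNReal.add_lt_add_left hKE ?_)
    rw [ENNReal.ofReal_lt_ofReal_iff hη]
    linarith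
  have hcont : Tendsto (fun d : ℝ≥0∞ => (A + (ENNReal.ofReal (M + 1) * d + d * G)) ^ 2)
      (𝓝 0) (𝓝 (A ^ 2)) := by
    have h1 : Tendsto (fun d : ℝ≥0∞ => ENNReal.ofReal (M + 1) * d) (𝓝 0) (𝓝 0) := by
      simpa using (ENNReal.continuous_const_mul (a := ENNReal.ofReal (M + 1))
        ENNReal.ofReal_ne_top).tendsto 0
    have h2 : Tendsto (fun d : ℝ≥0∞ => d * G) (𝓝 0) (𝓝 0) := by
      simpa using (ENNReal.continuous_mul_const hG).tendsto 0
    have h3 := ((ENNReal.continuous_pow 2).tendsto _).comp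
      ((tendsto_const_nhds (x := A)).add (h1.add h2))
    rw [add_zero, add_zero] at h3
    exact h3
  have hd0 : Tendsto (fun d : ℝ => ENNReal.ofReal d) (𝓝[>] 0) (𝓝 0) := by
    simpa using (ENNReal.continuous_ofReal.tendsto 0).mono_left
      (nhdsWithin_le_nhds (s := Ioi (0 : ℝ)))
  have hlt1 : ∀ᶠ d : ℝ in 𝓝[>] 0, d < 1 := nhdsWithin_le_nhds (gt_mem_nhds (zero_lt_one' ℝ))
  -- The number d measures the closeness of both ∇s(F) to ∇s(f) and DF to Df. It is taken so small
  -- that the perturbed norm still satisfies the strict inequality `hlt`.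
  obtain ⟨d, hdA, hd1, hd⟩ := (((hcont.comp hd0).eventually (gt_mem_nhds hlt)).and
    (hlt1.and self_mem_nhdsWithin)).exists
  simp only [Function.comp_apply] at hdA
  have hd : 0 < d := hd
  have hd1 : d < 1 := hd1
  obtain ⟨δ, hδ, hδs⟩ := Metric.mem_uniformity_dist.1
    (hfC.uniformContinuousAt_of_continuousAt s hss (Metric.dist_mem_uniformity (half_pos hη)))
  obtain ⟨δ₂, hδ₂, hδs₂⟩ := Metric.mem_uniformity_dist.1
    (hfC.uniformContinuousAt_of_continuousAt _ hsc (Metric.dist_mem_uniformity hd))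
  obtain ⟨δ', hδ', hδN⟩ := hfC.exists_thickening_subset_open hN
    (hfCC'.trans (interior_subset.trans hC'N))
  have hdpos : (0 : ℝ≥0∞) < ENNReal.ofReal d := ENNReal.ofReal_pos.2 hd
  obtain ⟨n, hn, hnd⟩ := ((Metric.tendstoUniformlyOn_iff.1 hFf _
    (lt_min (lt_min hδ hδ₂) hδ')).and (hFg.eventually (gt_mem_nhds hdpos))).exists
  have hnN : ∀ z ∈ C, F n z ∈ N := fun z hz => hδN (Metric.mem_thickening_iff.2
    ⟨f z, mem_image_of_mem f hz, by
      rw [dist_comm]; exact (hn z hz).trans_le (min_le_right _ _)⟩)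
  refine ⟨F n ⁻¹' N, hN.preimage (hF n).continuous, hnN, s ∘ F n,
    hs.comp ((hF n).of_le (WithTop.coe_le_coe.2 le_top)).contDiffOn (mapsTo_preimage _ _),
    fun z hz => ?_, ?_⟩
  · have h1 := hδs ((hn z hz).trans_le ((min_le_left _ _).trans (min_le_left _ _)))
      (mem_image_of_mem f hz)
    have h2 := hsv (f z) (interior_subset (hfCC' (mem_image_of_mem f hz)))
    simp only [mem_ofPred_eq, Real.dist_eq] at h1
    have h3 := h2.trans_le (min_le_left _ _)
    rw [abs_lt] at h1 h3 ⊢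
    constructor <;> simp only [Function.comp_apply] <;> linarith [h1.1, h1.2, h3.1, h3.2]
  · rw [← eLpNorm_two_sq]
    refine le_trans ?_ hdA.le
    gcongr
    set u₂ : ℂ → ℝ := fun z => (M + 1) * ‖(fderiv ℝ (F n) - g) z‖
    set u₃ : ℂ → ℝ := fun z => d * ‖g z‖
    have hpt : ∀ᵐ z ∂(volume.restrict C), ‖fderiv ℝ (s ∘ F n) z‖ ≤
        ((fun z => ‖fderiv ℝ s (f z)‖ * ‖g z‖) + (u₂ + u₃)) z := by
      filter_upwards [ae_restrict_mem hC.measurableSet] with z hz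
      have hfz := mem_image_of_mem f hz
      have h1 := enorm_fderiv_comp_le (s := s) (f := F n) (z := z)
        ((hs.differentiableOn (by simp)).differentiableAt (hN.mem_nhds (hnN z hz)))
        ((hF n).differentiable (by simp)).differentiableAt
      have h2 := hδs₂ ((hn z hz).trans_le ((min_le_left _ _).trans (min_le_right _ _))) hfz
      simp only [mem_ofPred_eq, dist_eq_norm] at h2
      have h3 : ‖fderiv ℝ s (F n z)‖ ≤ ‖fderiv ℝ s (f z)‖ + d := by
        have := norm_sub_norm_le (fderiv ℝ s (F n z)) (fderiv ℝ s (f z))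
        rw [norm_sub_rev] at this
        linarith
      have h4 : ‖fderiv ℝ (F n) z‖ ≤ ‖g z‖ + ‖fderiv ℝ (F n) z - g z‖ := by
        have := norm_add_le (g z) (fderiv ℝ (F n) z - g z)
        simpa using this
      have h5 := hM _ hfz
      simp only [Pi.add_apply, Pi.sub_apply, u₂, u₃]
      calc _ ≤ _ := h1
        _ ≤ (‖fderiv ℝ s (f z)‖ + d) * (‖g z‖ + ‖fderiv ℝ (F n) z - g z‖) := by gcongr
        _ = ‖fderiv ℝ s (f z)‖ * ‖g z‖ +
            ((‖fderiv ℝ s (f z)‖ + d) * ‖fderiv ℝ (F n) z - g z‖ + d * ‖g z‖) := by ring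
        _ ≤ _ := by gcongr
    have hu₂m : AEStronglyMeasurable u₂ (volume.restrict C) := (hsymmC n).norm.const_mul _
    have hu₃m : AEStronglyMeasurable u₃ (volume.restrict C) := hgC.1.norm.const_mul _
    have hu₂ : eLpNorm u₂ 2 (volume.restrict C) =
        ENNReal.ofReal (M + 1) * eLpNorm (fderiv ℝ (F n) - g) 2 (volume.restrict C) := by
      have := eLpNorm_const_smul (M + 1) (fun z => ‖(fderiv ℝ (F n) - g) z‖) 2
        (volume.restrict C)
      rw [eLpNorm_norm, Real.enorm_of_nonneg (by positivity)] at this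
      exact this
    have hu₃ : eLpNorm u₃ 2 (volume.restrict C) = ENNReal.ofReal d * G := by
      have := eLpNorm_const_smul d (fun z => ‖g z‖) 2 (volume.restrict C)
      rw [eLpNorm_norm, Real.enorm_of_nonneg hd.le] at this
      exact this
    calc _ ≤ _ := eLpNorm_mono_ae_real hpt
      _ ≤ A + (eLpNorm u₂ 2 (volume.restrict C) + eLpNorm u₃ 2 (volume.restrict C)) :=
        (eLpNorm_add_le hAm (hu₂m.add hu₃m) one_le_two).trans
          (add_le_add le_rfl (eLpNorm_add_le hu₂m hu₃m one_le_two))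
      _ ≤ _ := by
        rw [hu₂, hu₃]
        gcongr

/-! ### Logarithmic cutoffs and the length-area inequality on annuli -/

theorem measurableSet_annulus (c : ℂ) (r₁ r₂ : ℝ) :
    MeasurableSet {z : ℂ | r₁ < ‖z - c‖ ∧ ‖z - c‖ < r₂} := by
  have hc : Continuous fun z : ℂ => ‖z - c‖ := (continuous_id.sub continuous_const).norm
  exact ((isOpen_lt continuous_const hc).inter (isOpen_lt hc continuous_const)).measurableSet

theorem setLIntegral_annulus_eq_polar {H : ℂ → ℝ≥0∞} (hH : Measurable H) (c : ℂ) {r₁ r₂ : ℝ}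
    (hr : 0 ≤ r₁) :
    ∫⁻ z in {z | r₁ < ‖z - c‖ ∧ ‖z - c‖ < r₂}, H z =
      ∫⁻ s in Ioo r₁ r₂, ∫⁻ t in Ioo (-Real.pi) Real.pi, ENNReal.ofReal s * H (circleMap c s t) := by
  have hpol : ∀ p : ℝ × ℝ, Complex.polarCoord.symm p + c = circleMap c p.1 p.2 := by
    intro p
    rw [Complex.polarCoord_symm_apply, circleMap, Complex.exp_mul_I, add_comm]
    simp
  have hA : MeasurableSet {z : ℂ | r₁ < ‖z - c‖ ∧ ‖z - c‖ < r₂} :=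
    measurableSet_annulus c r₁ r₂
  have hcm : Continuous fun p : ℝ × ℝ => circleMap c p.1 p.2 :=
    (contDiff_uncurry_circleMap c).continuous
  rw [← lintegral_indicator hA, ← lintegral_add_right_eq_self _ c,
    ← Complex.lintegral_comp_polarCoord_symm]
  have h2 : ∫⁻ p in polarCoord.target, ENNReal.ofReal p.1 •
        {z : ℂ | r₁ < ‖z - c‖ ∧ ‖z - c‖ < r₂}.indicator H (Complex.polarCoord.symm p + c)
      = ∫⁻ p in polarCoord.target, (Ioo r₁ r₂ ×ˢ univ : Set (ℝ × ℝ)).indicator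
        (fun p : ℝ × ℝ => ENNReal.ofReal p.1 * H (circleMap c p.1 p.2)) p := by
    refine setLIntegral_congr_fun polarCoord.open_target.measurableSet fun p hp => ?_
    have hp1 : 0 < p.1 := by simpa [polarCoord] using hp.1
    have hn : ‖Complex.polarCoord.symm p + c - c‖ = p.1 := by
      rw [add_sub_cancel_right, Complex.norm_polarCoord_symm, abs_of_pos hp1]
    by_cases h : p.1 ∈ Ioo r₁ r₂
    · rw [indicator_of_mem (by rw [mem_ofPred_eq, hn]; exact h),
        indicator_of_mem (mk_mem_prod h (mem_univ _)), hpol, smul_eq_mul]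
    · rw [indicator_of_notMem (by rw [mem_ofPred_eq, hn]; exact h),
        indicator_of_notMem (fun h' => h h'.1), smul_zero]
  rw [h2, setLIntegral_indicator (measurableSet_Ioo.prod MeasurableSet.univ)]
  have h3 : (Ioo r₁ r₂ ×ˢ univ : Set (ℝ × ℝ)) ∩ polarCoord.target =
      Ioo r₁ r₂ ×ˢ Ioo (-Real.pi) Real.pi := by
    ext p
    simp only [polarCoord, mem_inter_iff, mem_prod, mem_univ, and_true, mem_Ioo, mem_Ioi]
    constructor
    · rintro ⟨h1, -, h2⟩; exact ⟨h1, h2⟩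
    · rintro ⟨h1, h2⟩; exact ⟨h1, hr.trans_lt h1.1, h2⟩
  rw [h3, Measure.volume_eq_prod, setLIntegral_prod]
  exact ((ENNReal.measurable_ofReal.comp measurable_fst).mul (hH.comp hcm.measurable)).aemeasurable

theorem lintegral_Ioo_ofReal_const_div {a r₁ r₂ : ℝ} (ha : 0 ≤ a) (hr : 0 < r₁) (h12 : r₁ ≤ r₂) :
    ∫⁻ s in Ioo r₁ r₂, ENNReal.ofReal (a / s) = ENNReal.ofReal (a * Real.log (r₂ / r₁)) := by
  rw [restrict_Ioo_eq_restrict_Ioc]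
  have hint : IntervalIntegrable (fun s : ℝ => a / s) volume r₁ r₂ := by
    refine ContinuousOn.intervalIntegrable ?_
    rw [uIcc_of_le h12]
    exact continuousOn_const.div continuousOn_id fun s hs => (hr.trans_le hs.1).ne'
  have h := ofReal_integral_eq_lintegral_ofReal
    ((intervalIntegrable_iff_integrableOn_Ioc_of_le h12).1 hint)
    (by
      filter_upwards [ae_restrict_mem measurableSet_Ioc] with s hs
      exact div_nonneg ha (hr.trans hs.1).le)
  rw [← h, ← intervalIntegral.integral_of_le h12]
  congr 1
  simp only [div_eq_mul_inv]
  rw [intervalIntegral.integral_const_mul, integral_inv_of_pos hr (hr.trans_le h12),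
    ← div_eq_mul_inv]

/-- Every such point is a global extremum, the endpoints 0 and 1 included. -/
theorem deriv_smoothTransition_eq_zero {x : ℝ} (hx : x ≤ 0 ∨ 1 ≤ x) :
    deriv Real.smoothTransition x = 0 := by
  rcases hx with hx | hx
  · refine IsLocalMin.deriv_eq_zero (Eventually.of_forall fun y => ?_)
    rw [Real.smoothTransition.zero_of_nonpos hx]
    exact Real.smoothTransition.nonneg y
  · refine IsLocalMax.deriv_eq_zero (Eventually.of_forall fun y => ?_)
    rw [Real.smoothTransition.one_of_one_le hx]
    exact Real.smoothTransition.le_one y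

theorem exists_bound_deriv_smoothTransition :
    ∃ M : ℝ, 0 < M ∧ ∀ x, |deriv Real.smoothTransition x| ≤ M := by
  obtain ⟨M, hM⟩ := (isCompact_Icc (a := (0 : ℝ)) (b := 1)).exists_bound_of_continuousOn
    ((Real.smoothTransition.contDiff (n := 1)).continuous_deriv le_rfl).continuousOn
  refine ⟨max M 1, by positivity, fun x => ?_⟩
  by_cases hx : x ∈ Icc (0 : ℝ) 1
  · exact (hM x hx).trans (le_max_left _ _)
  · rw [deriv_smoothTransition_eq_zero]
    · simp
    · by_contra hcon
      push Not at hcon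
      exact hx ⟨hcon.1.le, hcon.2.le⟩

/-- The gradient of log |w - a|² has length 2 / |w - a|. -/
theorem exists_hasFDerivAt_log_normSq {a w : ℂ} (hw : w ≠ a) {h : ℝ} (hh : 0 < h) (Λ : ℝ) :
    ∃ L : ℂ →L[ℝ] ℝ, HasFDerivAt (fun w => Real.log (Complex.normSq (w - a) / h ^ 2) / Λ) L w ∧
      ‖L‖ ≤ 2 / (‖w - a‖ * |Λ|) := by
  set ζ := w - a
  have hζ : ζ ≠ 0 := sub_ne_zero.2 hw
  have hn : HasFDerivAt (fun w : ℂ => Complex.normSq (w - a))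
      ((2 * ζ.re) • Complex.reCLM + (2 * ζ.im) • Complex.imCLM) w := by
    have hs : HasFDerivAt (fun w : ℂ => w - a) (ContinuousLinearMap.id ℝ ℂ) w :=
      (hasFDerivAt_id w).sub_const a
    have h1 := (Complex.reCLM.hasFDerivAt (x := ζ)).comp w hs
    have h2 := (Complex.imCLM.hasFDerivAt (x := ζ)).comp w hs
    refine (((h1.mul h1).add (h2.mul h2)).congr_fderiv ?_).congr_of_eventuallyEq ?_
    · ext <;> (simp [ζ]; try ring)
    · exact Eventually.of_forall fun w => by simp [Complex.normSq_apply]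
  have hpos : 0 < Complex.normSq ζ := Complex.normSq_pos.2 hζ
  have hl := ((hn.mul_const ((h ^ 2)⁻¹)).log (by positivity)).mul_const Λ⁻¹
  refine ⟨_, hl, ?_⟩
  refine ContinuousLinearMap.opNorm_le_bound _ (by positivity) fun v => ?_
  have hval : (Λ⁻¹ • (Complex.normSq (w - a) * (h ^ 2)⁻¹)⁻¹ • (h ^ 2)⁻¹ •
      ((2 * ζ.re) • Complex.reCLM + (2 * ζ.im) • Complex.imCLM)) v =
      Λ⁻¹ * ((Complex.normSq ζ)⁻¹ * (2 * ((starRingEnd ℂ) ζ * v).re)) := by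
    simp [ζ]
    field_simp
    ring
  rw [hval, Real.norm_eq_abs, abs_mul, abs_mul, abs_mul, abs_inv, abs_inv, abs_two, abs_of_pos hpos]
  have hre : |((starRingEnd ℂ) ζ * v).re| ≤ ‖ζ‖ * ‖v‖ := by
    refine (Complex.abs_re_le_norm _).trans ?_
    rw [norm_mul, RCLike.norm_conj]
  have hζ' : 0 < ‖ζ‖ := norm_pos_iff.2 hζ
  calc _ ≤ |Λ|⁻¹ * ((Complex.normSq ζ)⁻¹ * (2 * (‖ζ‖ * ‖v‖))) := by gcongr
    _ = _ := by
      rw [Complex.normSq_eq_norm_sq]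
      field_simp

/-- The logarithmic cutoff functions on round annuli, with their energy. -/
theorem exists_log_cutoff : ∃ C₀ : ℝ, 0 < C₀ ∧ ∀ (a : ℂ) (h R : ℝ), 0 < h → h < R →
    ∃ u : ℂ → ℝ, ContDiff ℝ 1 u ∧ (∀ w, ‖w - a‖ ≤ h → u w = 0) ∧ (∀ w, R ≤ ‖w - a‖ → u w = 1) ∧
      ∫⁻ w, ‖fderiv ℝ u w‖ₑ ^ 2 ≤ ENNReal.ofReal (C₀ / Real.log (R / h)) := by
  obtain ⟨M, hM0, hM⟩ := exists_bound_deriv_smoothTransition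
  refine ⟨2 * Real.pi * M ^ 2, by positivity, fun a h R hh hR => ?_⟩
  have hR0 : 0 < R := hh.trans hR
  have hlog : 0 < Real.log (R / h) := Real.log_pos ((one_lt_div hh).2 hR)
  -- The factor 2 matches the square in `Complex.normSq`, so that ℓ runs from 0 at radius h to 1 at
  -- radius R. The energy is then at most 8πM²/Λ² · log(R/h) = 2πM² / log(R/h).
  set Λ := 2 * Real.log (R / h) with hΛ
  have hΛ0 : 0 < Λ := by positivity
  set ℓ : ℂ → ℝ := fun w => Real.log (Complex.normSq (w - a) / h ^ 2) / Λ
  have hℓ : ∀ w, ‖w - a‖ ≤ h → ℓ w ≤ 0 := fun w hw => by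
    refine div_nonpos_of_nonpos_of_nonneg (Real.log_nonpos ?_ ?_) hΛ0.le
    · exact div_nonneg (Complex.normSq_nonneg _) (by positivity)
    · rw [div_le_one (by positivity), Complex.normSq_eq_norm_sq]
      gcongr
  have hℓ1 : ∀ w, R ≤ ‖w - a‖ → 1 ≤ ℓ w := fun w hw => by
    rw [le_div_iff₀ hΛ0, one_mul, hΛ, ← Nat.cast_two, ← Real.log_pow, div_pow,
      Complex.normSq_eq_norm_sq]
    refine Real.log_le_log (by positivity) ?_
    gcongr
  have hsmooth : ContDiff ℝ 1 fun w => Real.smoothTransition (ℓ w) := by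
    refine contDiff_iff_contDiffAt.2 fun w => ?_
    by_cases hw : w = a
    · subst hw
      have : (fun w => Real.smoothTransition (ℓ w)) =ᶠ[𝓝 w] fun _ => 0 := by
        filter_upwards [Metric.ball_mem_nhds w hh] with y hy
        refine Real.smoothTransition.zero_of_nonpos (hℓ y ?_)
        rw [← dist_eq_norm]; exact (Metric.mem_ball.1 hy).le
      exact contDiffAt_const.congr_of_eventuallyEq this
    · have hpos : Complex.normSq (w - a) / h ^ 2 ≠ 0 :=
        (div_pos (Complex.normSq_pos.2 (sub_ne_zero.2 hw)) (by positivity)).ne'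
      have hn : ContDiff ℝ 1 fun w : ℂ => Complex.normSq (w - a) := by
        simp only [Complex.normSq_apply]
        have h1 : ContDiff ℝ 1 fun w : ℂ => (w - a).re :=
          Complex.reCLM.contDiff.comp (contDiff_id.sub contDiff_const)
        have h2 : ContDiff ℝ 1 fun w : ℂ => (w - a).im :=
          Complex.imCLM.contDiff.comp (contDiff_id.sub contDiff_const)
        exact (h1.mul h1).add (h2.mul h2)
      exact (Real.smoothTransition.contDiff (n := 1)).contDiffAt.comp w
        (((hn.div_const _).contDiffAt.log hpos).div_const _)
  refine ⟨fun w => Real.smoothTransition (ℓ w), hsmooth,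
    fun w hw => Real.smoothTransition.zero_of_nonpos (hℓ w hw),
    fun w hw => Real.smoothTransition.one_of_one_le (hℓ1 w hw), ?_⟩
  have hgrad : ∀ w, ‖fderiv ℝ (fun w => Real.smoothTransition (ℓ w)) w‖ₑ ^ 2 ≤
      {w | h < ‖w - a‖ ∧ ‖w - a‖ < R}.indicator
        (fun w => ENNReal.ofReal ((M * (2 / (‖w - a‖ * Λ))) ^ 2)) w := by
    intro w
    by_cases hw : w = a
    · subst hw
      have : (fun w => Real.smoothTransition (ℓ w)) =ᶠ[𝓝 w] fun _ => 0 := by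
        filter_upwards [Metric.ball_mem_nhds w hh] with y hy
        refine Real.smoothTransition.zero_of_nonpos (hℓ y ?_)
        rw [← dist_eq_norm]; exact (Metric.mem_ball.1 hy).le
      rw [this.fderiv_eq, ← ofReal_norm]
      simp
    obtain ⟨L, hL, hLn⟩ := exists_hasFDerivAt_log_normSq hw hh Λ
    rw [abs_of_pos hΛ0] at hLn
    have hT : HasDerivAt Real.smoothTransition (deriv Real.smoothTransition (ℓ w)) (ℓ w) :=
      ((Real.smoothTransition.contDiff (n := 1)).differentiable (by simp)).differentiableAt.hasDerivAt
    have hd : fderiv ℝ (fun w => Real.smoothTransition (ℓ w)) w =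
        deriv Real.smoothTransition (ℓ w) • L := (hT.comp_hasFDerivAt w hL).fderiv
    by_cases hin : h < ‖w - a‖ ∧ ‖w - a‖ < R
    · rw [indicator_of_mem (show w ∈ {w | h < ‖w - a‖ ∧ ‖w - a‖ < R} from hin), hd, ← ofReal_norm,
        ← ENNReal.ofReal_pow (norm_nonneg _), norm_smul]
      refine ENNReal.ofReal_le_ofReal ?_
      gcongr
      exact hM _
    · rw [indicator_of_notMem (by exact hin), hd, deriv_smoothTransition_eq_zero]
      · rw [← ofReal_norm]
        simp
      · rw [not_and_or, not_lt, not_lt] at hin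
        exact hin.imp (hℓ w) (hℓ1 w)
  refine (lintegral_mono hgrad).trans (le_of_eq ?_)
  have hA : MeasurableSet {w : ℂ | h < ‖w - a‖ ∧ ‖w - a‖ < R} :=
    measurableSet_annulus a h R
  rw [lintegral_indicator hA, setLIntegral_annulus_eq_polar (by fun_prop) a hh.le]
  have hinner : ∀ s ∈ Ioo h R, ∫⁻ t in Ioo (-Real.pi) Real.pi, ENNReal.ofReal s *
      ENNReal.ofReal ((M * (2 / (‖circleMap a s t - a‖ * Λ))) ^ 2) =
      ENNReal.ofReal (8 * Real.pi * M ^ 2 / Λ ^ 2 / s) := by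
    intro s hs
    have hs0 : 0 < s := hh.trans hs.1
    have : ∀ t, ‖circleMap a s t - a‖ = s := fun t => by simp [circleMap, abs_of_pos hs0]
    simp only [this]
    rw [setLIntegral_const, Real.volume_Ioo, ← ENNReal.ofReal_mul hs0.le,
      ← ENNReal.ofReal_mul (by positivity)]
    congr 1
    field_simp
    ring
  rw [setLIntegral_congr_fun measurableSet_Ioo hinner,
    lintegral_Ioo_ofReal_const_div (by positivity) hh hR.le]
  congr 1
  rw [hΛ]
  field_simp
  ring

/-- Conformal invariance of the Dirichlet integral: the squared norm of the differential is the
Jacobian, and M is injective, so the change of variables loses nothing. -/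
theorem hasEnergyLE_comp_of_differentiableOn {M : OpenPartialHomeomorph ℂ ℂ}
    (hM : DifferentiableOn ℂ M M.source) {u : ℂ → ℝ} (hu : ContDiff ℝ 1 u) {E : ℝ≥0∞}
    (hE : ∫⁻ w, ‖fderiv ℝ u w‖ₑ ^ 2 ≤ E) : HasEnergyLE M.source E (u ∘ M) := by
  intro C hC hCM η hη
  have hMs : ContDiffOn ℝ 1 M M.source :=
    ((hM.contDiffOn M.open_source).restrict_scalars ℝ)
  refine ⟨M.source, M.open_source, hCM, u ∘ M, hu.comp_contDiffOn hMs, by simp [hη], ?_⟩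
  refine le_trans ?_ ((hE.trans le_self_add))
  have hder : ∀ z ∈ M.source, HasDerivAt M (deriv M z) z := fun z hz =>
    (hM.differentiableAt (M.open_source.mem_nhds hz)).hasDerivAt
  set M' : ℂ → ℂ →L[ℝ] ℂ := fun z =>
    (ContinuousLinearMap.toSpanSingleton ℂ (deriv M z)).restrictScalars ℝ
  have hM' : ∀ z ∈ M.source, HasFDerivAt M (M' z) z := fun z hz =>
    (hder z hz).hasFDerivAt.restrictScalars ℝ
  have hdet : ∀ z, (M' z).det = ‖deriv M z‖ ^ 2 := fun z => by
    have := (M' z).im_conj_mul_eq_det_mul 1 Complex.I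
    simp only [M', ContinuousLinearMap.coe_restrictScalars',
      ContinuousLinearMap.toSpanSingleton_apply, smul_eq_mul] at this
    rw [map_one, one_mul, one_mul, Complex.I_im, mul_one] at this
    rw [← this, ← Complex.normSq_eq_norm_sq, Complex.normSq_apply]
    simp
  have hnorm : ∀ z, ‖M' z‖ = ‖deriv M z‖ := fun z => by
    simp only [M', ContinuousLinearMap.norm_restrictScalars,
      ContinuousLinearMap.norm_toSpanSingleton]
  calc ∫⁻ z in C, ‖fderiv ℝ (u ∘ M) z‖ₑ ^ 2
      ≤ ∫⁻ z in C, ENNReal.ofReal |(M' z).det| * ‖fderiv ℝ u (M z)‖ₑ ^ 2 := by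
        refine setLIntegral_mono_ae' hC.measurableSet (Eventually.of_forall fun z hz => ?_)
        have h1 := enorm_fderiv_comp_le (s := u) (f := M) (z := z)
          (hu.differentiable (by simp)).differentiableAt (hM' z (hCM hz)).differentiableAt
        rw [(hM' z (hCM hz)).fderiv, hnorm] at h1
        rw [hdet, abs_of_nonneg (by positivity), ← ofReal_norm, ← ofReal_norm,
          ← ENNReal.ofReal_pow (norm_nonneg _), ← ENNReal.ofReal_pow (norm_nonneg _),
          ← ENNReal.ofReal_mul (by positivity), ← mul_pow, mul_comm ‖deriv M z‖]
        gcongr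
    _ = ∫⁻ w in M '' C, ‖fderiv ℝ u w‖ₑ ^ 2 :=
        (lintegral_image_eq_lintegral_abs_det_fderiv_mul volume hC.measurableSet
          (fun z hz => (hM' z (hCM hz)).hasFDerivWithinAt) (M.injOn.mono hCM)
          (fun w => ‖fderiv ℝ u w‖ₑ ^ 2)).symm
    _ ≤ _ := setLIntegral_le_lintegral _ _

/-- An oscillation of 1/2 forces ∫ r|∇s| dt ≥ 1/2 over the circle, and Cauchy–Schwarz over an
interval of length 2π gives ∫ r|∇s|² dt ≥ 1/(8πr). -/
theorem ofReal_le_lintegral_circle {N : Set ℂ} (hN : IsOpen N) {s : ℂ → ℝ}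
    (hs : ContDiffOn ℝ 1 s N) {c : ℂ} {r : ℝ} (hr : 0 < r) (hrN : Metric.sphere c r ⊆ N)
    {z₁ z₂ : ℂ} (hz₁ : z₁ ∈ Metric.sphere c r) (hz₂ : z₂ ∈ Metric.sphere c r)
    (hosc : 1 / 2 ≤ s z₂ - s z₁) :
    ENNReal.ofReal (1 / (8 * Real.pi) / r) ≤ ∫⁻ t in Ioo (-Real.pi) Real.pi,
      ENNReal.ofReal r * ‖fderiv ℝ s (circleMap c r t)‖ₑ ^ 2 := by
  have hmem : ∀ t, circleMap c r t ∈ N := fun t => hrN (circleMap_mem_sphere c hr.le t)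
  have hparam : ∀ z ∈ Metric.sphere c r, ∃ t ∈ Icc (-Real.pi) Real.pi, circleMap c r t = z := by
    intro z hz
    refine ⟨Complex.arg (z - c), ⟨(Complex.neg_pi_lt_arg _).le, Complex.arg_le_pi _⟩, ?_⟩
    have h1 : ‖z - c‖ = r := by rwa [← dist_eq_norm]
    rw [circleMap, ← h1, Complex.norm_mul_exp_arg_mul_I]
    ring
  obtain ⟨t₁, ht₁, rfl⟩ := hparam z₁ hz₁
  obtain ⟨t₂, ht₂, rfl⟩ := hparam z₂ hz₂
  have hfc : Continuous fun t => ‖fderiv ℝ s (circleMap c r t)‖ :=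
    ((hs.continuousOn_fderiv_of_isOpen hN le_rfl).comp_continuous
      (continuous_circleMap c r) hmem).norm
  set φ : ℝ → ℝ := fun t => ‖fderiv ℝ s (circleMap c r t)‖
  have hder : ∀ t, HasDerivAt (fun t => s (circleMap c r t))
      (fderiv ℝ s (circleMap c r t) (circleMap 0 r t * Complex.I)) t := fun t =>
    (((hs.differentiableOn (by simp)).differentiableAt
      (hN.mem_nhds (hmem t))).hasFDerivAt).comp_hasDerivAt t (hasDerivAt_circleMap c r t)
  have hdc : Continuous fun t => fderiv ℝ s (circleMap c r t) (circleMap 0 r t * Complex.I) :=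
    ((hs.continuousOn_fderiv_of_isOpen hN le_rfl).comp_continuous
      (continuous_circleMap c r) hmem).clm_apply ((continuous_circleMap 0 r).mul continuous_const)
  have hbd : ∀ t, ‖fderiv ℝ s (circleMap c r t) (circleMap 0 r t * Complex.I)‖ ≤ r * φ t := fun t => by
    have := (fderiv ℝ s (circleMap c r t)).le_opNorm (circleMap 0 r t * Complex.I)
    simpa [φ, circleMap, abs_of_pos hr, mul_comm] using this
  have hpi : -Real.pi ≤ Real.pi := by linarith [Real.pi_pos]
  have h1 : 1 / 2 ≤ ∫ t in -Real.pi..Real.pi, r * φ t := by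
    have hftc := intervalIntegral.integral_eq_sub_of_hasDerivAt (fun t _ => hder t)
      (hdc.intervalIntegrable t₁ t₂)
    have h2 := intervalIntegral.norm_integral_le_integral_norm_uIoc (μ := volume)
      (f := fun t => fderiv ℝ s (circleMap c r t) (circleMap 0 r t * Complex.I)) (a := t₁) (b := t₂)
    rw [hftc] at h2
    have hsub : uIoc t₁ t₂ ⊆ Ioc (-Real.pi) Real.pi := by
      rw [uIoc]
      exact Ioc_subset_Ioc (le_min ht₁.1 ht₂.1) (max_le ht₁.2 ht₂.2)
    have hint : IntegrableOn (fun t => r * φ t) (Ioc (-Real.pi) Real.pi) :=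
      ((continuous_const.mul hfc).integrableOn_Icc).mono_set Ioc_subset_Icc_self
    calc (1 : ℝ) / 2 ≤ s (circleMap c r t₂) - s (circleMap c r t₁) := hosc
      _ ≤ ‖s (circleMap c r t₂) - s (circleMap c r t₁)‖ := le_abs_self _
      _ ≤ _ := h2
      _ ≤ ∫ t in uIoc t₁ t₂, r * φ t := by
        refine setIntegral_mono (hdc.norm.integrableOn_uIcc.mono_set uIoc_subset_uIcc)
          (hint.mono_set hsub) hbd
      _ ≤ ∫ t in Ioc (-Real.pi) Real.pi, r * φ t :=
        setIntegral_mono_set hint (Eventually.of_forall fun t => by simp only [φ]; positivity)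
          hsub.eventuallyLE
      _ = _ := (intervalIntegral.integral_of_le hpi).symm
  have h2 : ∫ t in -Real.pi..Real.pi, r * φ t ≤
      ∫ t in -Real.pi..Real.pi, (1 / (8 * Real.pi) + 2 * Real.pi * r * (r * φ t ^ 2)) := by
    refine intervalIntegral.integral_mono_on hpi
      ((continuous_const.mul hfc).intervalIntegrable _ _)
      ((continuous_const.add (continuous_const.mul
        (continuous_const.mul (hfc.pow 2)))).intervalIntegrable _ _) fun t _ => ?_
    have hpos := Real.pi_pos
    -- Cauchy–Schwarz in the form of a completed square; after integration the constant 1/(8π) uses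
    -- up 1/4 of the 1/2.
    have : 0 ≤ (4 * Real.pi * (r * φ t) - 1) ^ 2 / (8 * Real.pi) := by positivity
    have e : (4 * Real.pi * (r * φ t) - 1) ^ 2 / (8 * Real.pi) =
        1 / (8 * Real.pi) + 2 * Real.pi * r * (r * φ t ^ 2) - r * φ t := by
      field_simp; ring
    linarith
  rw [intervalIntegral.integral_add (by simp) (Continuous.intervalIntegrable (by fun_prop) _ _),
    intervalIntegral.integral_const,
    intervalIntegral.integral_const_mul (2 * Real.pi * r)] at h2
  have h3 : 1 / (8 * Real.pi) / r ≤ ∫ t in -Real.pi..Real.pi, r * φ t ^ 2 := by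
    have hpos := Real.pi_pos
    have e : (Real.pi - -Real.pi) • (1 / (8 * Real.pi)) = 1 / 4 := by
      rw [smul_eq_mul]; field_simp; ring
    rw [e] at h2
    rw [div_div, div_le_iff₀ (by positivity)]
    nlinarith [h1.trans h2]
  have h4 : ∫⁻ t in Ioo (-Real.pi) Real.pi,
      ENNReal.ofReal r * ‖fderiv ℝ s (circleMap c r t)‖ₑ ^ 2 =
      ENNReal.ofReal (∫ t in -Real.pi..Real.pi, r * φ t ^ 2) := by
    rw [intervalIntegral.integral_of_le hpi, restrict_Ioo_eq_restrict_Ioc,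
      ofReal_integral_eq_lintegral_ofReal]
    · refine lintegral_congr fun t => ?_
      rw [ENNReal.ofReal_mul hr.le, ENNReal.ofReal_pow (norm_nonneg _), ofReal_norm]
    · exact ((continuous_const.mul (hfc.pow 2)).integrableOn_Icc).mono_set Ioc_subset_Icc_self
    · exact Eventually.of_forall fun t => by simp only [φ]; positivity
  rw [h4]
  exact ENNReal.ofReal_le_ofReal h3

/-- The length-area inequality on a round annulus. -/
theorem HasEnergyLE.ofReal_log_le {Ω : Set ℂ} {E : ℝ≥0∞} {h : ℂ → ℝ} (hE : HasEnergyLE Ω E h)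
    {c : ℂ} {r₁ r₂ : ℝ} (hr : 0 < r₁) (h12 : r₁ ≤ r₂)
    (hΩ : {z : ℂ | r₁ ≤ ‖z - c‖ ∧ ‖z - c‖ ≤ r₂} ⊆ Ω)
    (hosc : ∀ r, r₁ < r → r < r₂ → ∃ z₁ ∈ Metric.sphere c r, ∃ z₂ ∈ Metric.sphere c r,
      h z₁ = 0 ∧ h z₂ = 1) :
    ENNReal.ofReal (1 / (8 * Real.pi) * Real.log (r₂ / r₁)) ≤ E := by
  set C := {z : ℂ | r₁ ≤ ‖z - c‖ ∧ ‖z - c‖ ≤ r₂}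
  have hC : IsCompact C := by
    refine (isCompact_closedBall c r₂).of_isClosed_subset ?_ fun z hz => ?_
    · have hc : Continuous fun z : ℂ => ‖z - c‖ := (continuous_id.sub continuous_const).norm
      exact (isClosed_le continuous_const hc).inter (isClosed_le hc continuous_const)
    · rw [Metric.mem_closedBall, dist_eq_norm]; exact hz.2
  refine ENNReal.le_of_forall_pos_le_add fun ε hε _ => ?_
  -- Within 1/4 of a function with values 0 and 1 on each circle, the approximant still oscillates
  -- by at least 1/2.
  obtain ⟨N, hN, hCN, s, hs, hsh, hsE⟩ := hE C hC hΩ (min ε (1 / 4)) (by positivity)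
  calc ENNReal.ofReal (1 / (8 * Real.pi) * Real.log (r₂ / r₁))
      = ∫⁻ r in Ioo r₁ r₂, ENNReal.ofReal (1 / (8 * Real.pi) / r) :=
        (lintegral_Ioo_ofReal_const_div (by positivity) hr h12).symm
    _ ≤ ∫⁻ r in Ioo r₁ r₂, ∫⁻ t in Ioo (-Real.pi) Real.pi,
        ENNReal.ofReal r * ‖fderiv ℝ s (circleMap c r t)‖ₑ ^ 2 := by
        refine setLIntegral_mono_ae' measurableSet_Ioo (Eventually.of_forall fun r hrr => ?_)
        obtain ⟨z₁, hz₁, z₂, hz₂, h1, h2⟩ := hosc r hrr.1 hrr.2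
        have hsub : Metric.sphere c r ⊆ C := fun z hz => by
          rw [Metric.mem_sphere, dist_eq_norm] at hz
          exact ⟨hz ▸ hrr.1.le, hz ▸ hrr.2.le⟩
        refine ofReal_le_lintegral_circle hN hs (hr.trans hrr.1) (hsub.trans hCN) hz₁ hz₂ ?_
        have e1 := (hsh z₁ (hsub hz₁)).trans_le (min_le_right _ _)
        have e2 := (hsh z₂ (hsub hz₂)).trans_le (min_le_right _ _)
        rw [h1, abs_lt] at e1
        rw [h2, abs_lt] at e2
        linarith [e1.2, e2.1]
    _ = ∫⁻ z in {z | r₁ < ‖z - c‖ ∧ ‖z - c‖ < r₂}, ‖fderiv ℝ s z‖ₑ ^ 2 :=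
        (setLIntegral_annulus_eq_polar ((measurable_fderiv ℝ s).enorm.pow_const 2) c hr.le).symm
    _ ≤ ∫⁻ z in C, ‖fderiv ℝ s z‖ₑ ^ 2 := lintegral_mono_set fun z hz => ⟨hz.1.le, hz.2.le⟩
    _ ≤ _ := hsE
    _ ≤ E + ε := by
      gcongr
      rw [← ENNReal.ofReal_coe_nnreal]
      exact ENNReal.ofReal_le_ofReal (min_le_left _ _)

/-! ### Geometric disks and Möbius transformations -/

theorem sphericalDist_lt_iff {x y : OnePoint ℂ} {r : ℝ} (hr : 0 < r) (hrπ : r < Real.pi) :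
    sphericalDist x y < r ↔ chordalDist x y / 2 < Real.sin (r / 2) := by
  rw [← Real.arcsin_lt_iff_lt_sin' ⟨by linarith [Real.pi_pos], by linarith⟩, sphericalDist]
  constructor <;> intro h <;> linarith

theorem div_mul_sqrt_lt_iff {x s p q : ℝ} (hx : 0 ≤ x) (hs : 0 < s) (hp : 0 < p) (hq : 0 < q) :
    2 * x / (Real.sqrt p * Real.sqrt q) / 2 < s ↔ x ^ 2 < s ^ 2 * (p * q) := by
  rw [← Real.sqrt_mul hp.le, mul_div_assoc, mul_div_cancel_left₀ _ two_ne_zero,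
    div_lt_iff₀ (Real.sqrt_pos.2 (mul_pos hp hq)),
    ← pow_lt_pow_iff_left₀ hx (by positivity) two_ne_zero, mul_pow, Real.sq_sqrt (by positivity)]

theorem one_div_sqrt_lt_iff {s p : ℝ} (hs : 0 < s) (hp : 0 < p) :
    2 / Real.sqrt p / 2 < s ↔ 1 < s ^ 2 * p := by
  have := div_mul_sqrt_lt_iff zero_le_one hs hp one_pos
  simpa using this

/-- A geometric disk is the sublevel set of a quadratic form on the sphere. -/
theorem IsGeometricDisk.exists_quadratic {D : Set (OnePoint ℂ)} (hD : IsGeometricDisk D) :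
    ∃ (A C : ℝ) (b : ℂ), A * C < Complex.normSq b ∧
      (∀ z : ℂ, (z : OnePoint ℂ) ∈ D ↔
        A * Complex.normSq z + 2 * ((starRingEnd ℂ) b * z).re + C < 0) ∧
      ((∞ : OnePoint ℂ) ∈ D ↔ A < 0) := by
  obtain ⟨a, r, hr, hrπ, rfl⟩ := hD
  set s := Real.sin (r / 2)
  have hs0 : 0 < s := Real.sin_pos_of_pos_of_lt_pi (by linarith) (by linarith)
  have hs1 : s ^ 2 < 1 := by
    have hc : 0 < Real.cos (r / 2) := Real.cos_pos_of_mem_Ioo ⟨by linarith, by linarith⟩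
    nlinarith [Real.sin_sq_add_cos_sq (r / 2), pow_pos hc 2]
  induction a using OnePoint.rec with
  | infty =>
    refine ⟨-s ^ 2, 1 - s ^ 2, 0, ?_, fun z => ?_, ?_⟩
    · simp only [map_zero]
      nlinarith [pow_pos hs0 2]
    · rw [mem_ofPred_eq, sphericalDist_lt_iff hr hrπ]
      change 2 / Real.sqrt (1 + ‖z‖ ^ 2) / 2 < s ↔ _
      rw [one_div_sqrt_lt_iff hs0 (by positivity), Complex.normSq_eq_norm_sq]
      simp only [map_zero, zero_mul, Complex.zero_re, mul_zero]
      constructor <;> intro h <;> linarith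
    · rw [mem_ofPred_eq, sphericalDist_lt_iff hr hrπ]
      change (0 : ℝ) / 2 < s ↔ _
      constructor
      · intro _; nlinarith
      · intro _; simpa using hs0
  | coe a =>
    refine ⟨1 - s ^ 2 * (1 + Complex.normSq a), Complex.normSq a - s ^ 2 * (1 + Complex.normSq a),
      -a, ?_, fun z => ?_, ?_⟩
    · rw [Complex.normSq_neg]
      -- This product is the discriminant |b|² - AC.
      have h1 : 0 < s ^ 2 * (1 - s ^ 2) * (1 + Complex.normSq a) ^ 2 := by
        have := Complex.normSq_nonneg a
        have : 0 < 1 - s ^ 2 := by linarith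
        positivity
      nlinarith
    · rw [mem_ofPred_eq, sphericalDist_lt_iff hr hrπ]
      change 2 * ‖a - z‖ / (Real.sqrt (1 + ‖a‖ ^ 2) * Real.sqrt (1 + ‖z‖ ^ 2)) / 2 < s ↔ _
      rw [div_mul_sqrt_lt_iff (norm_nonneg _) hs0 (by positivity) (by positivity),
        ← Complex.normSq_eq_norm_sq, ← Complex.normSq_eq_norm_sq, ← Complex.normSq_eq_norm_sq]
      simp only [Complex.normSq_apply, Complex.sub_re, Complex.sub_im, Complex.mul_re,
        Complex.conj_re, Complex.conj_im, Complex.neg_re, Complex.neg_im]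
      constructor <;> intro h <;> nlinarith
    · rw [mem_ofPred_eq, sphericalDist_lt_iff hr hrπ]
      change 2 / Real.sqrt (1 + ‖a‖ ^ 2) / 2 < s ↔ _
      rw [one_div_sqrt_lt_iff hs0 (by positivity), Complex.normSq_eq_norm_sq]
      constructor <;> intro h <;> linarith

theorem tendsto_quadratic_cobounded {A : ℝ} (hA : 0 < A) (b : ℂ) (C : ℝ) :
    ∀ᶠ z in coclosedCompact ℂ, 0 < A * Complex.normSq z + 2 * ((starRingEnd ℂ) b * z).re + C := by
  rw [coclosedCompact_eq_cocompact, ← Metric.cobounded_eq_cocompact]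
  have ht : Tendsto (fun z : ℂ => ‖z‖) (Bornology.cobounded ℂ) atTop := tendsto_norm_cobounded_atTop
  filter_upwards [ht.eventually_ge_atTop ((2 * ‖b‖ + |C|) / A + 1)] with z hz
  have hre : -(‖b‖ * ‖z‖) ≤ ((starRingEnd ℂ) b * z).re := by
    have := (abs_le.1 (Complex.abs_re_le_norm ((starRingEnd ℂ) b * z))).1
    rwa [norm_mul, RCLike.norm_conj] at this
  have h1 : 1 ≤ ‖z‖ := le_trans (by
    have : 0 ≤ (2 * ‖b‖ + |C|) / A := by positivity
    linarith) hz
  have h2 : 2 * ‖b‖ + |C| < A * ‖z‖ := by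
    have h3 : (2 * ‖b‖ + |C|) / A < ‖z‖ := by linarith
    rw [div_lt_iff₀ hA] at h3
    linarith
  have h4 : (2 * ‖b‖ + |C|) * ‖z‖ < A * ‖z‖ * ‖z‖ := by gcongr
  have h5 : |C| ≤ |C| * ‖z‖ := le_mul_of_one_le_right (abs_nonneg _) h1
  rw [Complex.normSq_eq_norm_sq]
  nlinarith [neg_abs_le C]

/-- If A ≠ 0, the quadratic has the sign of A near ∞, which makes ∞ an interior point of D or of its
complement. -/
theorem quadratic_leading_eq_zero {D : Set (OnePoint ℂ)} {A C : ℝ} {b : ℂ}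
    (hD : ∀ z : ℂ, (z : OnePoint ℂ) ∈ D ↔
        A * Complex.normSq z + 2 * ((starRingEnd ℂ) b * z).re + C < 0)
    (hDi : (∞ : OnePoint ℂ) ∈ D ↔ A < 0) (hp : (∞ : OnePoint ℂ) ∈ frontier D) : A = 0 := by
  rw [frontier_eq_closure_inter_closure] at hp
  have hnhds : ∀ {S : Set (OnePoint ℂ)}, (∀ᶠ z : ℂ in coclosedCompact ℂ,
      (z : OnePoint ℂ) ∈ S) → (∞ : OnePoint ℂ) ∈ S → S ∈ 𝓝 (∞ : OnePoint ℂ) := fun h1 h2 => by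
    rw [OnePoint.nhds_infty_eq]
    exact ⟨h1, h2⟩
  rcases lt_trichotomy A 0 with hA | hA | hA
  · exfalso
    have h1 := tendsto_quadratic_cobounded (neg_pos.2 hA) (-b) (-C)
    have h2 : D ∈ 𝓝 (∞ : OnePoint ℂ) := hnhds (by
      filter_upwards [h1] with z hz
      rw [hD]
      simp only [map_neg, neg_mul, Complex.neg_re] at hz
      linarith) (hDi.2 hA)
    obtain ⟨x, hx, hx'⟩ := mem_closure_iff_nhds.1 hp.2 D h2
    exact hx' hx
  · exact hA
  · exfalso
    have h1 := tendsto_quadratic_cobounded hA b C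
    have h2 : Dᶜ ∈ 𝓝 (∞ : OnePoint ℂ) := hnhds (by
      filter_upwards [h1] with z hz
      rw [mem_compl_iff, hD]
      exact hz.not_gt) (fun h => hA.not_gt (hDi.1 h))
    obtain ⟨x, hx, hx'⟩ := mem_closure_iff_nhds.1 hp.1 _ h2
    exact hx hx'

theorem quadratic_eq_zero_of_mem_frontier {D : Set (OnePoint ℂ)} {A C : ℝ} {b p : ℂ}
    (hD : ∀ z : ℂ, (z : OnePoint ℂ) ∈ D ↔
        A * Complex.normSq z + 2 * ((starRingEnd ℂ) b * z).re + C < 0)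
    (hp : (p : OnePoint ℂ) ∈ frontier D) :
    A * Complex.normSq p + 2 * ((starRingEnd ℂ) b * p).re + C = 0 := by
  have h1 : p ∈ frontier ((fun z : ℂ => (z : OnePoint ℂ)) ⁻¹' D) := by
    rw [← OnePoint.isOpenMap_coe.preimage_frontier_eq_frontier_preimage OnePoint.continuous_coe]
    exact hp
  have h2 : (fun z : ℂ => (z : OnePoint ℂ)) ⁻¹' D =
      {z : ℂ | A * Complex.normSq z + 2 * ((starRingEnd ℂ) b * z).re + C < 0} := by
    ext z; exact hD z
  rw [h2] at h1
  have hc : Continuous fun z : ℂ =>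
      A * Complex.normSq z + 2 * ((starRingEnd ℂ) b * z).re + C :=
    ((continuous_const.mul Complex.continuous_normSq).add (continuous_const.mul
    (Complex.continuous_re.comp (continuous_const.mul continuous_id)))).add continuous_const
  exact frontier_lt_subset_eq hc continuous_const h1

/-- The bijection of the Riemann sphere given by `z ↦ 1 / (z - p)`. -/
def poleEquiv (p : ℂ) : OnePoint ℂ ≃ OnePoint ℂ where
  toFun x := x.elim ((0 : ℂ) : OnePoint ℂ) fun z => if z = p then (∞ : OnePoint ℂ) else ((z - p)⁻¹ : ℂ)
  invFun x := x.elim (p : OnePoint ℂ) fun z => if z = 0 then (∞ : OnePoint ℂ) else (p + z⁻¹ : ℂ)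
  left_inv x := by
    induction x using OnePoint.rec with
    | infty => simp
    | coe z =>
      by_cases h : z = p
      · simp [h]
      · simp [h, sub_eq_zero]
  right_inv x := by
    induction x using OnePoint.rec with
    | infty => simp
    | coe z =>
      by_cases h : z = 0
      · simp [h]
      · simp [h]

theorem poleEquiv_coe_of_ne {p z : ℂ} (h : z ≠ p) :
    poleEquiv p z = (((z - p)⁻¹ : ℂ) : OnePoint ℂ) := by
  simp [poleEquiv, h]

theorem poleEquiv_coe_self (p : ℂ) : poleEquiv p p = (∞ : OnePoint ℂ) := by simp [poleEquiv]

theorem continuous_poleEquiv (p : ℂ) : Continuous (poleEquiv p) := by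
  rw [OnePoint.continuous_iff]
  constructor
  · have h1 : Tendsto (fun z : ℂ => (((z - p)⁻¹ : ℂ) : OnePoint ℂ)) (coclosedCompact ℂ)
        (𝓝 ((0 : ℂ) : OnePoint ℂ)) := by
      refine (OnePoint.continuous_coe.tendsto 0).comp ?_
      rw [coclosedCompact_eq_cocompact, ← Metric.cobounded_eq_cocompact]
      exact tendsto_inv₀_cobounded.comp (tendsto_sub_const_cobounded p)
    refine h1.congr' ?_
    have : ∀ᶠ z in coclosedCompact ℂ, z ≠ p := by
      rw [coclosedCompact_eq_cocompact]
      exact (isCompact_singleton (x := p)).compl_mem_cocompact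
    filter_upwards [this] with z hz
    exact (poleEquiv_coe_of_ne hz).symm
  · refine continuous_iff_continuousAt.2 fun z => ?_
    by_cases hz : z = p
    · subst hz
      rw [continuousAt_iff_punctured_nhds, poleEquiv_coe_self]
      have h1 : Tendsto (fun y : ℂ => (((y - z)⁻¹ : ℂ) : OnePoint ℂ)) (𝓝[≠] z)
          (𝓝 (∞ : OnePoint ℂ)) := by
        refine OnePoint.tendsto_coe_infty.comp ?_
        rw [coclosedCompact_eq_cocompact, ← Metric.cobounded_eq_cocompact]
        refine tendsto_inv₀_nhdsNE_zero.comp ?_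
        refine tendsto_nhdsWithin_of_tendsto_nhds_of_eventually_within _ ?_ ?_
        · have : Tendsto (fun y => y - z) (𝓝 z) (𝓝 (z - z)) := tendsto_id.sub_const z
          rw [sub_self] at this
          exact this.mono_left nhdsWithin_le_nhds
        · filter_upwards [self_mem_nhdsWithin] with y hy
          exact sub_ne_zero.2 hy
      refine h1.congr' ?_
      filter_upwards [self_mem_nhdsWithin] with y hy
      exact (poleEquiv_coe_of_ne hy).symm
    · have h1 : ContinuousAt (fun y : ℂ => (((y - p)⁻¹ : ℂ) : OnePoint ℂ)) z :=
        OnePoint.continuous_coe.continuousAt.comp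
          ((continuousAt_id.sub continuousAt_const).inv₀ (sub_ne_zero.2 hz))
      refine h1.congr ?_
      filter_upwards [isOpen_ne.mem_nhds hz] with y hy
      exact (poleEquiv_coe_of_ne hy).symm

/-- The homeomorphism of the Riemann sphere given by `z ↦ 1 / (z - p)`. -/
def poleHomeomorph (p : ℂ) : OnePoint ℂ ≃ₜ OnePoint ℂ :=
  Continuous.homeoOfEquivCompactToT2 (f := poleEquiv p) (continuous_poleEquiv p)

theorem poleHomeomorph_apply (p : ℂ) (x : OnePoint ℂ) : poleHomeomorph p x = poleEquiv p x := rfl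

/-- A point of the sphere can be moved to infinity by a Möbius transformation, which maps disks
tangent to each other at this point to half-planes. -/
theorem exists_mobius (p : OnePoint ℂ) : ∃ m : OnePoint ℂ ≃ₜ OnePoint ℂ, m p = (∞ : OnePoint ℂ) ∧
    DifferentiableOn ℂ (planarRestriction m) (planarRestriction m).source ∧
    ∀ D, IsGeometricDisk D → p ∈ frontier D → ∃ β : ℂ, β ≠ 0 ∧ ∃ c : ℝ, ∀ ζ : ℂ, ζ ≠ 0 →
      (β * ζ).re < c → (ζ : OnePoint ℂ) ∈ m '' D := by
  induction p using OnePoint.rec with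
  | infty =>
    refine ⟨Homeomorph.refl _, rfl, ?_, fun D hD hp => ?_⟩
    · refine differentiableOn_id.congr fun z hz => ?_
      have := coe_planarRestriction (Homeomorph.refl _) z
        ((mem_planarRestriction_source _ z).1 hz)
      exact OnePoint.coe_injective this
    · obtain ⟨A, C, b, hdisc, hz, hi⟩ := hD.exists_quadratic
      have hA := quadratic_leading_eq_zero hz hi hp
      subst hA
      rw [zero_mul] at hdisc
      refine ⟨(starRingEnd ℂ) b, ?_, -C / 2, fun ζ _ hζ => ⟨ζ, ?_, rfl⟩⟩
      · rw [Ne, map_eq_zero]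
        exact Complex.normSq_pos.1 hdisc
      · rw [hz]
        linarith
  | coe p =>
    refine ⟨poleHomeomorph p, poleEquiv_coe_self p, ?_, fun D hD hp => ?_⟩
    · have hne : ∀ z ∈ (planarRestriction (poleHomeomorph p)).source, z ≠ p := fun z hz h => by
        rw [mem_planarRestriction_source, h, poleHomeomorph_apply, poleEquiv_coe_self] at hz
        exact hz rfl
      have hd : DifferentiableOn ℂ (fun z : ℂ => (z - p)⁻¹)
          (planarRestriction (poleHomeomorph p)).source :=
        (differentiableOn_id.sub_const p).inv fun z hz => sub_ne_zero.2 (hne z hz)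
      refine hd.congr fun z hz => ?_
      have := coe_planarRestriction (poleHomeomorph p) z
        ((mem_planarRestriction_source _ z).1 hz)
      rw [poleHomeomorph_apply, poleEquiv_coe_of_ne (hne z hz)] at this
      exact OnePoint.coe_injective this
    · obtain ⟨A, C, b, hdisc, hz, hi⟩ := hD.exists_quadratic
      have hQ := quadratic_eq_zero_of_mem_frontier hz hp
      refine ⟨A * p + b, ?_, -A / 2, fun ζ hζ0 hζ => ⟨((p + ζ⁻¹ : ℂ) : OnePoint ℂ), ?_, ?_⟩⟩
      · rw [← Complex.normSq_pos]
        -- Since the quadratic vanishes at p, the squared length of its gradient vector there is the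
        -- discriminant, which is positive.
        have : Complex.normSq (A * p + b) = Complex.normSq b - A * C := by
          simp only [Complex.normSq_apply, Complex.mul_re, Complex.conj_re, Complex.conj_im,
            Complex.add_re, Complex.add_im, Complex.mul_im, Complex.ofReal_re,
            Complex.ofReal_im] at hQ ⊢
          linear_combination A * hQ
        rw [this]; linarith
      · rw [hz]
        have hn : 0 < Complex.normSq ζ := Complex.normSq_pos.2 hζ0
        -- Substituting z = p + 1/ζ and using that the constant term at p vanishes leaves an affine
        -- function of ζ over |ζ|²: the disk becomes a half-plane. The point ζ = 0 corresponds to z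
        -- = ∞ and is left aside.
        have key : A * Complex.normSq (p + ζ⁻¹) + 2 * ((starRingEnd ℂ) b * (p + ζ⁻¹)).re + C =
            (A + 2 * ((A * p + b) * ζ).re) / Complex.normSq ζ := by
          have e1 : ζ⁻¹.re = ζ.re / Complex.normSq ζ := Complex.inv_re ζ
          have e2 : ζ⁻¹.im = -ζ.im / Complex.normSq ζ := Complex.inv_im ζ
          have e3 : Complex.normSq ζ⁻¹ = (Complex.normSq ζ)⁻¹ := Complex.normSq_inv ζ
          have e4 : Complex.normSq (p + ζ⁻¹) = Complex.normSq p +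
              2 * (p.re * ζ⁻¹.re + p.im * ζ⁻¹.im) + (Complex.normSq ζ)⁻¹ := by
            rw [← e3]; simp only [Complex.normSq_apply, Complex.add_re, Complex.add_im]; ring
          rw [e4]
          simp only [Complex.mul_re, Complex.conj_re, Complex.conj_im,
            Complex.add_re, Complex.add_im, Complex.mul_im, Complex.ofReal_re,
            Complex.ofReal_im, e1, e2] at hQ ⊢
          field_simp
          linear_combination Complex.normSq ζ * hQ
        rw [key]
        exact div_neg_of_neg_of_pos (by linarith) hn
      · rw [poleHomeomorph_apply, poleEquiv_coe_of_ne (by simpa using hζ0)]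
        simp

/-! ### The strip between two disjoint half-planes -/

/-- If the unit normals n, k are not opposite, then moving far in the direction -(n̄ + k̄) enters
both half-planes at once. -/
theorem exists_strip {β₁ β₂ : ℂ} (h₁ : β₁ ≠ 0) (h₂ : β₂ ≠ 0) {c₁ c₂ : ℝ}
    (hdisj : ∀ ζ : ℂ, ζ ≠ 0 → (β₁ * ζ).re < c₁ → (β₂ * ζ).re < c₂ → False) :
    ∃ n : ℂ, ‖n‖ = 1 ∧ ∃ h : ℝ, 0 < h ∧ ∀ ζ : ℂ, (ζ ≠ 0 → c₁ ≤ (β₁ * ζ).re) →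
      (ζ ≠ 0 → c₂ ≤ (β₂ * ζ).re) → |(n * ζ).re| ≤ h := by
  have hr₁ : 0 < ‖β₁‖ := norm_pos_iff.2 h₁
  have hr₂ : 0 < ‖β₂‖ := norm_pos_iff.2 h₂
  set n := β₁ / ‖β₁‖ with hn
  set k := β₂ / ‖β₂‖ with hk
  have hβ₁ : β₁ = ‖β₁‖ * n := by rw [hn, mul_div_cancel₀ _ (by exact_mod_cast hr₁.ne')]
  have hβ₂ : β₂ = ‖β₂‖ * k := by rw [hk, mul_div_cancel₀ _ (by exact_mod_cast hr₂.ne')]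
  have hn1 : ‖n‖ = 1 := by rw [hn, norm_div, Complex.norm_real, norm_norm, div_self hr₁.ne']
  have hk1 : ‖k‖ = 1 := by rw [hk, norm_div, Complex.norm_real, norm_norm, div_self hr₂.ne']
  have hnn : n.re * n.re + n.im * n.im = 1 := by
    rw [← Complex.normSq_apply, Complex.normSq_eq_norm_sq, hn1, one_pow]
  have hkk : k.re * k.re + k.im * k.im = 1 := by
    rw [← Complex.normSq_apply, Complex.normSq_eq_norm_sq, hk1, one_pow]
  have hre₁ : ∀ ζ, (β₁ * ζ).re = ‖β₁‖ * (n * ζ).re := fun ζ => by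
    conv_lhs => rw [hβ₁, mul_assoc, Complex.re_ofReal_mul]
  have hre₂ : ∀ ζ, (β₂ * ζ).re = ‖β₂‖ * (k * ζ).re := fun ζ => by
    conv_lhs => rw [hβ₂, mul_assoc, Complex.re_ofReal_mul]
  have hkn : k = -n := by
    -- This is |n + k|² / 2, so e ≤ 0 means k = -n.
    set e := 1 + (n.re * k.re + n.im * k.im) with he
    have he0 : e ≤ 0 := by
      by_contra hcon
      push Not at hcon
      set L := (|c₁| / ‖β₁‖ + |c₂| / ‖β₂‖ + 1) / e with hL
      have hL0 : 0 < L := by positivity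
      have hLe : L * e = |c₁| / ‖β₁‖ + |c₂| / ‖β₂‖ + 1 := div_mul_cancel₀ _ hcon.ne'
      set ζ : ℂ := -(L : ℂ) * ((starRingEnd ℂ) n + (starRingEnd ℂ) k)
      have e1 : (n * ζ).re = -(L * e) := by
        simp only [ζ, he, Complex.mul_re, Complex.mul_im, Complex.neg_re, Complex.neg_im,
          Complex.add_re, Complex.add_im, Complex.conj_re, Complex.conj_im, Complex.ofReal_re,
          Complex.ofReal_im]
        linear_combination -L * hnn
      have e2 : (k * ζ).re = -(L * e) := by
        simp only [ζ, he, Complex.mul_re, Complex.mul_im, Complex.neg_re, Complex.neg_im,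
          Complex.add_re, Complex.add_im, Complex.conj_re, Complex.conj_im, Complex.ofReal_re,
          Complex.ofReal_im]
        linear_combination -L * hkk
      have a1 : 0 ≤ |c₁| / ‖β₁‖ := by positivity
      have a2 : 0 ≤ |c₂| / ‖β₂‖ := by positivity
      refine hdisj ζ ?_ ?_ ?_
      · intro h0
        rw [h0, mul_zero, Complex.zero_re, hLe] at e1
        linarith
      · rw [hre₁, e1, hLe]
        have : ‖β₁‖ * (|c₁| / ‖β₁‖) = |c₁| := mul_div_cancel₀ _ hr₁.ne'
        nlinarith [neg_abs_le c₁, mul_nonneg hr₁.le a2]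
      · rw [hre₂, e2, hLe]
        have : ‖β₂‖ * (|c₂| / ‖β₂‖) = |c₂| := mul_div_cancel₀ _ hr₂.ne'
        nlinarith [neg_abs_le c₂, mul_nonneg hr₂.le a1]
    have hsum : (n.re + k.re) ^ 2 + (n.im + k.im) ^ 2 ≤ 0 := by nlinarith
    have hx : n.re + k.re = 0 := by nlinarith [sq_nonneg (n.re + k.re), sq_nonneg (n.im + k.im)]
    have hy : n.im + k.im = 0 := by nlinarith [sq_nonneg (n.re + k.re), sq_nonneg (n.im + k.im)]
    apply Complex.ext
    · rw [Complex.neg_re]; linarith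
    · rw [Complex.neg_im]; linarith
  refine ⟨n, hn1, |c₁| / ‖β₁‖ + |c₂| / ‖β₂‖ + 1, by positivity, fun ζ hζ₁ hζ₂ => ?_⟩
  have a1 : 0 ≤ |c₁| / ‖β₁‖ := by positivity
  have a2 : 0 ≤ |c₂| / ‖β₂‖ := by positivity
  by_cases h0 : ζ = 0
  · subst h0; simp; linarith
  have b1 := hζ₁ h0
  have b2 := hζ₂ h0
  rw [hre₁] at b1
  rw [hre₂, hkn, neg_mul, Complex.neg_re] at b2
  have d1 : -(|c₁| / ‖β₁‖) ≤ (n * ζ).re := by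
    rw [← neg_div, div_le_iff₀ hr₁]
    linarith [neg_abs_le c₁]
  have d2 : (n * ζ).re ≤ |c₂| / ‖β₂‖ := by
    rw [le_div_iff₀ hr₂]
    linarith [neg_abs_le c₂]
  rw [abs_le]
  constructor <;> linarith

/-! ### Connected sets on the sphere and points on the unit circle -/

/-- P may contain ∞; this point counts as exterior, so the open ball and the complement of the
closed ball in the sphere would separate P. -/
theorem exists_mem_sphere_of_isPreconnected {P : Set (OnePoint ℂ)} (hP : IsPreconnected P) {c : ℂ}
    {r : ℝ} {x y : ℂ} (hx : (x : OnePoint ℂ) ∈ P) (hxr : ‖x - c‖ < r) (hy : (y : OnePoint ℂ) ∈ P)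
    (hyr : r < ‖y - c‖) : ∃ z ∈ Metric.sphere c r, (z : OnePoint ℂ) ∈ P := by
  by_contra! hcon
  have hu : IsOpen ((fun z : ℂ => (z : OnePoint ℂ)) '' Metric.ball c r) :=
    OnePoint.isOpenEmbedding_coe.isOpenMap _ Metric.isOpen_ball
  have hv : IsOpen ((fun z : ℂ => (z : OnePoint ℂ)) '' Metric.closedBall c r)ᶜ :=
    OnePoint.isOpen_compl_image_coe.2 ⟨Metric.isClosed_closedBall, isCompact_closedBall c r⟩
  obtain ⟨_, -, ⟨z, hz, rfl⟩, hz'⟩ := hP _ _ hu hv (fun w hw => by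
      by_cases h : w ∈ (fun z : ℂ => (z : OnePoint ℂ)) '' Metric.closedBall c r
      · obtain ⟨z, hz, rfl⟩ := h
        refine Or.inl ⟨z, lt_of_le_of_ne hz fun h => hcon z h hw, rfl⟩
      · exact Or.inr h)
    ⟨x, hx, x, by rwa [mem_ball_iff_norm], rfl⟩
    ⟨y, hy, by
      rintro ⟨z, hz, hzy⟩
      rw [OnePoint.coe_injective hzy, mem_closedBall_iff_norm] at hz
      exact hz.not_gt hyr⟩
  exact hz' ⟨z, Metric.ball_subset_closedBall hz, rfl⟩

/-- The complement of a round disk in the sphere is connected. -/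
theorem exists_isPreconnected_exterior (a : ℂ) {R : ℝ} (hR : 0 < R) :
    ∃ P : Set (OnePoint ℂ), IsPreconnected P ∧ (∞ : OnePoint ℂ) ∈ P ∧
      ∀ w : ℂ, (w : OnePoint ℂ) ∈ P ↔ R ≤ ‖w - a‖ := by
  refine ⟨poleHomeomorph a ⁻¹' ((fun z : ℂ => (z : OnePoint ℂ)) '' Metric.closedBall 0 R⁻¹),
    ?_, ?_, fun w => ?_⟩
  · rw [Homeomorph.isPreconnected_preimage]
    exact (convex_closedBall (0 : ℂ) R⁻¹).isPreconnected.image _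
      OnePoint.continuous_coe.continuousOn
  · exact ⟨0, Metric.mem_closedBall_self (by positivity), rfl⟩
  · rw [mem_preimage, poleHomeomorph_apply]
    by_cases hw : w = a
    · subst hw
      rw [poleEquiv_coe_self, sub_self, norm_zero]
      constructor
      · rintro ⟨z, -, hz⟩
        exact absurd hz (OnePoint.coe_ne_infty z)
      · intro h; exact absurd h hR.not_ge
    · rw [poleEquiv_coe_of_ne hw, OnePoint.coe_injective.mem_set_image,
        mem_closedBall_zero_iff, norm_inv, inv_le_inv₀ (norm_pos_iff.2 (sub_ne_zero.2 hw)) hR]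

theorem norm_mul_exp_sub_mul_exp {q : ℂ} (hq : ‖q‖ = 1) (s t : ℝ) :
    ‖q * Complex.exp (s * Complex.I) - q * Complex.exp (t * Complex.I)‖ =
      2 * |Real.sin ((s - t) / 2)| := by
  have h : q * Complex.exp (s * Complex.I) - q * Complex.exp (t * Complex.I) =
      q * Complex.exp (t * Complex.I) * (Complex.exp (Complex.I * (s - t : ℝ)) - 1) := by
    rw [mul_sub, mul_assoc q (Complex.exp _) (Complex.exp _), ← Complex.exp_add, mul_one]
    congr 3
    push_cast; ring
  rw [h, norm_mul, norm_mul, hq, Complex.norm_exp_ofReal_mul_I, one_mul, one_mul,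
    Complex.norm_exp_I_mul_ofReal_sub_one, norm_mul, Real.norm_eq_abs, Real.norm_eq_abs, abs_two]

/-- Since (α + β)/2 ≥ α, compare with sin α = 2 sin(α/2) cos(α/2), where cos(α/2) ≥ 3/4. -/
theorem sin_half_add_ge {α β : ℝ} (hα : 0 < α) (hαβ : α ≤ β) (hβ : β ≤ 1) :
    3 / 2 * Real.sin (α / 2) ≤ Real.sin ((α + β) / 2) := by
  have h1 : Real.sin α ≤ Real.sin ((α + β) / 2) :=
    Real.sin_le_sin_of_le_of_le_pi_div_two (by linarith [Real.pi_gt_three])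
      (by linarith [Real.pi_gt_three]) (by linarith)
  have h2 : Real.sin α = 2 * Real.sin (α / 2) * Real.cos (α / 2) := by
    rw [← Real.sin_two_mul]; congr 1; ring
  have h3 : 0 < Real.sin (α / 2) :=
    Real.sin_pos_of_pos_of_lt_pi (by linarith) (by linarith [Real.pi_gt_three])
  have h4 : 1 - (α / 2) ^ 2 / 2 ≤ Real.cos (α / 2) := Real.one_sub_sq_div_two_le_cos
  have h5 : 3 / 4 ≤ Real.cos (α / 2) := by nlinarith
  nlinarith

/-- Of two points close to `q` on the two sides of `q` on a circle, one is much closer to `q`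
than to the other. -/
theorem exists_close_of_two_sides {q : ℂ} (hq : ‖q‖ = 1) {α β : ℝ} (hα : 0 < α) (hα1 : α ≤ 1)
    (hβ : 0 < β) (hβ1 : β ≤ 1) {x y : ℂ} (hx : x = q * Complex.exp (α * Complex.I))
    (hy : y = q * Complex.exp (-β * Complex.I)) :
    0 < ‖x - q‖ ∧ ‖x - q‖ ≤ α ∧ 0 < ‖y - q‖ ∧ ‖y - q‖ ≤ β ∧
      (3 / 2 * ‖x - q‖ ≤ ‖x - y‖ ∨ 3 / 2 * ‖y - q‖ ≤ ‖y - x‖) := by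
  have hq0 : q = q * Complex.exp ((0 : ℝ) * Complex.I) := by simp
  have sin_pos : ∀ {t : ℝ}, 0 < t → t ≤ 1 → 0 < Real.sin (t / 2) := fun h0 h1 =>
    Real.sin_pos_of_pos_of_lt_pi (by linarith) (by linarith [Real.pi_gt_three])
  have e1 : ‖x - q‖ = 2 * Real.sin (α / 2) := by
    rw [hx]
    nth_rw 2 [hq0]
    rw [norm_mul_exp_sub_mul_exp hq, sub_zero, abs_of_pos (sin_pos hα hα1)]
  have hy' : y = q * Complex.exp ((-β : ℝ) * Complex.I) := by rw [hy]; push_cast; rfl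
  have e2 : ‖y - q‖ = 2 * Real.sin (β / 2) := by
    rw [hy']
    nth_rw 2 [hq0]
    rw [norm_mul_exp_sub_mul_exp hq, sub_zero, neg_div, Real.sin_neg, abs_neg,
      abs_of_pos (sin_pos hβ hβ1)]
  have e3 : ‖x - y‖ = 2 * Real.sin ((α + β) / 2) := by
    rw [hx, hy', norm_mul_exp_sub_mul_exp hq, sub_neg_eq_add, abs_of_pos]
    exact Real.sin_pos_of_pos_of_lt_pi (by linarith) (by linarith [Real.pi_gt_three])
  have e4 : ‖y - x‖ = 2 * Real.sin ((β + α) / 2) := by rw [norm_sub_rev, e3, add_comm]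
  rw [e1, e2, e3, e4]
  refine ⟨by linarith [sin_pos hα hα1], by linarith [Real.sin_le (show 0 ≤ α / 2 by linarith)],
    by linarith [sin_pos hβ hβ1], by linarith [Real.sin_le (show 0 ≤ β / 2 by linarith)], ?_⟩
  rcases le_total α β with h | h
  · left; linarith [sin_half_add_ge hα h hβ1]
  · right; linarith [sin_half_add_ge hβ h hα1]

/-- A connected punctured neighbourhood of a boundary point in the closed unit disk. -/
theorem isPreconnected_closedBall_inter_ball_diff {q : ℂ} (hq : ‖q‖ = 1) (δ : ℝ) :
    IsPreconnected ((Metric.closedBall (0 : ℂ) 1 ∩ Metric.ball q δ) \ {q}) := by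
  have hc : Convex ℝ {z : ℂ | ((starRingEnd ℂ) q * z).re < 1} := by
    have hl : IsLinearMap ℝ fun z : ℂ => ((starRingEnd ℂ) q * z).re :=
      ⟨fun x y => by rw [mul_add, Complex.add_re], fun c x => by
        rw [mul_smul_comm, Complex.smul_re]⟩
    exact convex_halfSpace_lt hl 1
  have hqq : q.re * q.re + q.im * q.im = 1 := by
    rw [← Complex.normSq_apply, Complex.normSq_eq_norm_sq, hq, one_pow]
  -- The tangent line at q meets the closed disk only in q, so removing q amounts to intersecting
  -- with an open half-plane and convexity survives.
  have : (Metric.closedBall (0 : ℂ) 1 ∩ Metric.ball q δ) \ {q} =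
      (Metric.closedBall (0 : ℂ) 1 ∩ Metric.ball q δ) ∩
        {z : ℂ | ((starRingEnd ℂ) q * z).re < 1} := by
    ext z
    simp only [Set.mem_sdiff, mem_inter_iff, mem_singleton_iff, mem_ofPred_eq, and_congr_right_iff]
    rintro ⟨hz, -⟩
    rw [mem_closedBall_zero_iff] at hz
    have hzz : z.re * z.re + z.im * z.im ≤ 1 := by
      rw [← Complex.normSq_apply, Complex.normSq_eq_norm_sq]
      exact pow_le_one₀ (norm_nonneg _) hz
    simp only [Complex.mul_re, Complex.conj_re, Complex.conj_im]
    constructor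
    · intro hne
      by_contra! hcon
      apply hne
      have hs : (z.re - q.re) ^ 2 + (z.im - q.im) ^ 2 ≤ 0 := by nlinarith
      apply Complex.ext
      · nlinarith [sq_nonneg (z.re - q.re), sq_nonneg (z.im - q.im)]
      · nlinarith [sq_nonneg (z.re - q.re), sq_nonneg (z.im - q.im)]
    · rintro h rfl
      linarith
  rw [this]
  exact (((convex_closedBall _ _).inter (convex_ball _ _)).inter hc).isPreconnected

/-! ### Mapping the disk into a strip -/

/-- A map of the closed disk into a strip which sends a boundary point to infinity takes nearby
values at some points on the two sides of this boundary point. -/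
theorem exists_two_sides_close {G : ℂ → ℂ} {q n : ℂ} (hq : ‖q‖ = 1) (hn : ‖n‖ = 1) {h : ℝ}
    (hG : ContinuousOn G (Metric.closedBall 0 1 \ {q}))
    (hlim : Tendsto (fun z => ‖G z‖) (𝓝[Metric.closedBall 0 1 \ {q}] q) atTop)
    (hstrip : ∀ z ∈ Metric.closedBall (0 : ℂ) 1 \ {q}, |(n * G z).re| ≤ h) (X₀ : ℝ) {δ₀ : ℝ}
    (hδ₀ : 0 < δ₀) :
    ∃ α ∈ Ioo 0 δ₀, ∃ β ∈ Ioo 0 δ₀, X₀ ≤ ‖G (q * Complex.exp (α * Complex.I))‖ ∧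
      ‖G (q * Complex.exp (-β * Complex.I)) - G (q * Complex.exp (α * Complex.I))‖ ≤ 2 * h := by
  have hnorm : ∀ z ∈ Metric.closedBall (0 : ℂ) 1 \ {q}, ‖G z‖ ≤ h + |(n * G z).im| := fun z hz => by
    calc ‖G z‖ = ‖n * G z‖ := by rw [norm_mul, hn, one_mul]
      _ ≤ |(n * G z).re| + |(n * G z).im| := Complex.norm_le_abs_re_add_abs_im _
      _ ≤ h + |(n * G z).im| := by gcongr; exact hstrip z hz
  -- Inside the strip the real part of nG is bounded, so only the imaginary part can escape to
  -- infinity.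
  have hlim' : Tendsto (fun z => |(n * G z).im|) (𝓝[Metric.closedBall 0 1 \ {q}] q) atTop := by
    refine tendsto_atTop_mono' _ ?_ (tendsto_atTop_add_const_right _ (-h) hlim)
    filter_upwards [self_mem_nhdsWithin] with z hz
    linarith [hnorm z hz]
  have hX : ContinuousOn (fun z => (n * G z).im) (Metric.closedBall 0 1 \ {q}) :=
    Complex.continuous_im.comp_continuousOn (continuousOn_const.mul hG)
  obtain ⟨δ, hδ, hδX⟩ := Metric.mem_nhdsWithin_iff.1 (hlim'.eventually_gt_atTop (max X₀ 0))
  set S := (Metric.closedBall (0 : ℂ) 1 ∩ Metric.ball q δ) \ {q} with hS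
  have hSX : ∀ z ∈ S, max X₀ 0 < |(n * G z).im| := fun z hz => hδX ⟨hz.1.2, hz.1.1, hz.2⟩
  have hSsub : S ⊆ Metric.closedBall (0 : ℂ) 1 \ {q} := fun z hz => ⟨hz.1.1, hz.2⟩
  -- Connectedness of the punctured neighbourhood confines its image to one end of the strip.
  have hsign : (∀ z ∈ S, 0 < (n * G z).im) ∨ ∀ z ∈ S, (n * G z).im < 0 := by
    by_contra! hcon
    obtain ⟨⟨z, hz, hz0⟩, w, hw, hw0⟩ := hcon
    obtain ⟨y, hy, hy0⟩ := (isPreconnected_closedBall_inter_ball_diff hq δ).intermediate_value hz hw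
      (hX.mono hSsub) ⟨hz0, hw0⟩
    have := hSX y hy
    dsimp only at hy0
    rw [hy0, abs_zero] at this
    exact (le_max_right X₀ 0).not_gt this
  have hdiff : ∀ z ∈ S, ∀ w ∈ S, |(n * G z).im| = |(n * G w).im| → (n * G z).im = (n * G w).im := by
    intro z hz w hw hzw
    rcases hsign with hs | hs
    · rwa [abs_of_pos (hs z hz), abs_of_pos (hs w hw)] at hzw
    · rw [abs_of_neg (hs z hz), abs_of_neg (hs w hw)] at hzw
      linarith
  set κ := min (min δ δ₀) 1 / 2 with hκ
  have hκ0 : 0 < κ := by positivity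
  have hκδ : κ < δ := by
    have : min (min δ δ₀) 1 ≤ δ := (min_le_left _ _).trans (min_le_left _ _)
    linarith
  have hκδ₀ : κ < δ₀ := by
    have : min (min δ δ₀) 1 ≤ δ₀ := (min_le_left _ _).trans (min_le_right _ _)
    linarith
  have hκ1 : κ < 1 := by
    have : min (min δ δ₀) 1 ≤ 1 := min_le_right _ _
    linarith
  set c : ℝ → ℂ := fun t => q * Complex.exp (t * Complex.I) with hc
  have hcc : Continuous c := by fun_prop
  have hc0 : c 0 = q := by simp [hc]
  have hcS : ∀ t : ℝ, t ≠ 0 → |t| ≤ κ → c t ∈ S := by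
    intro t ht htκ
    have e : ‖c t - q‖ = 2 * |Real.sin (t / 2)| := by
      rw [← hc0, hc]
      dsimp only
      rw [norm_mul_exp_sub_mul_exp hq, sub_zero]
    refine ⟨⟨?_, ?_⟩, ?_⟩
    · rw [mem_closedBall_zero_iff, hc, norm_mul, hq, Complex.norm_exp_ofReal_mul_I, one_mul]
    · rw [mem_ball_iff_norm, e]
      have := Real.abs_sin_le_abs (x := t / 2)
      rw [abs_div, abs_two] at this
      linarith
    · rw [mem_singleton_iff, ← sub_eq_zero, ← norm_eq_zero, e, mul_eq_zero, abs_eq_zero, not_or]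
      refine ⟨two_ne_zero, fun h0 => ht ?_⟩
      have hb := abs_le.1 htκ
      have := (Real.sin_eq_zero_iff_of_lt_of_lt (by linarith [Real.pi_gt_three])
        (by linarith [Real.pi_gt_three])).1 h0
      linarith
  -- On either side of q (s = ±1) the height |Im nG| tends to infinity, so it takes every value from
  -- its value at angle κ on.
  have hivt : ∀ s : ℝ, |s| = 1 → ∀ Y, |(n * G (c (s * κ))).im| ≤ Y →
      ∃ t ∈ Ioc 0 κ, |(n * G (c (s * t))).im| = Y := by
    intro s hs Y hY
    have hs0 : s ≠ 0 := fun h0 => by simp [h0] at hs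
    have hmem : ∀ t ∈ Ioc 0 κ, c (s * t) ∈ S := fun t ht =>
      hcS _ (mul_ne_zero hs0 ht.1.ne') (by rw [abs_mul, hs, one_mul, abs_of_pos ht.1]; exact ht.2)
    have hcs : ContinuousOn (fun t => |(n * G (c (s * t))).im|) (Ioc 0 κ) :=
      (hX.comp (by fun_prop : Continuous fun t => c (s * t)).continuousOn
        fun t ht => hSsub (hmem t ht)).abs
    have hl : Tendsto (fun t => c (s * t)) (𝓝[Ioc 0 κ] 0) (𝓝[Metric.closedBall 0 1 \ {q}] q) := by
      refine tendsto_nhdsWithin_of_tendsto_nhds_of_eventually_within _ ?_ ?_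
      · have : Tendsto (fun t => c (s * t)) (𝓝 0) (𝓝 (c (s * 0))) :=
          (by fun_prop : Continuous fun t => c (s * t)).tendsto 0
        rw [mul_zero, hc0] at this
        exact this.mono_left nhdsWithin_le_nhds
      · filter_upwards [self_mem_nhdsWithin] with t ht using hSsub (hmem t ht)
    have : (𝓝[Ioc 0 κ] (0 : ℝ)).NeBot := by
      rw [nhdsWithin_Ioc_eq_nhdsGT hκ0]; infer_instance
    obtain ⟨t, htY, ht⟩ := (((hlim'.comp hl).eventually_ge_atTop Y).and self_mem_nhdsWithin).exists
    obtain ⟨y, hy, hyY⟩ := isPreconnected_Ioc.intermediate_value (right_mem_Ioc.2 hκ0) ht hcs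
      ⟨hY, htY⟩
    exact ⟨y, hy, hyY⟩
  -- The larger of the two heights at angle κ is a height attained on both sides.
  obtain ⟨α, hα, hαY⟩ := hivt 1 abs_one _ (le_max_left _ |(n * G (c (-1 * κ))).im|)
  obtain ⟨β, hβ, hβY⟩ := hivt (-1) (by simp) _ (le_max_right |(n * G (c (1 * κ))).im| _)
  rw [one_mul] at hαY
  have hαS : c α ∈ S := hcS α hα.1.ne' (by rw [abs_of_pos hα.1]; exact hα.2)
  have hβS : c (-1 * β) ∈ S := hcS _ (by simpa using hβ.1.ne')
    (by rw [abs_mul, abs_neg, abs_one, one_mul, abs_of_pos hβ.1]; exact hβ.2)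
  have hcβ : q * Complex.exp (-β * Complex.I) = c (-1 * β) := by
    simp only [hc]; push_cast; rw [neg_one_mul]
  refine ⟨α, ⟨hα.1, hα.2.trans_lt hκδ₀⟩, β, ⟨hβ.1, hβ.2.trans_lt hκδ₀⟩, ?_, ?_⟩
  · have h1 := hSX _ hαS
    have h2 : |(n * G (c α)).im| ≤ ‖G (c α)‖ := by
      calc _ ≤ ‖n * G (c α)‖ := Complex.abs_im_le_norm _
        _ = _ := by rw [norm_mul, hn, one_mul]
    exact ((le_max_left _ _).trans h1.le).trans h2
  · rw [hcβ]
    change ‖G (c (-1 * β)) - G (c α)‖ ≤ 2 * h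
    have him := hdiff _ hβS _ hαS (hβY.trans hαY.symm)
    have hb := hstrip _ (hSsub hβS)
    have ha := hstrip _ (hSsub hαS)
    calc ‖G (c (-1 * β)) - G (c α)‖ = ‖n * G (c (-1 * β)) - n * G (c α)‖ := by
          rw [← mul_sub, norm_mul, hn, one_mul]
      _ ≤ |(n * G (c (-1 * β)) - n * G (c α)).re| + |(n * G (c (-1 * β)) - n * G (c α)).im| :=
          Complex.norm_le_abs_re_add_abs_im _
      _ = |(n * G (c (-1 * β))).re - (n * G (c α)).re| := by
          rw [Complex.sub_im, him, sub_self, abs_zero, add_zero, Complex.sub_re]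
      _ ≤ |(n * G (c (-1 * β))).re| + |(n * G (c α)).re| := abs_sub _ _
      _ ≤ 2 * h := by linarith

/-- A homeomorphism of the sphere with the energy distortion of a quasiconformal map cannot map the
closed unit disk into a strip. -/
theorem false_of_strip_of_hasEnergyLE {g : OnePoint ℂ ≃ₜ OnePoint ℂ} {q n : ℂ} (hq : ‖q‖ = 1)
    (hgq : g q = (∞ : OnePoint ℂ)) (hn : ‖n‖ = 1) {h : ℝ} (hh : 0 < h)
    (hstrip : ∀ z ∈ Metric.closedBall (0 : ℂ) 1, z ≠ q → ∃ ζ : ℂ, g z = ζ ∧ |(n * ζ).re| ≤ h)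
    {Ω : Set ℂ} (hΩ : Ω ∈ 𝓝[≠] q) {F : ℂ → ℂ} (hF : ∀ z ∈ Ω, g z = F z) {K : ℝ} (hK : 0 ≤ K)
    (hE : ∀ (u : ℂ → ℝ) (E : ℝ≥0∞), ContDiff ℝ 1 u → E ≠ ⊤ →
      ∫⁻ w, ‖fderiv ℝ u w‖ₑ ^ 2 ≤ E → HasEnergyLE Ω (ENNReal.ofReal K * E) (u ∘ F)) : False := by
  obtain ⟨C₀, hC₀, hcut⟩ := exists_log_cutoff
  have hlog : 0 < Real.log (11 / 10) := Real.log_pos (by norm_num)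
  -- Λ will be log(R / 2h). It is chosen so that the upper bound K C₀ / Λ for the energy falls below
  -- the lower bound log(11/10) / (8π).
  set Λ := 8 * Real.pi * (K * C₀) / Real.log (11 / 10) + 1 with hΛ
  have hΛ0 : 0 < Λ := by positivity
  set R := 2 * h * Real.exp Λ with hR
  have hhR : 2 * h < R := by
    rw [hR]
    exact lt_mul_of_one_lt_right (by positivity) (Real.one_lt_exp_iff.2 hΛ0)
  have hRlog : Real.log (R / (2 * h)) = Λ := by
    rw [hR, mul_div_cancel_left₀ _ (by positivity), Real.log_exp]
  choose! G hG using hstrip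
  have hq2 : ‖-q - q‖ = 2 := by
    rw [← neg_add', norm_neg, ← two_mul, norm_mul, hq, mul_one, Complex.norm_ofNat]
  have hqne : -q ≠ q := fun h0 => by simp [h0] at hq2
  have hGc : ContinuousOn G (Metric.closedBall 0 1 \ {q}) := by
    rw [OnePoint.isOpenEmbedding_coe.isInducing.continuousOn_iff]
    exact (g.continuous.comp OnePoint.continuous_coe).continuousOn.congr fun z hz =>
      ((hG z hz.1 hz.2).1).symm
  have hlim : Tendsto (fun z => ‖G z‖) (𝓝[Metric.closedBall 0 1 \ {q}] q) atTop := by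
    refine tendsto_atTop.2 fun b => ?_
    have h1 : ((fun z : ℂ => (z : OnePoint ℂ)) '' Metric.closedBall 0 b)ᶜ ∈ 𝓝 (g q) := by
      refine (OnePoint.isOpen_compl_image_coe.2
        ⟨Metric.isClosed_closedBall, isCompact_closedBall 0 b⟩).mem_nhds ?_
      rw [hgq]
      rintro ⟨z, -, hz⟩
      exact OnePoint.coe_ne_infty z hz
    have h2 := (g.continuous.comp OnePoint.continuous_coe).continuousAt.preimage_mem_nhds h1
    filter_upwards [self_mem_nhdsWithin, mem_nhdsWithin_of_mem_nhds h2] with z hz hz'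
    by_contra! hcon
    exact hz' ⟨G z, mem_closedBall_zero_iff.2 hcon.le, (hG z hz.1 hz.2).1.symm⟩
  obtain ⟨ε, hε, hεΩ⟩ := Metric.mem_nhdsWithin_iff.1 hΩ
  obtain ⟨α, hα, β, hβ, hfar, hclose⟩ := exists_two_sides_close hq hn hGc hlim
    -- The height R + ‖G(-q)‖ places g(-q) outside the disk of radius R about G(x).
    (fun z hz => (hG z hz.1 hz.2).2) (R + ‖G (-q)‖) (show 0 < min ε 1 / 4 by positivity)
  have hε1 : min ε 1 ≤ ε := min_le_left _ _
  have h11 : min ε 1 ≤ 1 := min_le_right _ _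
  set x := q * Complex.exp (α * Complex.I) with hx
  set y := q * Complex.exp (-β * Complex.I) with hy
  obtain ⟨hx0, hxα, hy0, hyβ, hxy⟩ := exists_close_of_two_sides hq hα.1 (by linarith [hα.2]) hβ.1
    (by linarith [hβ.2]) hx hy
  have hxB : x ∈ Metric.closedBall (0 : ℂ) 1 := by
    rw [mem_closedBall_zero_iff, hx, norm_mul, hq, Complex.norm_exp_ofReal_mul_I, one_mul]
  have hyB : y ∈ Metric.closedBall (0 : ℂ) 1 := by
    rw [mem_closedBall_zero_iff, hy, norm_mul, hq, ← Complex.ofReal_neg,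
      Complex.norm_exp_ofReal_mul_I, one_mul]
  have hxG := (hG x hxB (sub_ne_zero.1 (norm_pos_iff.1 hx0))).1
  have hyG := (hG y hyB (sub_ne_zero.1 (norm_pos_iff.1 hy0))).1
  have hqG := (hG (-q) (by rw [mem_closedBall_zero_iff, norm_neg, hq]) hqne).1
  obtain ⟨u, hu, hu0, hu1, huE⟩ := hcut (G x) (2 * h) R (by positivity) hhR
  rw [hRlog] at huE
  have henergy := hE u _ hu ENNReal.ofReal_ne_top huE
  obtain ⟨P, hP, hP_infty, hPw⟩ := exists_isPreconnected_exterior (G x) (show 0 < R by linarith)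
  have hB : IsPreconnected ((fun z : ℂ => (z : OnePoint ℂ)) '' Metric.closedBall (G x) (2 * h)) :=
    (convex_closedBall _ _).isPreconnected.image _ OnePoint.continuous_coe.continuousOn
  -- Circles about e with radii between 5/4 d and 11/8 d contain q (at distance d) and leave out e'
  -- (at distance at least 3/2 d) and -q. They stay within 19/8 d < ε of q and avoid q, hence lie in
  -- Ω.
  have hmain : ∀ e e' : ℂ,
      g e ∈ (fun z : ℂ => (z : OnePoint ℂ)) '' Metric.closedBall (G x) (2 * h) →
      g e' ∈ (fun z : ℂ => (z : OnePoint ℂ)) '' Metric.closedBall (G x) (2 * h) →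
      0 < ‖e - q‖ → ‖e - q‖ < min ε 1 / 4 → 3 / 2 * ‖e - q‖ ≤ ‖e - e'‖ → False := by
    intro e e' he he' hd0 hd1 hee
    set d := ‖e - q‖ with hd
    have hann : {z | 5 / 4 * d ≤ ‖z - e‖ ∧ ‖z - e‖ ≤ 11 / 8 * d} ⊆ Ω := by
      rintro z ⟨hz1, hz2⟩
      refine hεΩ ⟨?_, fun hzq => ?_⟩
      · rw [mem_ball_iff_norm]
        have := norm_sub_le_norm_sub_add_norm_sub z e q
        linarith
      · rw [mem_singleton_iff.1 hzq, norm_sub_rev] at hz1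
        linarith
    have hmem : ∀ r, 5 / 4 * d < r → r < 11 / 8 * d → ∀ z ∈ Metric.sphere e r, z ∈ Ω :=
      fun r hr1 hr2 z hz => hann (by
        rw [mem_sphere_iff_norm] at hz
        exact ⟨by rw [hz]; exact hr1.le, by rw [hz]; exact hr2.le⟩)
    have hfin := henergy.ofReal_log_le (c := e) (r₁ := 5 / 4 * d) (r₂ := 11 / 8 * d)
      (by positivity) (by linarith) hann (fun r hr1 hr2 => by
        -- The preimage of the inner disk joins e to e', and that of the exterior joins q to -q;
        -- both must cross the circle, giving the values 0 and 1 of u.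
        obtain ⟨z₁, hz₁, w, hw, hwz⟩ := exists_mem_sphere_of_isPreconnected
          (g.isPreconnected_preimage.2 hB) (c := e) (r := r) (x := e) (y := e') he
          (by rw [sub_self, norm_zero]; linarith) he' (by rw [norm_sub_rev]; linarith)
        obtain ⟨z₂, hz₂, hz₂P⟩ := exists_mem_sphere_of_isPreconnected
          (g.isPreconnected_preimage.2 hP) (c := e) (r := r) (x := q) (y := -q)
          (by rw [mem_preimage, hgq]; exact hP_infty)
          (by rw [norm_sub_rev]; linarith)
          (by
            rw [mem_preimage, hqG, hPw]
            have := norm_sub_norm_le (G x) (G (-q))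
            rw [norm_sub_rev] at this
            linarith)
          (by
            have := norm_sub_le_norm_sub_add_norm_sub (-q) e q
            rw [hq2] at this
            linarith)
        refine ⟨z₁, hz₁, z₂, hz₂, hu0 _ ?_, hu1 _ ?_⟩
        · rw [hF _ (hmem r hr1 hr2 z₁ hz₁)] at hwz
          rw [← OnePoint.coe_injective hwz, ← mem_closedBall_iff_norm]
          exact hw
        · rw [mem_preimage, hF _ (hmem r hr1 hr2 z₂ hz₂), hPw] at hz₂P
          exact hz₂P)
    have hratio : 11 / 8 * d / (5 / 4 * d) = 11 / 10 := by field_simp; norm_num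
    rw [hratio, ← ENNReal.ofReal_mul hK, ENNReal.ofReal_le_ofReal_iff (by positivity),
      one_div_mul_eq_div, div_le_iff₀ (by positivity), ← mul_div_assoc, div_mul_eq_mul_div,
      le_div_iff₀ hΛ0] at hfin
    have : Real.log (11 / 10) * Λ = 8 * Real.pi * (K * C₀) + Real.log (11 / 10) := by
      rw [hΛ, mul_add, mul_one, mul_div_cancel₀ _ hlog.ne']
    linarith
  have hxC : g x ∈ (fun z : ℂ => (z : OnePoint ℂ)) '' Metric.closedBall (G x) (2 * h) :=
    ⟨G x, Metric.mem_closedBall_self (by positivity), hxG.symm⟩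
  have hyC : g y ∈ (fun z : ℂ => (z : OnePoint ℂ)) '' Metric.closedBall (G x) (2 * h) :=
    ⟨G y, by rwa [mem_closedBall_iff_norm], hyG.symm⟩
  rcases hxy with hxy | hxy
  · exact hmain x y hxC hyC hx0 (hxα.trans_lt hα.2) hxy
  · exact hmain y x hyC hxC hy0 (hyβ.trans_lt hβ.2) hxy

/-! ### The composed map and the theorem -/

/-- Energy distortion of the composition of two quasiconformal maps and a conformal map. -/
theorem hasEnergyLE_comp_planarRestriction {f φ m : OnePoint ℂ ≃ₜ OnePoint ℂ} {K L : ℝ}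
    (hf : IsPlanarQuasiconformal K (planarRestriction f))
    (hφ : IsPlanarQuasiconformal L (planarRestriction φ))
    (hm : DifferentiableOn ℂ (planarRestriction m) (planarRestriction m).source) {q : ℂ} :
    ∃ Ω ∈ 𝓝[≠] q, ∃ F : ℂ → ℂ, (∀ z ∈ Ω, m (φ (f z)) = F z) ∧
      ∀ (u : ℂ → ℝ) (E : ℝ≥0∞), ContDiff ℝ 1 u → E ≠ ⊤ →
        ∫⁻ w, ‖fderiv ℝ u w‖ₑ ^ 2 ≤ E → HasEnergyLE Ω (ENNReal.ofReal (K * L) * E) (u ∘ F) := by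
  set f' := planarRestriction f
  set φ' := planarRestriction φ
  set m' := planarRestriction m
  set Ω₂ := φ'.source ∩ φ' ⁻¹' (m'.source ∩ φ'.target) with hΩ₂
  have hΩ₂o : IsOpen Ω₂ :=
    φ'.isOpen_inter_preimage (m'.open_source.inter φ'.open_target)
  -- A homeomorphism sends only one point to ∞, so each stage of the composition stays finite on a
  -- punctured neighbourhood of q, whatever happens at q.
  have hbad : ∀ (j : OnePoint ℂ ≃ₜ OnePoint ℂ), ∀ᶠ z : ℂ in 𝓝[≠] q, j z ≠ (∞ : OnePoint ℂ) := by
    intro j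
    have hfin : {z : ℂ | j z = (∞ : OnePoint ℂ)}.Subsingleton := fun z hz w hw =>
      OnePoint.coe_injective (j.injective (hz.trans hw.symm))
    have hnhds : ({z : ℂ | j z = (∞ : OnePoint ℂ)} \ {q})ᶜ ∈ 𝓝 q :=
      ((hfin.anti sdiff_subset).finite.isClosed.isOpen_compl).mem_nhds fun h => h.2 rfl
    filter_upwards [self_mem_nhdsWithin, mem_nhdsWithin_of_mem_nhds hnhds] with z hzq hz hj
    exact hz ⟨hj, hzq⟩
  have hvf : ∀ z : ℂ, f z ≠ (∞ : OnePoint ℂ) → ((f' z : ℂ) : OnePoint ℂ) = f z :=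
    fun z hz => coe_planarRestriction f z hz
  have hvφ : ∀ z : ℂ, φ z ≠ (∞ : OnePoint ℂ) → ((φ' z : ℂ) : OnePoint ℂ) = φ z :=
    fun z hz => coe_planarRestriction φ z hz
  have hvm : ∀ z : ℂ, m z ≠ (∞ : OnePoint ℂ) → ((m' z : ℂ) : OnePoint ℂ) = m z :=
    fun z hz => coe_planarRestriction m z hz
  refine ⟨f'.source ∩ f' ⁻¹' (Ω₂ ∩ f'.target), ?_, m' ∘ φ' ∘ f', ?_, ?_⟩
  · filter_upwards [hbad f, hbad (f.trans φ), hbad ((f.trans φ).trans m)] with z h1 h2 h3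
    rw [Homeomorph.trans_apply] at h2
    rw [Homeomorph.trans_apply, Homeomorph.trans_apply] at h3
    have hs1 : z ∈ f'.source := (mem_planarRestriction_source f z).2 h1
    rw [← hvf z h1] at h2 h3
    have hs2 : f' z ∈ φ'.source := (mem_planarRestriction_source φ _).2 h2
    rw [← hvφ _ h2] at h3
    have hs3 : φ' (f' z) ∈ m'.source := (mem_planarRestriction_source m _).2 h3
    exact ⟨hs1, ⟨hs2, hs3, φ'.map_source hs2⟩, f'.map_source hs1⟩
  · rintro z ⟨hs1, ⟨hs2, hs3, -⟩, -⟩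
    rw [← hvf z ((mem_planarRestriction_source f z).1 hs1),
      ← hvφ _ ((mem_planarRestriction_source φ _).1 hs2),
      ← hvm _ ((mem_planarRestriction_source m _).1 hs3)]
    rfl
  · intro u E hu hE hle
    have h1 := hasEnergyLE_comp_of_differentiableOn hm hu hle
    have h2 := hφ.hasEnergyLE_comp m'.open_source hE h1
    have h3 := hf.hasEnergyLE_comp hΩ₂o (ENNReal.mul_ne_top ENNReal.ofReal_ne_top hE) h2
    rw [ENNReal.ofReal_mul (zero_le_one.trans hf.1), mul_assoc]
    exact h3

theorem exists_norm_eq_one_of_mem_frontier {f : OnePoint ℂ ≃ₜ OnePoint ℂ} {x : OnePoint ℂ}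
    (hx : x ∈ frontier (f '' ((fun z : ℂ => (z : OnePoint ℂ)) '' Metric.ball (0 : ℂ) 1))) :
    ∃ q : ℂ, ‖q‖ = 1 ∧ f q = x := by
  rw [← f.image_frontier] at hx
  obtain ⟨y, hy, rfl⟩ := hx
  have hcl : IsClosed ((fun z : ℂ => (z : OnePoint ℂ)) '' Metric.closedBall (0 : ℂ) 1) :=
    ((isCompact_closedBall (0 : ℂ) 1).image OnePoint.continuous_coe).isClosed
  obtain ⟨q, hq, rfl⟩ := closure_minimal (image_mono Metric.ball_subset_closedBall) hcl hy.1
  refine ⟨q, le_antisymm (mem_closedBall_zero_iff.1 hq) ?_, rfl⟩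
  by_contra! hcon
  refine hy.2 ?_
  rw [(OnePoint.isOpenEmbedding_coe.isOpenMap _ Metric.isOpen_ball).interior_eq]
  exact ⟨q, mem_ball_zero_iff.2 hcon, rfl⟩

/-- An open set disjoint from f(𝔻) is disjoint from its closure, which contains the image of the
closed disk. -/
theorem apply_notMem_of_disjoint_of_mem_closedBall {f : OnePoint ℂ ≃ₜ OnePoint ℂ}
    {U : Set (OnePoint ℂ)} (hU : IsOpen U)
    (hd : Disjoint (f '' ((fun z : ℂ => (z : OnePoint ℂ)) '' Metric.ball (0 : ℂ) 1)) U) {z : ℂ}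
    (hz : z ∈ Metric.closedBall (0 : ℂ) 1) : f z ∉ U := by
  have h1 := hd.closure_left hU
  refine fun hzU => disjoint_left.1 h1 ?_ hzU
  have h2 : z ∈ closure (Metric.ball (0 : ℂ) 1) := by
    rwa [closure_ball _ one_ne_zero]
  rw [image_image]
  exact image_closure_subset_closure_image (f.continuous.comp OnePoint.continuous_coe)
    ⟨z, h2, rfl⟩

end

/-- No room for three. -/
theorem lemma3p2 (U V W : Set (OnePoint ℂ))
    (hU : IsJordanRegion U) (hV : IsJordanRegion V) (hUV : Disjoint U V)
    (hcirc : IsQCCircularizable U V)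
    (hW : IsJordanRegion W) (hWUV : W ⊆ (U ∪ V)ᶜ)
    (hne : (frontier W ∩ frontier U ∩ frontier V).Nonempty) :
    ¬ IsQuasidisk W := by
  rintro ⟨f, ⟨K, hf⟩, rfl⟩
  obtain ⟨φ, ⟨L, hφ⟩, hφU, hφV⟩ := hcirc
  obtain ⟨x, ⟨hxW, hxU⟩, hxV⟩ := hne
  obtain ⟨q, hq, rfl⟩ := exists_norm_eq_one_of_mem_frontier hxW
  obtain ⟨m, hmp, hm, hhalf⟩ := exists_mobius (φ (f q))
  obtain ⟨β₁, hβ₁, c₁, h₁⟩ := hhalf _ hφU (φ.image_frontier U ▸ mem_image_of_mem φ hxU)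
  obtain ⟨β₂, hβ₂, c₂, h₂⟩ := hhalf _ hφV (φ.image_frontier V ▸ mem_image_of_mem φ hxV)
  obtain ⟨n, hn, h, hh, hstrip⟩ := exists_strip hβ₁ hβ₂ (c₁ := c₁) (c₂ := c₂)
    fun ζ hζ hζ₁ hζ₂ => by
      obtain ⟨_, ⟨a, ha, rfl⟩, haζ⟩ := h₁ ζ hζ hζ₁
      obtain ⟨_, ⟨b, hb, rfl⟩, hbζ⟩ := h₂ ζ hζ hζ₂
      have hab := φ.injective (m.injective (haζ.trans hbζ.symm))
      exact disjoint_left.1 hUV ha (hab ▸ hb)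
  obtain ⟨Ω, hΩ, F, hF, hE⟩ := hasEnergyLE_comp_planarRestriction hf hφ hm (q := q)
  have hdisj := disjoint_left.2 fun z (hz : z ∈ _) => hWUV hz
  -- The image of the closed disk avoids m(φ(U)) and m(φ(V)), hence the half-planes inside them,
  -- except possibly at ζ = 0.
  have key : ∀ (D : Set (OnePoint ℂ)) (β : ℂ) (c : ℝ), IsOpen D → D ⊆ U ∪ V →
      (∀ ζ : ℂ, ζ ≠ 0 → (β * ζ).re < c → (ζ : OnePoint ℂ) ∈ m '' (φ '' D)) →
      ∀ z ∈ Metric.closedBall (0 : ℂ) 1, ∀ ζ : ℂ, m (φ (f z)) = ζ → ζ ≠ 0 →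
        c ≤ (β * ζ).re := by
    intro D β c hD hDUV hDhalf z hz ζ hζ hζ0
    by_contra! hcon
    obtain ⟨_, ⟨a, ha, rfl⟩, haζ⟩ := hDhalf ζ hζ0 hcon
    have hza := φ.injective (m.injective (haζ.trans hζ.symm))
    exact apply_notMem_of_disjoint_of_mem_closedBall hD (hdisj.mono_right hDUV) hz (hza ▸ ha)
  refine false_of_strip_of_hasEnergyLE (g := (f.trans φ).trans m) hq hmp hn hh ?_ hΩ hF
    (mul_nonneg (zero_le_one.trans hf.1) (zero_le_one.trans hφ.1)) hE
  intro z hz hzq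
  have hfin : m (φ (f z)) ≠ (∞ : OnePoint ℂ) := fun h0 =>
    hzq (OnePoint.coe_injective (f.injective (φ.injective (m.injective (h0.trans hmp.symm)))))
  obtain ⟨ζ, hζ⟩ := OnePoint.ne_infty_iff_exists.1 hfin
  exact ⟨ζ, hζ.symm, hstrip ζ (key U β₁ c₁ hU.1 subset_union_left h₁ z hz ζ hζ.symm)
    (key V β₂ c₂ hV.1 subset_union_right h₂ z hz ζ hζ.symm)⟩
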